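/- **Setting.** Let $\Omega=(l_1,l_2)\times(l_3,l_4)$, let $\psi$ be smooth on $\Omega$, $\Gamma=\{\psi=0\}$ with $\nabla\psi\neq0$ on $\Gamma$, $\Omega^\pm=\{\pm\psi>0\}$, and $\vec n=\nabla\psi/|\nabla\psi|$. Let $a$ and $f$ be smooth in $\Omega^+$ and in $\Omega^-$, with all partial derivatives having one-sided limits on $\Gamma$; let $a$ be positive in $\Omega^\pm$ with positive one-sided limits on $\Gamma$; let $g_1,g_2$ be smooth on $\Omega$. Let $u$ have uniformly continuous partial derivatives of total order $\le5$ in $\Omega^+$ and in $\Omega^-$ and satisfy $$-\nabla\cdot(a\nabla u)=f\ \text{ in }\Omega\setminus\Gamma,\qquad [u]=g_1,\quad [a\nabla u\cdot\vec n]=g_2\ \text{ on }\Gamma,$$ where $[w]$ is the limit of $w$ from $\Omega^+$ minus the limit from $\Omega^-$. A subscript $\pm$ denotes restriction to $\Omega^\pm$, extended to $\Gamma$ by one-sided limits; $w^{(m,n)}$ is $\partial_x^m\partial_y^n w$ at a base point $(x^*,y^*)\in\Gamma$. Write $\Lambda_K=\{(m,n)\in\mathbb N_0^2: m+n\le K\}$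 and $\Lambda_K^1=\{(m,n)\in\Lambda_K: m\le1\}$. **Coefficients ($M=2$).** By the equation and its first derivatives, the $u_\pm^{(m',n')}$ with $(m',n')\in\Lambda_3$ are linear combinations of the $u_\pm^{(m,n)}$, $(m,n)\in\Lambda_3^1$, and the $f_\pm^{(m,n)}$, $(m,n)\in\Lambda_1$, with coefficients depending on the derivatives of $a_\pm$ at the base point. Inserting these in the cubic Taylor polynomial of $u_\pm$ at the base point defines the polynomials $G^\pm_{m,n}$, $H^\pm_{m,n}$: $$\sum_{(m,n)\in\Lambda_3}\frac{u_\pm^{(m,n)}}{m!\,n!}x^my^n=\sum_{(m,n)\in\Lambda_3^1}u_\pm^{(m,n)}G^\pm_{m,n}(x,y)+\sum_{(m,n)\in\Lambda_1}f_\pm^{(m,n)}H^\pm_{m,n}(x,y).$$ Let $\Gamma$ be parametrized near the base point by $(x^*+r(t),y^*+s(t))$, $|t|<\epsilon$, with $r,s$ smooth, $r(0)=s(0)=0$, $r'^2+s'^2>0$, and $(s',-r')$ pointing towards $\Omega^+$. Expanding both jump conditions in $t$ (that of $u$ to order $t^3$, that of the flux to order $t^2$) and solving order by order for $u_-^{(m',n')}$,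 $(m',n')\in\Lambda^1_3$, gives the transmission coefficients $T$: $$u_-^{(m',n')}=\sum_{\Lambda_3^1}T^{u_+}_{m',n',m,n}u_+^{(m,n)}+\sum_{\Lambda_1}\bigl(T^{+}_{m',n',m,n}f_+^{(m,n)}+T^{-}_{m',n',m,n}f_-^{(m,n)}\bigr)+\sum_{\Lambda_3}T^{g_1}_{m',n',m,n}g_1^{(m,n)}+\sum_{\Lambda_2}T^{g_2}_{m',n',m,n}g_2^{(m,n)}.$$ For a centre $(x_i,y_j)=(x^*+v_0h,y^*+w_0h)$ with $-1<v_0,w_0<1$, let $d^+$ (resp. $d^-$) be the set of $(k,\ell)\in\{-1,0,1\}^2$ with $\psi(x_i+kh,y_j+\ell h)\ge0$ (resp. $<0$); the centre is irregular if both are nonempty. For polynomials $C_{k,\ell}(h)$ and a unit vector $e$ put $$I^\pm_{m,n}=\sum_{d^\pm}C_{k,\ell}(h)G^\pm_{m,n}((v_0+k)h,(w_0+\ell)h),\qquad J^{\pm,0}_{m,n}=\sum_{d^\pm}C_{k,\ell}(h)H^\pm_{m,n}((v_0+k)h,(w_0+\ell)h),$$ $$I_{m,n}=I^+_{m,n}+\sum_{\Lambda^1_3}I^-_{m',n'}T^{u_+}_{m',n',m,n}-h\,\nabla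 G^+_{m,n}(v_0h,w_0h)\cdot e,$$ $$J^+_{m,n}=J^{+,0}_{m,n}+\sum_{\Lambda^1_3}I^-_{m',n'}T^+_{m',n',m,n}-h\,\nabla H^+_{m,n}(v_0h,w_0h)\cdot e,\qquad J^-_{m,n}=J^{-,0}_{m,n}+\sum_{\Lambda^1_3}I^-_{m',n'}T^-_{m',n',m,n},$$ $$J^{g_1}_{m,n}=\sum_{\Lambda^1_3}I^-_{m',n'}T^{g_1}_{m',n',m,n},\qquad J^{g_2}_{m,n}=\sum_{\Lambda^1_3}I^-_{m',n'}T^{g_2}_{m',n',m,n},$$ the sums over $\Lambda_3^1$ being over $(m',n')$. A *nontrivial solution of the $M=2$ system in the direction $e$* is a family of polynomials $C_{k,\ell}$ of degree at most $3$, with $C_{k,\ell}(0)\ne0$ for some $(k,\ell)$, such that, with $v_0,w_0,d^\pm$ and the base point fixed, $I_{m,n}(h)=\mathcal O(h^4)$ as $h\to0$ for all $(m,n)\in\Lambda^1_3$. **Theorem.** Let $K\subset\Omega$ be compact and $B\in\mathbb R$. There are $A>0$ and $h_0>0$ such that the following holds for all $0<h<h_0$, all irregular centres $(x_i,y_j)$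 with $\psi(x_i,y_j)\ge0$, all base points $(x^*,y^*)\in\Gamma\cap K$ with $|x_i-x^*|<h$ and $|y_j-y^*|<h$, and all parametrizations as above with $|r^{(k)}(0)|,|s^{(k)}(0)|\le B$ for $k\le3$ and $B\,(r'(0)^2+s'(0)^2)\ge1$. The nine stencil points lie in $\Omega$. If $U_{k,\ell}$ are nodal values with $|U_{k,\ell}-u(x_i+kh,y_j+\ell h)|\le\delta$ for all $k,\ell\in\{-1,0,1\}$, then, for every nontrivial solution of the $M=2$ system in the direction $e=(1,0)$ whose coefficients are bounded by $B$, the quantity $$D=\frac1h\Bigl(\sum_{k,\ell}C_{k,\ell}(h)U_{k,\ell}-\sum_{\Lambda_1}f_+^{(m,n)}J^+_{m,n}(h)-\sum_{\Lambda_1}f_-^{(m,n)}J^-_{m,n}(h)-\sum_{\Lambda_3}g_1^{(m,n)}J^{g_1}_{m,n}(h)-\sum_{\Lambda_2}g_2^{(m,n)}J^{g_2}_{m,n}(h)\Bigr)$$ satisfies $|D-u_x(x_i,y_j)|\le A\,(h^3+\delta/h)$; and for every such solution in the direction $e=(0,1)$, it satisfies $|D-u_y(x_i,y_j)|\le A\,(h^3+\delta/h)$.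 In particular, both formulas are third-order accurate for exact nodal values ($\delta=0$). (At a grid point on $\Gamma$, $u$, $u_x$, $u_y$ are the limits from $\Omega^+$.) -/

import Mathlib

open Filter Topology Set Asymptotics
open scoped ContDiff

namespace EllipticInterface

noncomputable section

/-! ### Partial derivatives, one-sided limits, index sets -/

/-- `∂w/∂x` for a function of `(x, y)`. -/
def dX (w : ℝ × ℝ → ℝ) (p : ℝ × ℝ) : ℝ := deriv (fun t => w (t, p.2)) p.1

/-- `∂w/∂y` for a function of `(x, y)`. -/
def dY (w : ℝ × ℝ → ℝ) (p : ℝ × ℝ) : ℝ := deriv (fun t => w (p.1, t)) p.2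

/-- `∂^{m+n} w / ∂x^m ∂y^n`. -/
def pd (m n : ℕ) (w : ℝ × ℝ → ℝ) : ℝ × ℝ → ℝ := dX^[m] (dY^[n] w)

/-- The one-sided limit `lim_{q ∈ S, q → p} w q`. -/
def trace (S : Set (ℝ × ℝ)) (w : ℝ × ℝ → ℝ) (p : ℝ × ℝ) : ℝ := limUnder (𝓝[S] p) w

/-- The partial derivatives of `w|_S` at `p` (a point of `S` or of its boundary), as one-sided
limits from `S`. -/
def sideJet (S : Set (ℝ × ℝ)) (w : ℝ × ℝ → ℝ) (p : ℝ × ℝ) (m n : ℕ) : ℝ := trace S (pd m n w) p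

/-- `Λ_K = {(m, n) : m + n ≤ K}`. -/
def Lam (K : ℕ) : Finset (ℕ × ℕ) :=
  (Finset.range (K + 1) ×ˢ Finset.range (K + 1)).filter (fun q => q.1 + q.2 ≤ K)

/-- `Λ¹_K = {(m, n) ∈ Λ_K : m ≤ 1}`. -/
def Lam1 (K : ℕ) : Finset (ℕ × ℕ) := (Lam K).filter (fun q => q.1 ≤ 1)

/-- `Λ²_K = Λ_K \ Λ¹_K`. -/
def Lam2 (K : ℕ) : Finset (ℕ × ℕ) := Lam K \ Lam1 K

/-! ### The elliptic interface problem -/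

/-- The data of the problem `-∇·(a∇u) = f` in `Ω \ Γ`, `[u] = g₁` and `[a∇u·n] = g₂` on `Γ`,
in the rectangle `Ω = (l₁, l₂) × (l₃, l₄)`, with the level-set function `ψ`. -/
structure Problem where
  (l₁ l₂ l₃ l₄ : ℝ)
  (ψ a f g₁ g₂ : ℝ × ℝ → ℝ)

namespace Problem

variable (P : Problem)

/-- The rectangle `Ω`. -/
def Om : Set (ℝ × ℝ) := Ioo P.l₁ P.l₂ ×ˢ Ioo P.l₃ P.l₄

/-- The interface `Γ`. -/
def Gam : Set (ℝ × ℝ) := {p | p ∈ P.Om ∧ P.ψ p = 0}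

/-- `Ω⁺`. -/
def OmP : Set (ℝ × ℝ) := {p | p ∈ P.Om ∧ 0 < P.ψ p}

/-- `Ω⁻`. -/
def OmM : Set (ℝ × ℝ) := {p | p ∈ P.Om ∧ P.ψ p < 0}

/-- The unit normal `∇ψ / |∇ψ|` of `Γ`, pointing towards `Ω⁺`. -/
def normal (p : ℝ × ℝ) : ℝ × ℝ :=
  (dX P.ψ p / Real.sqrt (dX P.ψ p ^ 2 + dY P.ψ p ^ 2),
   dY P.ψ p / Real.sqrt (dX P.ψ p ^ 2 + dY P.ψ p ^ 2))

/-- `w` is smooth in the subregion `S`, up to the interface: it is `C^∞` in `S`, and each of its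
partial derivatives has a limit from `S` at each point of `Γ`. -/
def SmoothUpToInterface (S : Set (ℝ × ℝ)) (w : ℝ × ℝ → ℝ) : Prop :=
  ContDiffOn ℝ ∞ w S ∧
    ∀ p ∈ P.Gam, ∀ m n : ℕ, ∃ L : ℝ, Tendsto (pd m n w) (𝓝[S] p) (𝓝 L)

/-- The standing assumptions on the data. -/
structure Admissible : Prop where
  width : P.l₁ < P.l₂
  height : P.l₃ < P.l₄
  smooth_psi : ContDiffOn ℝ ∞ P.ψ P.Om
  regular_curve : ∀ p ∈ P.Gam, dX P.ψ p ≠ 0 ∨ dY P.ψ p ≠ 0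
  smooth_a_plus : P.SmoothUpToInterface P.OmP P.a
  smooth_a_minus : P.SmoothUpToInterface P.OmM P.a
  a_pos : ∀ p ∈ P.OmP ∪ P.OmM, 0 < P.a p
  a_pos_plus : ∀ p ∈ P.Gam, 0 < trace P.OmP P.a p
  a_pos_minus : ∀ p ∈ P.Gam, 0 < trace P.OmM P.a p
  smooth_f_plus : P.SmoothUpToInterface P.OmP P.f
  smooth_f_minus : P.SmoothUpToInterface P.OmM P.f
  smooth_g₁ : ContDiffOn ℝ ∞ P.g₁ P.Om
  smooth_g₂ : ContDiffOn ℝ ∞ P.g₂ P.Om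

/-- `u` has uniformly continuous partial derivatives of total order at most five in `S`. -/
def SmoothFive (S : Set (ℝ × ℝ)) (u : ℝ × ℝ → ℝ) : Prop :=
  ContDiffOn ℝ 5 u S ∧ ∀ m n : ℕ, m + n ≤ 5 → UniformContinuousOn (pd m n u) S

/-- `u` is an exact, piecewise smooth solution of the interface problem. Nothing is assumed on
the values of `u` on `Γ`, nor on its boundary values. -/
structure IsSolution (u : ℝ × ℝ → ℝ) : Prop where
  smooth_plus : SmoothFive P.OmP u
  smooth_minus : SmoothFive P.OmM u
  pde : ∀ p ∈ P.OmP ∪ P.OmM,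
    -(dX (fun q => P.a q * dX u q) p + dY (fun q => P.a q * dY u q) p) = P.f p
  jump : ∀ p ∈ P.Gam, trace P.OmP u p - trace P.OmM u p = P.g₁ p
  flux_jump : ∀ p ∈ P.Gam,
    trace P.OmP (fun q => P.a q * (dX u q * (P.normal p).1 + dY u q * (P.normal p).2)) p
      - trace P.OmM (fun q => P.a q * (dX u q * (P.normal p).1 + dY u q * (P.normal p).2)) p
      = P.g₂ p

/-- The exact value of `u` at a grid point; a grid point on `Γ` is counted with `Ω⁺`. -/
def nodeValue (u : ℝ × ℝ → ℝ) (p : ℝ × ℝ) : ℝ :=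
  open Classical in if P.ψ p = 0 then trace P.OmP u p else u p

end Problem

/-! ### Taylor polynomials reduced by the equation (`M = 2`)

A jet at the base point is a function `ℕ → ℕ → ℝ`; `α`, `φ`, `υ` stand for the partial derivatives
of `a`, `f`, `u` there. -/

/-- The jet with a single entry `1`, at `(m, n)`. -/
def unitJet (m n : ℕ) : ℕ → ℕ → ℝ := fun i j => if i = m ∧ j = n then 1 else 0

/-- `u^{(2,0)}` from `a u_xx + a u_yy + a_x u_x + a_y u_y = -f`. -/
def u20 (α υ φ : ℕ → ℕ → ℝ) : ℝ :=
  -(α 1 0 * υ 1 0 + α 0 1 * υ 0 1) / α 0 0 - υ 0 2 - φ 0 0 / α 0 0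

/-- `u^{(2,1)}` from the `y`-derivative of the equation. -/
def u21 (α υ φ : ℕ → ℕ → ℝ) : ℝ :=
  -(α 0 1 * u20 α υ φ + 2 * α 0 1 * υ 0 2 + α 1 1 * υ 1 0 + α 1 0 * υ 1 1 + α 0 2 * υ 0 1) / α 0 0
    - υ 0 3 - φ 0 1 / α 0 0

/-- `u^{(3,0)}` from the `x`-derivative of the equation. -/
def u30 (α υ φ : ℕ → ℕ → ℝ) : ℝ :=
  -(2 * α 1 0 * u20 α υ φ + α 1 0 * υ 0 2 + α 2 0 * υ 1 0 + α 1 1 * υ 0 1 + α 0 1 * υ 1 1) / α 0 0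
    - υ 1 2 - φ 1 0 / α 0 0

/-- The derivatives `u^{(m,n)}`, `(m,n) ∈ Λ_3`, expressed through those with `(m,n) ∈ Λ¹_3`
(the entries of `υ`) and through the jets of `a` and `f`. -/
def reduced (α υ φ : ℕ → ℕ → ℝ) (m n : ℕ) : ℝ :=
  if m = 2 ∧ n = 0 then u20 α υ φ
  else if m = 2 ∧ n = 1 then u21 α υ φ
  else if m = 3 ∧ n = 0 then u30 α υ φ
  else υ m n

/-- `A^u_{m',n',m,n}`: the coefficient of `u^{(m,n)}` in `u^{(m',n')}`. -/
def Au (α : ℕ → ℕ → ℝ) (m' n' m n : ℕ) : ℝ := reduced α (unitJet m n) (fun _ _ => 0) m' n'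

/-- `A^f_{m',n',m,n}`: the coefficient of `f^{(m,n)}` in `u^{(m',n')}`. -/
def Af (α : ℕ → ℕ → ℝ) (m' n' m n : ℕ) : ℝ := reduced α (fun _ _ => 0) (unitJet m n) m' n'

/-- `x^m y^n / (m! n!)`. -/
def mono (m n : ℕ) (p : ℝ × ℝ) : ℝ :=
  p.1 ^ m * p.2 ^ n / ((Nat.factorial m : ℝ) * (Nat.factorial n : ℝ))

/-- The polynomial `G_{m,n}`, for `(m,n) ∈ Λ¹_3`. -/
def G (α : ℕ → ℕ → ℝ) (m n : ℕ) (p : ℝ × ℝ) : ℝ :=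
  (∑ l ∈ Finset.range (n / 2 + 1), (-1 : ℝ) ^ l * mono (m + 2 * l) (n - 2 * l) p)
    + ∑ q ∈ Lam2 3 \ Lam2 (m + n), Au α q.1 q.2 m n * mono q.1 q.2 p

/-- The polynomial `H_{m,n}`, for `(m,n) ∈ Λ_1`. -/
def H (α : ℕ → ℕ → ℝ) (m n : ℕ) (p : ℝ × ℝ) : ℝ :=
  (∑ l ∈ Finset.Icc 1 (1 + n / 2),
      (-1 : ℝ) ^ l * mono (m + 2 * l) (n + 2 - 2 * l) p * (1 / α 0 0))
    + ∑ q ∈ Lam2 3 \ Lam2 (m + n + 2), Af α q.1 q.2 m n * mono q.1 q.2 p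

/-! ### Transmission coefficients -/

/-- What the transmission coefficients are made of: the jets of `a_±` at the base point and a
parametrization `(x^* + r(t), y^* + s(t))` of `Γ`, with `r(0) = s(0) = 0`. -/
structure LocalGeometry where
  (αP αM : ℕ → ℕ → ℝ)
  (r s : ℝ → ℝ)

/-- The jets which determine the jet of `u_-`. -/
structure JetData where
  (uP fP fM g₁ g₂ : ℕ → ℕ → ℝ)

/-- All jets zero. -/
def JetData.zero : JetData :=
  ⟨fun _ _ => 0, fun _ _ => 0, fun _ _ => 0, fun _ _ => 0, fun _ _ => 0⟩

/-- The `p`-th Taylor coefficient at `0`. -/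
def coeffAt (w : ℝ → ℝ) (p : ℕ) : ℝ := iteratedDeriv p w 0 / (Nat.factorial p : ℝ)

namespace LocalGeometry

variable (L : LocalGeometry)

/-- The Taylor polynomial of degree two of `a_±`. -/
def taylorA (α : ℕ → ℕ → ℝ) (p : ℝ × ℝ) : ℝ := ∑ q ∈ Lam 2, α q.1 q.2 * mono q.1 q.2 p

/-- The Taylor coefficients in `t` of `w(r(t), s(t))`. -/
def along (w : ℝ × ℝ → ℝ) (p : ℕ) : ℝ := coeffAt (fun t => w (L.r t, L.s t)) p

/-- The Taylor coefficients in `t` of `(a ∇w)(r(t), s(t)) · (s'(t), -r'(t))`. -/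
def fluxAlong (α : ℕ → ℕ → ℝ) (w : ℝ × ℝ → ℝ) (p : ℕ) : ℝ :=
  coeffAt (fun t => taylorA α (L.r t, L.s t) *
    (dX w (L.r t, L.s t) * deriv L.s t - dY w (L.r t, L.s t) * deriv L.r t)) p

/-- The Taylor coefficients in `t` of `w(r(t), s(t)) |(r'(t), s'(t))|`. -/
def speedAlong (w : ℝ × ℝ → ℝ) (p : ℕ) : ℝ :=
  coeffAt (fun t => w (L.r t, L.s t) * Real.sqrt (deriv L.r t ^ 2 + deriv L.s t ^ 2)) p

/-- The part of order `p` of `[u]` that comes from the data `f_±` and `g₁`. -/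
def dataF (D : JetData) (p : ℕ) : ℝ :=
  (∑ q ∈ Lam 1, (D.fM q.1 q.2 * L.along (H L.αM q.1 q.2) p
      - D.fP q.1 q.2 * L.along (H L.αP q.1 q.2) p))
    + ∑ q ∈ Lam 3, D.g₁ q.1 q.2 * L.along (mono q.1 q.2) p

/-- The part of order `p` of the flux jump that comes from the data `f_±` and `g₂`. -/
def dataG (D : JetData) (p : ℕ) : ℝ :=
  (∑ q ∈ Lam 1, (D.fM q.1 q.2 * L.fluxAlong L.αM (H L.αM q.1 q.2) p
      - D.fP q.1 q.2 * L.fluxAlong L.αP (H L.αP q.1 q.2) p))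
    + ∑ q ∈ Lam 2, D.g₂ q.1 q.2 * L.speedAlong (mono q.1 q.2) p

/-- Right side for the unknowns `u_-^{(0,p)}`, `u_-^{(1,p-1)}` in the jump of `u` at order `p`;
`w` holds the entries of `u_-` of lower order. -/
def rhsU (D : JetData) (w : ℕ → ℕ → ℝ) (p : ℕ) : ℝ :=
  (∑ q ∈ Lam1 p, D.uP q.1 q.2 * L.along (G L.αP q.1 q.2) p)
    - (∑ q ∈ Lam1 (p - 1), w q.1 q.2 * L.along (G L.αM q.1 q.2) p) - L.dataF D p

/-- Right side for the same unknowns in the jump of the flux at order `p - 1`. -/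
def rhsFlux (D : JetData) (w : ℕ → ℕ → ℝ) (p : ℕ) : ℝ :=
  (∑ q ∈ Lam1 p, D.uP q.1 q.2 * L.fluxAlong L.αP (G L.αP q.1 q.2) (p - 1))
    - (∑ q ∈ Lam1 (p - 1), w q.1 q.2 * L.fluxAlong L.αM (G L.αM q.1 q.2) (p - 1))
    - L.dataG D (p - 1)

/-- The determinant of the two-by-two system for `u_-^{(0,p)}`, `u_-^{(1,p-1)}`. -/
def det (p : ℕ) : ℝ :=
  L.along (G L.αM 0 p) p * L.fluxAlong L.αM (G L.αM 1 (p - 1)) (p - 1)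
    - L.along (G L.αM 1 (p - 1)) p * L.fluxAlong L.αM (G L.αM 0 p) (p - 1)

/-- The entries `u_-^{(m,n)}`, `(m,n) ∈ Λ¹_p`, computed order by order from the jump conditions. -/
def minusJet (D : JetData) : ℕ → ℕ → ℕ → ℝ
  | 0 => fun m n => if m = 0 ∧ n = 0 then D.uP 0 0 - D.g₁ 0 0 else 0
  | p + 1 => fun m n =>
      let w := minusJet D p
      if m = 0 ∧ n = p + 1 then
        (L.fluxAlong L.αM (G L.αM 1 p) p * L.rhsU D w (p + 1)
          - L.along (G L.αM 1 p) (p + 1) * L.rhsFlux D w (p + 1)) / L.det (p + 1)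
      else if m = 1 ∧ n = p then
        (L.along (G L.αM 0 (p + 1)) (p + 1) * L.rhsFlux D w (p + 1)
          - L.fluxAlong L.αM (G L.αM 0 (p + 1)) p * L.rhsU D w (p + 1)) / L.det (p + 1)
      else w m n

/-- `T^{u_+}_{m',n',m,n}`: the coefficient of `u_+^{(m,n)}` in `u_-^{(m',n')}`. -/
def TU (m' n' m n : ℕ) : ℝ := L.minusJet { JetData.zero with uP := unitJet m n } 3 m' n'

/-- `T^+_{m',n',m,n}`: the coefficient of `f_+^{(m,n)}` in `u_-^{(m',n')}`. -/
def TP (m' n' m n : ℕ) : ℝ := L.minusJet { JetData.zero with fP := unitJet m n } 3 m' n'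

/-- `T^-_{m',n',m,n}`: the coefficient of `f_-^{(m,n)}` in `u_-^{(m',n')}`. -/
def TM (m' n' m n : ℕ) : ℝ := L.minusJet { JetData.zero with fM := unitJet m n } 3 m' n'

/-- `T^{g_1}_{m',n',m,n}`: the coefficient of `g_1^{(m,n)}` in `u_-^{(m',n')}`. -/
def TG1 (m' n' m n : ℕ) : ℝ := L.minusJet { JetData.zero with g₁ := unitJet m n } 3 m' n'

/-- `T^{g_2}_{m',n',m,n}`: the coefficient of `g_2^{(m,n)}` in `u_-^{(m',n')}`. -/
def TG2 (m' n' m n : ℕ) : ℝ := L.minusJet { JetData.zero with g₂ := unitJet m n } 3 m' n'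

end LocalGeometry

/-! ### The nine-point stencil and the system for the coefficients -/

/-- The indices `(k, l) ∈ {-1, 0, 1}²`. -/
def stencil : Finset (ℤ × ℤ) := Finset.Icc (-1) 1 ×ˢ Finset.Icc (-1) 1

/-- The stencil point `(x_i + k h, y_j + l h)` around the centre `c = (x_i, y_j)`. -/
def node (c : ℝ × ℝ) (h : ℝ) (kl : ℤ × ℤ) : ℝ × ℝ := (c.1 + kl.1 * h, c.2 + kl.2 * h)

/-- A splitting of the stencil: the local geometry at the base point `(x^*, y^*)`, the offset
`(v₀, w₀)` with `(x_i, y_j) = (x^* + v₀ h, y^* + w₀ h)`, and the index sets `d^±`. -/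
structure Split where
  L : LocalGeometry
  (v₀ w₀ : ℝ)
  (dP dM : Finset (ℤ × ℤ))

namespace Split

variable (S : Split) (C : ℤ × ℤ → Polynomial ℝ) (e : ℝ × ℝ)

/-- The stencil point `(v₀ h + k h, w₀ h + l h)` relative to the base point. -/
def rel (h : ℝ) (kl : ℤ × ℤ) : ℝ × ℝ := (S.v₀ * h + kl.1 * h, S.w₀ * h + kl.2 * h)

/-- `I^+_{m,n}(h)`. -/
def IP (m n : ℕ) (h : ℝ) : ℝ := ∑ kl ∈ S.dP, (C kl).eval h * G S.L.αP m n (S.rel h kl)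

/-- `I^-_{m,n}(h)`. -/
def IM (m n : ℕ) (h : ℝ) : ℝ := ∑ kl ∈ S.dM, (C kl).eval h * G S.L.αM m n (S.rel h kl)

/-- `J^{+,0}_{m,n}(h)`. -/
def JP0 (m n : ℕ) (h : ℝ) : ℝ := ∑ kl ∈ S.dP, (C kl).eval h * H S.L.αP m n (S.rel h kl)

/-- `J^{-,0}_{m,n}(h)`. -/
def JM0 (m n : ℕ) (h : ℝ) : ℝ := ∑ kl ∈ S.dM, (C kl).eval h * H S.L.αM m n (S.rel h kl)

/-- `∑_{(m',n') ∈ Λ¹_3} I^-_{m',n'}(h) T_{m',n',m,n}`. -/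
def transfer (T : ℕ → ℕ → ℕ → ℕ → ℝ) (m n : ℕ) (h : ℝ) : ℝ :=
  ∑ q ∈ Lam1 3, S.IM C q.1 q.2 h * T q.1 q.2 m n

/-- `h ∇w(v₀ h, w₀ h) · e`. -/
def directional (w : ℝ × ℝ → ℝ) (h : ℝ) : ℝ :=
  h * (dX w (S.v₀ * h, S.w₀ * h) * e.1 + dY w (S.v₀ * h, S.w₀ * h) * e.2)

/-- `I_{m,n}(h) = I^+_{m,n}(h) + J^{u_+,T}_{m,n}(h) - I^{+,θ}_{m,n}(h)`, `e = (cos θ, sin θ)`. -/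
def I (m n : ℕ) (h : ℝ) : ℝ :=
  S.IP C m n h + S.transfer C S.L.TU m n h - S.directional e (G S.L.αP m n) h

/-- `J^+_{m,n}(h) = J^{+,0}_{m,n}(h) + J^{+,T}_{m,n}(h) - J^{+,θ}_{m,n}(h)`. -/
def JP (m n : ℕ) (h : ℝ) : ℝ :=
  S.JP0 C m n h + S.transfer C S.L.TP m n h - S.directional e (H S.L.αP m n) h

/-- `J^-_{m,n}(h) = J^{-,0}_{m,n}(h) + J^{-,T}_{m,n}(h)`. -/
def JM (m n : ℕ) (h : ℝ) : ℝ := S.JM0 C m n h + S.transfer C S.L.TM m n h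

/-- `J^{g_1}_{m,n}(h)`. -/
def JG1 (m n : ℕ) (h : ℝ) : ℝ := S.transfer C S.L.TG1 m n h

/-- `J^{g_2}_{m,n}(h)`. -/
def JG2 (m n : ℕ) (h : ℝ) : ℝ := S.transfer C S.L.TG2 m n h

/-- `{C_{k,l}}` is a nontrivial solution of the system with `M = 2` in the direction `e`:
polynomials of degree less than `M + 2`, not all vanishing at `h = 0`, such that
`I_{m,n}(h) = O(h^{M+2})` as `h → 0` for all `(m,n) ∈ Λ¹_{M+1}` (the splitting being fixed). -/
structure IsNontrivialSolution : Prop where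
  degree : ∀ kl ∈ stencil, (C kl).natDegree < 4
  nontrivial : ∃ kl ∈ stencil, (C kl).eval 0 ≠ 0
  system : ∀ q ∈ Lam1 3, (fun τ : ℝ => S.I C e q.1 q.2 τ) =O[𝓝[>] 0] (fun τ : ℝ => τ ^ 4)

/-- The compact formula for the derivative in the direction `e`, from nodal values `U` and the
jets at the base point of `f_±`, `g_1`, `g_2`. -/
def gradFormula (h : ℝ) (U : ℤ × ℤ → ℝ) (fP fM g₁ g₂ : ℕ → ℕ → ℝ) : ℝ :=
  (∑ kl ∈ stencil, 1 / h * (C kl).eval h * U kl)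
    - (∑ q ∈ Lam 1, 1 / h * fP q.1 q.2 * S.JP C e q.1 q.2 h)
    - (∑ q ∈ Lam 1, 1 / h * fM q.1 q.2 * S.JM C q.1 q.2 h)
    - (∑ q ∈ Lam 3, 1 / h * g₁ q.1 q.2 * S.JG1 C q.1 q.2 h)
    - (∑ q ∈ Lam 2, 1 / h * g₂ q.1 q.2 * S.JG2 C q.1 q.2 h)

end Split

namespace Problem

variable (P : Problem)

/-- `d^+`: the indices of the stencil points with `ψ ≥ 0`. -/
def dPlus (c : ℝ × ℝ) (h : ℝ) : Finset (ℤ × ℤ) :=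
  open Classical in stencil.filter (fun kl => 0 ≤ P.ψ (node c h kl))

/-- `d^-`: the indices of the stencil points with `ψ < 0`. -/
def dMinus (c : ℝ × ℝ) (h : ℝ) : Finset (ℤ × ℤ) :=
  open Classical in stencil.filter (fun kl => P.ψ (node c h kl) < 0)

/-- The point `c` is irregular: its stencil has points on both sides. -/
def IsIrregular (c : ℝ × ℝ) (h : ℝ) : Prop :=
  (P.dPlus c h).Nonempty ∧ (P.dMinus c h).Nonempty

/-- `(b.1 + r(t), b.2 + s(t))`, `t ∈ (-ε, ε)`, is a smooth regular parametrization of `Γ` near `b`,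
with `(s', -r')` pointing towards `Ω⁺`. -/
structure IsParam (b : ℝ × ℝ) (r s : ℝ → ℝ) (ε : ℝ) : Prop where
  pos : 0 < ε
  smooth_r : ContDiffOn ℝ ∞ r (Ioo (-ε) ε)
  smooth_s : ContDiffOn ℝ ∞ s (Ioo (-ε) ε)
  r_zero : r 0 = 0
  s_zero : s 0 = 0
  regular : ∀ t ∈ Ioo (-ε) ε, 0 < deriv r t ^ 2 + deriv s t ^ 2
  mem : ∀ t ∈ Ioo (-ε) ε, (b.1 + r t, b.2 + s t) ∈ P.Gam
  orient : 0 < dX P.ψ b * deriv s 0 - dY P.ψ b * deriv r 0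

/-- The splitting at the centre `c` with mesh size `h`, base point `b ∈ Γ` and parametrization
`(r, s)`. -/
def split (c b : ℝ × ℝ) (h : ℝ) (r s : ℝ → ℝ) : Split where
  L := { αP := sideJet P.OmP P.a b, αM := sideJet P.OmM P.a b, r := r, s := s }
  v₀ := (c.1 - b.1) / h
  w₀ := (c.2 - b.2) / h
  dP := P.dPlus c h
  dM := P.dMinus c h

/-- The compact formula with the data of the problem, derivatives taken at the base point `b`. -/
def gradApprox (c b : ℝ × ℝ) (h : ℝ) (r s : ℝ → ℝ) (C : ℤ × ℤ → Polynomial ℝ) (e : ℝ × ℝ)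
    (U : ℤ × ℤ → ℝ) : ℝ :=
  (P.split c b h r s).gradFormula C e h U (sideJet P.OmP P.f b) (sideJet P.OmM P.f b)
    (fun m n => pd m n P.g₁ b) (fun m n => pd m n P.g₂ b)

end Problem

/-- Bounds on a parametrization of the interface at the base point: the derivatives of `r`, `s`
up to order three at `0`, and the speed from below. -/
def ParamBound (B : ℝ) (r s : ℝ → ℝ) : Prop :=
  (∀ k ≤ 3, |iteratedDeriv k r 0| ≤ B ∧ |iteratedDeriv k s 0| ≤ B) ∧
    1 ≤ B * (deriv r 0 ^ 2 + deriv s 0 ^ 2)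

/-- The coefficients of the polynomials `C_{k,l}` are bounded by `B`. -/
def CoeffBound (B : ℝ) (C : ℤ × ℤ → Polynomial ℝ) : Prop :=
  ∀ kl ∈ stencil, ∀ i : ℕ, |(C kl).coeff i| ≤ B

end

end EllipticInterface

/-! The nodal values are compared with the cubic one-sided Taylor polynomials of `u` at the base
point: a node on either side contributes an error `O(h⁴) + δ`. The differentiated equation writes
these polynomials through `G` and `H`, and the jump conditions write the jet of `u_-` through the
jet of `u_+` and the data. After both substitutions the terms in `f_±`, `g₁`, `g₂` are exactly those
subtracted in the formula. What is left is the identity `Split.mul_gradFormula`: `h D` equals the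
weighted errors at the nodes, plus the residuals `I_{m,n}(h)` weighted by the entries of the jet of
`u_+`, plus `h` times the directional derivative of the Taylor polynomial of `u_+` at the centre.
The last term differs from `h ∂_e u` by `O(h⁴)`; division by `h` gives the rate `h³ + δ/h`.

Three points need an argument.

One-sided Taylor expansion. The sides are not convex, and the base point is not in the open side.
Since `∇ψ ≠ 0`, points near the base point can be reached from it by a three-piece path of
comparable length inside the side (`exists_accessible`). Integrating remainders along such paths
gives Taylor's formula with constants independent of the base point (`Accessible.taylor`,
`SmoothUpTo.taylor`).

Transmission. Taylor coefficients along the curve are coefficients of formal power series. The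
equations are triangular in the order of the derivatives, with a two-by-two block at each order `p`.
Its determinant is `a_- (r'² + s'²)^p / (p! (p-1)!)`, which is nonzero
(`LocalGeometry.Smooth.det_eq`). Hence the actual jet of `u_-` is the constructed one
(`IsSolution.minusJet_eq`).

Uniformity. A nontrivial solution satisfies `I_{m,n} = O(h⁴)` only for each fixed configuration,
with no control of the constant. But `I_{m,n}` is a polynomial in `h` whose coefficients are bounded
in terms of the bounds on the curve, on `a_±`, on `1/a_±` and on the coefficients of `C`. The
`O(h⁴)` condition removes its terms of degree at most three, and the remaining ones are uniformly
bounded (`PolyFam.bound`, `exists_residual_bound`).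

The resulting estimate is local in the base point; compactness of `Γ ∩ K` makes it uniform. -/

namespace EllipticInterface

noncomputable section

/-! ### Partial derivatives of smooth functions -/

/-- The differential `vx dx + vy dy`. -/
def gradCLM (vx vy : ℝ) : ℝ × ℝ →L[ℝ] ℝ :=
  vx • ContinuousLinearMap.fst ℝ ℝ ℝ + vy • ContinuousLinearMap.snd ℝ ℝ ℝ

@[simp] lemma gradCLM_apply (vx vy : ℝ) (p : ℝ × ℝ) : gradCLM vx vy p = vx * p.1 + vy * p.2 := by
  simp [gradCLM]

lemma gradCLM_eq (L : ℝ × ℝ →L[ℝ] ℝ) : L = gradCLM (L (1, 0)) (L (0, 1)) := by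
  ext <;> simp

lemma HasFDerivAt.dX_eq {v : ℝ × ℝ → ℝ} {L : ℝ × ℝ →L[ℝ] ℝ} {p : ℝ × ℝ}
    (h : HasFDerivAt v L p) : dX v p = L (1, 0) := by
  have h1 : HasDerivAt (fun t : ℝ => (t, p.2)) ((1 : ℝ), (0 : ℝ)) p.1 :=
    (hasDerivAt_id _).prodMk (hasDerivAt_const _ _)
  have h2 : HasFDerivAt v L ((fun t : ℝ => (t, p.2)) p.1) := h
  exact (h2.comp_hasDerivAt p.1 h1).deriv

lemma HasFDerivAt.dY_eq {v : ℝ × ℝ → ℝ} {L : ℝ × ℝ →L[ℝ] ℝ} {p : ℝ × ℝ}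
    (h : HasFDerivAt v L p) : dY v p = L (0, 1) := by
  have h1 : HasDerivAt (fun t : ℝ => (p.1, t)) ((0 : ℝ), (1 : ℝ)) p.2 :=
    (hasDerivAt_const _ _).prodMk (hasDerivAt_id _)
  have h2 : HasFDerivAt v L ((fun t : ℝ => (p.1, t)) p.2) := h
  exact (h2.comp_hasDerivAt p.2 h1).deriv

lemma hasFDerivAt_gradCLM {v : ℝ × ℝ → ℝ} {p : ℝ × ℝ} (h : DifferentiableAt ℝ v p) :
    HasFDerivAt v (gradCLM (dX v p) (dY v p)) p := by
  have h' := h.hasFDerivAt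
  rw [gradCLM_eq (fderiv ℝ v p)] at h'
  rwa [HasFDerivAt.dX_eq h.hasFDerivAt, HasFDerivAt.dY_eq h.hasFDerivAt]

section EqOn

variable {S : Set (ℝ × ℝ)} {v w : ℝ × ℝ → ℝ}

lemma dX_congr (hS : IsOpen S) (h : EqOn v w S) : EqOn (dX v) (dX w) S := by
  intro p hp
  have hc : ContinuousAt (fun t : ℝ => (t, p.2)) p.1 := by fun_prop
  exact Filter.EventuallyEq.deriv_eq
    ((hc.eventually (hS.mem_nhds hp)).mono fun t ht => h ht)

lemma dY_congr (hS : IsOpen S) (h : EqOn v w S) : EqOn (dY v) (dY w) S := by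
  intro p hp
  have hc : ContinuousAt (fun t : ℝ => (p.1, t)) p.2 := by fun_prop
  exact Filter.EventuallyEq.deriv_eq
    ((hc.eventually (hS.mem_nhds hp)).mono fun t ht => h ht)

lemma dX_eqOn_fderiv (hS : IsOpen S) (h : DifferentiableOn ℝ v S) :
    EqOn (dX v) (fun p => fderiv ℝ v p (1, 0)) S := fun _ hp =>
  HasFDerivAt.dX_eq (h.differentiableAt (hS.mem_nhds hp)).hasFDerivAt

lemma dY_eqOn_fderiv (hS : IsOpen S) (h : DifferentiableOn ℝ v S) :
    EqOn (dY v) (fun p => fderiv ℝ v p (0, 1)) S := fun _ hp =>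
  HasFDerivAt.dY_eq (h.differentiableAt (hS.mem_nhds hp)).hasFDerivAt

lemma contDiffOn_dX (hS : IsOpen S) {n : ℕ} (h : ContDiffOn ℝ (n + 1 : ℕ) v S) :
    ContDiffOn ℝ n (dX v) S := by
  have h1 : ContDiffOn ℝ n (fun p => fderiv ℝ v p (1, 0)) S :=
    (h.fderiv_of_isOpen hS (by norm_cast)).clm_apply contDiffOn_const
  exact h1.congr (dX_eqOn_fderiv hS (h.differentiableOn (by simp)))

lemma contDiffOn_dY (hS : IsOpen S) {n : ℕ} (h : ContDiffOn ℝ (n + 1 : ℕ) v S) :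
    ContDiffOn ℝ n (dY v) S := by
  have h1 : ContDiffOn ℝ n (fun p => fderiv ℝ v p (0, 1)) S :=
    (h.fderiv_of_isOpen hS (by norm_cast)).clm_apply contDiffOn_const
  exact h1.congr (dY_eqOn_fderiv hS (h.differentiableOn (by simp)))

lemma dY_dX_comm (hS : IsOpen S) (h : ContDiffOn ℝ 2 v S) :
    EqOn (dY (dX v)) (dX (dY v)) S := by
  intro p hp
  have hd : DifferentiableOn ℝ v S := h.differentiableOn (by simp)
  have hf : ContDiffOn ℝ 1 (fderiv ℝ v) S := h.fderiv_of_isOpen hS (by norm_num)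
  have hfd : HasFDerivAt (fderiv ℝ v) (fderiv ℝ (fderiv ℝ v) p) p :=
    ((hf.differentiableOn (by simp)).differentiableAt (hS.mem_nhds hp)).hasFDerivAt
  have hsymm : IsSymmSndFDerivAt ℝ v p :=
    (h.contDiffAt (hS.mem_nhds hp)).isSymmSndFDerivAt (by simp)
  rw [dY_congr hS (dX_eqOn_fderiv hS hd) hp, dX_congr hS (dY_eqOn_fderiv hS hd) hp,
    HasFDerivAt.dY_eq (hfd.clm_apply (hasFDerivAt_const _ _)),
    HasFDerivAt.dX_eq (hfd.clm_apply (hasFDerivAt_const _ _))]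
  simpa using hsymm.eq (0, 1) (1, 0)

lemma contDiffOn_iterate_dX (hS : IsOpen S) (m : ℕ) : ∀ {n : ℕ} {v : ℝ × ℝ → ℝ},
    ContDiffOn ℝ (m + n : ℕ) v S → ContDiffOn ℝ n (dX^[m] v) S := by
  induction m with
  | zero => intro n v h; simpa using h
  | succ m ih =>
    intro n v h
    rw [Function.iterate_succ_apply']
    exact contDiffOn_dX hS (ih (by rwa [show m + (n + 1) = m + 1 + n by ring]))

lemma contDiffOn_iterate_dY (hS : IsOpen S) (m : ℕ) : ∀ {n : ℕ} {v : ℝ × ℝ → ℝ},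
    ContDiffOn ℝ (m + n : ℕ) v S → ContDiffOn ℝ n (dY^[m] v) S := by
  induction m with
  | zero => intro n v h; simpa using h
  | succ m ih =>
    intro n v h
    rw [Function.iterate_succ_apply']
    exact contDiffOn_dY hS (ih (by rwa [show m + (n + 1) = m + 1 + n by ring]))

lemma contDiffOn_pd (hS : IsOpen S) {i j n : ℕ} (h : ContDiffOn ℝ (i + j + n : ℕ) v S) :
    ContDiffOn ℝ n (pd i j v) S :=
  contDiffOn_iterate_dX hS i (contDiffOn_iterate_dY hS j (by
    rwa [show j + (i + n) = i + j + n by ring]))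

lemma dX_pd (i j : ℕ) : dX (pd i j v) = pd (i + 1) j v := by
  simp only [pd, Function.iterate_succ_apply']

lemma dY_iterate_dX (hS : IsOpen S) (m : ℕ) : ∀ {v : ℝ × ℝ → ℝ},
    ContDiffOn ℝ (m + 1 : ℕ) v S → EqOn (dY (dX^[m] v)) (dX^[m] (dY v)) S := by
  induction m with
  | zero => intro v _ p _; rfl
  | succ m ih =>
    intro v h p hp
    rw [Function.iterate_succ_apply', Function.iterate_succ_apply']
    rw [dY_dX_comm hS (contDiffOn_iterate_dX hS m h) hp]
    exact dX_congr hS (ih (h.of_le (by norm_cast; omega))) hp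

/-- `pd` applies the `x`-derivatives last, so `dX_pd` is immediate, whereas a further `y`-derivative
has to be commuted past all of them by the symmetry of second derivatives. -/
lemma dY_pd (hS : IsOpen S) {i j : ℕ} (h : ContDiffOn ℝ (i + j + 1 : ℕ) v S) :
    EqOn (dY (pd i j v)) (pd i (j + 1) v) S := by
  intro p hp
  have := dY_iterate_dX hS i (contDiffOn_iterate_dY hS j
    (by rwa [show j + (i + 1) = i + j + 1 by ring])) hp
  simpa only [pd, Function.iterate_succ_apply'] using this

end EqOn

/-- `W i j` is the family of partial derivatives, up to the total order `N`, of `W 0 0` on `S`. -/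
def JetFam (S : Set (ℝ × ℝ)) (N : ℕ) (W : ℕ → ℕ → ℝ × ℝ → ℝ) : Prop :=
  ∀ i j, i + j < N → ∀ p ∈ S, HasFDerivAt (W i j) (gradCLM (W (i + 1) j p) (W i (j + 1) p)) p

lemma jetFam_pd {S : Set (ℝ × ℝ)} (hS : IsOpen S) {N : ℕ} {v : ℝ × ℝ → ℝ}
    (h : ContDiffOn ℝ N v S) : JetFam S N (fun i j => pd i j v) := by
  intro i j hij p hp
  have h1 : ContDiffOn ℝ (i + j + 1 : ℕ) v S := h.of_le (by norm_cast)
  have h2 : ContDiffOn ℝ (1 : ℕ) (pd i j v) S := contDiffOn_pd hS h1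
  have := hasFDerivAt_gradCLM ((h2.differentiableOn (by simp)).differentiableAt (hS.mem_nhds hp))
  rwa [dX_pd, dY_pd hS h1 hp] at this

lemma JetFam.shift {S : Set (ℝ × ℝ)} {N : ℕ} {W : ℕ → ℕ → ℝ × ℝ → ℝ} (i j : ℕ)
    (h : JetFam S (N + i + j) W) : JetFam S N (fun m n => W (i + m) (j + n)) := fun m n hmn p hp =>
  h (i + m) (j + n) (by omega) p hp

/-! ### Taylor polynomials in two variables -/

/-- The Taylor polynomial of degree `N` with the jet `J`. -/
def taylorPoly (N : ℕ) (J : ℕ → ℕ → ℝ) (p : ℝ × ℝ) : ℝ :=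
  ∑ q ∈ Lam N, J q.1 q.2 * mono q.1 q.2 p

lemma mem_Lam {N : ℕ} {q : ℕ × ℕ} : q ∈ Lam N ↔ q.1 + q.2 ≤ N := by
  simp only [Lam, Finset.mem_filter, Finset.mem_product, Finset.mem_range]; omega

lemma mem_Lam1 {N : ℕ} {q : ℕ × ℕ} : q ∈ Lam1 N ↔ q.1 + q.2 ≤ N ∧ q.1 ≤ 1 := by
  simp [Lam1, mem_Lam]

/-- `∂ₓ(x^m y^n / (m! n!))`. -/
def monoX (m n : ℕ) (p : ℝ × ℝ) : ℝ := if m = 0 then 0 else mono (m - 1) n p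

/-- `∂_y(x^m y^n / (m! n!))`. -/
def monoY (m n : ℕ) (p : ℝ × ℝ) : ℝ := if n = 0 then 0 else mono m (n - 1) p

lemma hasFDerivAt_mono (m n : ℕ) (p : ℝ × ℝ) :
    HasFDerivAt (mono m n) (gradCLM (monoX m n p) (monoY m n p)) p := by
  have h1 : HasFDerivAt (fun q : ℝ × ℝ => q.1) (ContinuousLinearMap.fst ℝ ℝ ℝ) p := hasFDerivAt_fst
  have h2 : HasFDerivAt (fun q : ℝ × ℝ => q.2) (ContinuousLinearMap.snd ℝ ℝ ℝ) p := hasFDerivAt_snd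
  have h3 := ((h1.pow m).mul (h2.pow n)).mul_const
    (((Nat.factorial m : ℝ) * (Nat.factorial n : ℝ))⁻¹)
  have h4 : mono m n = fun y : ℝ × ℝ =>
      (y.1 ^ m * y.2 ^ n) * ((Nat.factorial m : ℝ) * (Nat.factorial n : ℝ))⁻¹ := by
    funext y; simp [mono, div_eq_mul_inv]
  rw [h4]
  refine h3.congr_fderiv ?_
  ext
  · rcases m with _ | m
    · simp [monoX]
    · simp [monoX, mono, Nat.factorial_succ]; field_simp
  · rcases n with _ | n
    · simp [monoY]
    · simp [monoY, mono, Nat.factorial_succ]; field_simp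

/-- Differentiation kills the monomials with `m = 0` and lowers the others, so the sum is reindexed
by `(m, n) ↦ (m + 1, n)`. Hence the partial derivatives of a Taylor polynomial are the Taylor
polynomials of the shifted jets, which is what drives the induction on the order. -/
lemma taylorPoly_sum_monoX (N : ℕ) (J : ℕ → ℕ → ℝ) (p : ℝ × ℝ) :
    ∑ q ∈ Lam (N + 1), J q.1 q.2 * monoX q.1 q.2 p = taylorPoly N (fun i j => J (i + 1) j) p := by
  rw [taylorPoly]
  symm
  refine Finset.sum_of_injOn (fun q => (q.1 + 1, q.2)) ?_ ?_ ?_ ?_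
  · intro a _ b _ hab
    simp only [Prod.mk.injEq, add_left_inj] at hab
    exact Prod.ext hab.1 hab.2
  · intro q hq
    simp only [Finset.mem_coe, mem_Lam] at hq ⊢; omega
  · rintro ⟨m, n⟩ hq hn
    rcases m with _ | m
    · simp [monoX]
    · exact absurd ⟨(m, n), by simp only [Finset.mem_coe, mem_Lam] at hq ⊢; omega, rfl⟩ hn
  · intro q _; simp [monoX]

lemma taylorPoly_sum_monoY (N : ℕ) (J : ℕ → ℕ → ℝ) (p : ℝ × ℝ) :
    ∑ q ∈ Lam (N + 1), J q.1 q.2 * monoY q.1 q.2 p = taylorPoly N (fun i j => J i (j + 1)) p := by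
  rw [taylorPoly]
  symm
  refine Finset.sum_of_injOn (fun q => (q.1, q.2 + 1)) ?_ ?_ ?_ ?_
  · intro a _ b _ hab
    simp only [Prod.mk.injEq, add_left_inj] at hab
    exact Prod.ext hab.1 hab.2
  · intro q hq
    simp only [Finset.mem_coe, mem_Lam] at hq ⊢; omega
  · rintro ⟨m, n⟩ hq hn
    rcases n with _ | n
    · simp [monoY]
    · exact absurd ⟨(m, n), by simp only [Finset.mem_coe, mem_Lam] at hq ⊢; omega, rfl⟩ hn
  · intro q _; simp [monoY]

lemma hasFDerivAt_taylorPoly (N : ℕ) (J : ℕ → ℕ → ℝ) (p : ℝ × ℝ) :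
    HasFDerivAt (taylorPoly (N + 1) J)
      (gradCLM (taylorPoly N (fun i j => J (i + 1) j) p)
        (taylorPoly N (fun i j => J i (j + 1)) p)) p := by
  have h := HasFDerivAt.fun_sum (u := Lam (N + 1))
    (fun q _ => (hasFDerivAt_mono q.1 q.2 p).const_mul (J q.1 q.2))
  refine h.congr_fderiv ?_
  ext
  · simp [← taylorPoly_sum_monoX]
  · simp [← taylorPoly_sum_monoY]

lemma dX_taylorPoly (N : ℕ) (J : ℕ → ℕ → ℝ) (p : ℝ × ℝ) :
    dX (taylorPoly (N + 1) J) p = taylorPoly N (fun i j => J (i + 1) j) p := by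
  simpa using HasFDerivAt.dX_eq (hasFDerivAt_taylorPoly N J p)

lemma dY_taylorPoly (N : ℕ) (J : ℕ → ℕ → ℝ) (p : ℝ × ℝ) :
    dY (taylorPoly (N + 1) J) p = taylorPoly N (fun i j => J i (j + 1)) p := by
  simpa using HasFDerivAt.dY_eq (hasFDerivAt_taylorPoly N J p)

lemma taylorPoly_zero (J : ℕ → ℕ → ℝ) (p : ℝ × ℝ) : taylorPoly 0 J p = J 0 0 := by
  have : Lam 0 = {(0, 0)} := by decide
  simp [taylorPoly, this, mono]

lemma continuous_taylorPoly (N : ℕ) (J : ℕ → ℕ → ℝ) : Continuous (taylorPoly N J) := by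
  unfold taylorPoly mono; fun_prop

lemma taylorPoly_origin (N : ℕ) (J : ℕ → ℕ → ℝ) : taylorPoly N J 0 = J 0 0 := by
  rw [taylorPoly, Finset.sum_eq_single (0, 0)]
  · simp [mono]
  · rintro ⟨m, n⟩ _ h
    have : m ≠ 0 ∨ n ≠ 0 := by
      by_contra! hc
      exact h (by simp [hc.1, hc.2])
    rcases this with h | h <;> simp [mono, h]
  · intro h; exact absurd (mem_Lam.2 (by simp)) h

/-! ### Mean value and Taylor estimates on one side of the interface -/

/-- Every point `p` of `S` near `b` is joined to `b` by a polygonal path in `S` of length comparable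
to the distance of `p` and `b`: one moves along `ν`, then parallel to `p - b`, then along `-ν`. -/
def Accessible (S : Set (ℝ × ℝ)) (b : ℝ × ℝ) (ρ : ℝ) (ν : ℝ × ℝ) : Prop :=
  b ∉ S ∧ ∀ d, 0 < d → d < ρ →
    (∀ τ : ℝ, 0 < τ → τ ≤ d → b + τ • ν ∈ S) ∧
      ∀ p ∈ S, dist p b ≤ d → (∀ τ : ℝ, 0 ≤ τ → τ ≤ d → p + τ • ν ∈ S) ∧
        ∀ θ : ℝ, 0 ≤ θ → θ ≤ 1 → b + θ • (p - b) + d • ν ∈ S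

/-- The norm on `ℝ × ℝ` is the maximum norm; hence the factor 2. -/
lemma abs_gradCLM_le {a b E : ℝ} (ha : |a| ≤ E) (hb : |b| ≤ E) : ‖gradCLM a b‖ ≤ 2 * E := by
  have hE : 0 ≤ E := (abs_nonneg a).trans ha
  refine ContinuousLinearMap.opNorm_le_bound _ (by positivity) fun p => ?_
  have h1 : |p.1| ≤ ‖p‖ := norm_fst_le p
  have h2 : |p.2| ≤ ‖p‖ := norm_snd_le p
  calc ‖gradCLM a b p‖ = |a * p.1 + b * p.2| := by simp
    _ ≤ |a| * |p.1| + |b| * |p.2| := by rw [← abs_mul, ← abs_mul]; exact abs_add_le _ _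
    _ ≤ E * ‖p‖ + E * ‖p‖ := by gcongr
    _ = 2 * E * ‖p‖ := by ring

/-- Convexity is asked of the segment only, not of `S`. -/
lemma abs_sub_le_of_segment {S : Set (ℝ × ℝ)} {v vx vy : ℝ × ℝ → ℝ}
    (hv : ∀ p ∈ S, HasFDerivAt v (gradCLM (vx p) (vy p)) p) {E : ℝ} {x y : ℝ × ℝ}
    (hxy : segment ℝ x y ⊆ S) (hE : ∀ q ∈ segment ℝ x y, |vx q| ≤ E ∧ |vy q| ≤ E) :
    |v y - v x| ≤ 2 * E * ‖y - x‖ :=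
  (convex_segment x y).norm_image_sub_le_of_norm_hasFDerivWithin_le
    (fun q hq => (hv q (hxy hq)).hasFDerivWithinAt)
    (fun q hq => abs_gradCLM_le (hE q hq).1 (hE q hq).2)
    (left_mem_segment ℝ x y) (right_mem_segment ℝ x y)

lemma Accessible.tendsto {S : Set (ℝ × ℝ)} {b ν : ℝ × ℝ} {ρ : ℝ} (hρ : 0 < ρ)
    (h : Accessible S b ρ ν) : Tendsto (fun τ : ℝ => b + τ • ν) (𝓝[>] 0) (𝓝[S] b) := by
  refine tendsto_nhdsWithin_iff.2 ⟨?_, ?_⟩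
  · have : ContinuousAt (fun τ : ℝ => b + τ • ν) 0 := by fun_prop
    have h2 := this.tendsto
    simp only [zero_smul, add_zero] at h2
    exact h2.mono_left nhdsWithin_le_nhds
  · filter_upwards [Ioo_mem_nhdsGT (show (0 : ℝ) < ρ / 2 by positivity)] with τ hτ
    exact (h.2 (ρ / 2) (by positivity) (by linarith)).1 τ hτ.1 hτ.2.le

lemma Accessible.neBot {S : Set (ℝ × ℝ)} {b ν : ℝ × ℝ} {ρ : ℝ} (hρ : 0 < ρ)
    (h : Accessible S b ρ ν) : (𝓝[S] b).NeBot := (h.tendsto hρ).neBot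

/-- The gradient bound is integrated along `b + ε ν → b + d ν → p + d ν → p`. The pieces have
lengths at most `d ‖ν‖`, `d`, `d ‖ν‖`, and they stay within `(1 + ‖ν‖) d` of `b`. The path starts at
`b + ε ν` because `b` is not in `S`. -/
theorem Accessible.abs_le {S : Set (ℝ × ℝ)} {b ν : ℝ × ℝ} {ρ : ℝ} (hS : Accessible S b ρ ν)
    {v vx vy : ℝ × ℝ → ℝ} (hv : ∀ p ∈ S, HasFDerivAt v (gradCLM (vx p) (vy p)) p)
    (hlim : Tendsto v (𝓝[S] b) (𝓝 0)) {E d : ℝ} (hd : 0 < d) (hdρ : d < ρ)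
    (hE : ∀ q ∈ S, dist q b ≤ (1 + ‖ν‖) * d → |vx q| ≤ E ∧ |vy q| ≤ E)
    {p : ℝ × ℝ} (hp : p ∈ S) (hpd : dist p b ≤ d) :
    |v p| ≤ 2 * E * ((1 + 2 * ‖ν‖) * d) := by
  obtain ⟨h1, h2⟩ := hS.2 d hd hdρ
  obtain ⟨h3, h4⟩ := h2 p hp hpd
  have hpd' : ‖p - b‖ ≤ d := by rwa [← dist_eq_norm]
  have hE0 : 0 ≤ E := by
    have := (hE p hp (hpd.trans (by nlinarith [norm_nonneg ν]))).1
    exact (abs_nonneg _).trans this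
  have key : ∀ ε, 0 < ε → ε < d → |v p - v (b + ε • ν)| ≤ 2 * E * ((1 + 2 * ‖ν‖) * d) := by
    intro ε hε hεd
    have s1 : ∀ q ∈ segment ℝ (b + ε • ν) (b + d • ν), q ∈ S ∧ dist q b ≤ (1 + ‖ν‖) * d := by
      intro q hq
      rw [segment_eq_image'] at hq
      obtain ⟨θ, ⟨hθ0, hθ1⟩, rfl⟩ := hq
      have e : b + ε • ν + θ • (b + d • ν - (b + ε • ν)) = b + (ε + θ * (d - ε)) • ν := by
        ext <;> simp <;> ring
      have hτ0 : 0 < ε + θ * (d - ε) := by nlinarith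
      have hτ : ε + θ * (d - ε) ≤ d := by nlinarith
      simp only [e]
      refine ⟨h1 _ hτ0 hτ, ?_⟩
      rw [dist_eq_norm, add_sub_cancel_left, norm_smul, Real.norm_of_nonneg hτ0.le]
      nlinarith [norm_nonneg ν]
    have s2 : ∀ q ∈ segment ℝ (b + d • ν) (p + d • ν), q ∈ S ∧ dist q b ≤ (1 + ‖ν‖) * d := by
      intro q hq
      rw [segment_eq_image'] at hq
      obtain ⟨θ, ⟨hθ0, hθ1⟩, rfl⟩ := hq
      have e : b + d • ν + θ • (p + d • ν - (b + d • ν)) = b + θ • (p - b) + d • ν := by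
        ext <;> simp <;> ring
      simp only [e]
      refine ⟨h4 θ hθ0 hθ1, ?_⟩
      rw [dist_eq_norm, show b + θ • (p - b) + d • ν - b = θ • (p - b) + d • ν by abel]
      calc ‖θ • (p - b) + d • ν‖ ≤ θ * ‖p - b‖ + d * ‖ν‖ := by
            refine (norm_add_le _ _).trans ?_
            rw [norm_smul, norm_smul, Real.norm_of_nonneg hθ0, Real.norm_of_nonneg hd.le]
        _ ≤ 1 * d + d * ‖ν‖ := by gcongr
        _ = (1 + ‖ν‖) * d := by ring
    have s3 : ∀ q ∈ segment ℝ (p + d • ν) p, q ∈ S ∧ dist q b ≤ (1 + ‖ν‖) * d := by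
      intro q hq
      rw [segment_symm, segment_eq_image'] at hq
      obtain ⟨θ, ⟨hθ0, hθ1⟩, rfl⟩ := hq
      have e : p + θ • (p + d • ν - p) = p + (θ * d) • ν := by
        ext <;> simp <;> ring
      have hτ0 : 0 ≤ θ * d := by positivity
      simp only [e]
      refine ⟨h3 _ hτ0 (by nlinarith), ?_⟩
      rw [dist_eq_norm, show p + (θ * d) • ν - b = (p - b) + (θ * d) • ν by abel]
      calc ‖(p - b) + (θ * d) • ν‖ ≤ ‖p - b‖ + θ * d * ‖ν‖ := by
            refine (norm_add_le _ _).trans ?_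
            rw [norm_smul, Real.norm_of_nonneg hτ0]
        _ ≤ d + 1 * d * ‖ν‖ := by gcongr
        _ = (1 + ‖ν‖) * d := by ring
    have b1 := abs_sub_le_of_segment hv (fun q hq => (s1 q hq).1)
      (fun q hq => hE q (s1 q hq).1 (s1 q hq).2)
    have b2 := abs_sub_le_of_segment hv (fun q hq => (s2 q hq).1)
      (fun q hq => hE q (s2 q hq).1 (s2 q hq).2)
    have b3 := abs_sub_le_of_segment hv (fun q hq => (s3 q hq).1)
      (fun q hq => hE q (s3 q hq).1 (s3 q hq).2)
    rw [show b + d • ν - (b + ε • ν) = (d - ε) • ν by rw [sub_smul]; abel, norm_smul,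
      Real.norm_of_nonneg (by linarith)] at b1
    rw [show p + d • ν - (b + d • ν) = p - b by abel] at b2
    rw [show p - (p + d • ν) = -(d • ν) by abel, norm_neg, norm_smul,
      Real.norm_of_nonneg hd.le] at b3
    have t : |v p - v (b + ε • ν)| ≤ |v p - v (p + d • ν)| + |v (p + d • ν) - v (b + d • ν)|
        + |v (b + d • ν) - v (b + ε • ν)| := by
      have := abs_add_three (v p - v (p + d • ν)) (v (p + d • ν) - v (b + d • ν))
        (v (b + d • ν) - v (b + ε • ν))
      simpa using this
    have c1 : 2 * E * ((d - ε) * ‖ν‖) ≤ 2 * E * (d * ‖ν‖) := by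
      gcongr; linarith
    have c2 : 2 * E * ‖p - b‖ ≤ 2 * E * d := by gcongr
    calc _ ≤ _ := t
      _ ≤ 2 * E * (d * ‖ν‖) + 2 * E * d + 2 * E * (d * ‖ν‖) := by linarith
      _ = _ := by ring
  -- As `ε → 0` the starting value `v (b + ε ν)` tends to the one-sided limit `0`, and the bound
  -- does not depend on `ε`.
  have hl : Tendsto (fun ε : ℝ => |v p - v (b + ε • ν)|) (𝓝[>] 0) (𝓝 |v p - 0|) :=
    (tendsto_const_nhds.sub (hlim.comp (hS.tendsto (hd.trans hdρ)))).abs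
  rw [sub_zero] at hl
  refine le_of_tendsto hl ?_
  filter_upwards [Ioo_mem_nhdsGT hd] with ε hε using key ε hε.1 hε.2

lemma hasFDerivAt_taylorPoly_sub (N : ℕ) (J : ℕ → ℕ → ℝ) (b p : ℝ × ℝ) :
    HasFDerivAt (fun q => taylorPoly (N + 1) J (q - b))
      (gradCLM (taylorPoly N (fun i j => J (i + 1) j) (p - b))
        (taylorPoly N (fun i j => J i (j + 1)) (p - b))) p := by
  have h := (hasFDerivAt_taylorPoly N J (p - b)).comp p ((hasFDerivAt_id p).sub_const b)
  simpa [Function.comp_def] using h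

lemma gradCLM_sub (a b c d : ℝ) : gradCLM a b - gradCLM c d = gradCLM (a - c) (b - d) := by
  ext <;> simp

lemma tendsto_sub_taylorPoly {S : Set (ℝ × ℝ)} {b : ℝ × ℝ} {v : ℝ × ℝ → ℝ} (N : ℕ)
    {J : ℕ → ℕ → ℝ} (h : Tendsto v (𝓝[S] b) (𝓝 (J 0 0))) :
    Tendsto (fun q => v q - taylorPoly N J (q - b)) (𝓝[S] b) (𝓝 0) := by
  have h1 : Tendsto (fun q => taylorPoly N J (q - b)) (𝓝 b) (𝓝 (taylorPoly N J (b - b))) :=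
    ((continuous_taylorPoly N J).comp (continuous_id.sub continuous_const)).tendsto b
  rw [sub_self, taylorPoly_origin] at h1
  simpa using h.sub (h1.mono_left nhdsWithin_le_nhds)

/-- Induction on the order: the remainder has limit zero at `b`, and its partial derivatives are the
remainders of one order less of the shifted families, so `Accessible.abs_le` integrates their
bounds. The constants are chosen before `S`, `b` and `W`, which makes the estimate uniform in the
base point. -/
theorem Accessible.taylor (N : ℕ) {ρ R M : ℝ} (hρ : 0 < ρ) (hR : 0 < R) (hM : 0 ≤ M)
    (ν : ℝ × ℝ) :
    ∃ C, 0 ≤ C ∧ ∃ ρ', 0 < ρ' ∧ ∀ (S : Set (ℝ × ℝ)) (b : ℝ × ℝ) (W : ℕ → ℕ → ℝ × ℝ → ℝ)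
      (J : ℕ → ℕ → ℝ), Accessible S b ρ ν → JetFam S (N + 1) W →
      (∀ i j, i + j ≤ N → Tendsto (W i j) (𝓝[S] b) (𝓝 (J i j))) →
      (∀ i j, i + j = N + 1 → ∀ q ∈ S, dist q b < R → |W i j q| ≤ M) →
      ∀ p ∈ S, dist p b < ρ' → |W 0 0 p - taylorPoly N J (p - b)| ≤ C * dist p b ^ (N + 1) := by
  have hκ : 0 < 1 + ‖ν‖ := by positivity
  induction N with
  | zero =>
    refine ⟨2 * M * (1 + 2 * ‖ν‖), by positivity, min ρ (R / (1 + ‖ν‖)), by positivity, ?_⟩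
    intro S b W J hS hW hJ hb p hp hpd
    have hd : 0 < dist p b := dist_pos.2 fun h => hS.1 (h ▸ hp)
    obtain ⟨h1, h2⟩ := lt_min_iff.1 hpd
    rw [lt_div_iff₀ hκ] at h2
    have hv : ∀ p ∈ S, HasFDerivAt (fun q => W 0 0 q - taylorPoly 0 J (q - b))
        (gradCLM (W 1 0 p) (W 0 1 p)) p := by
      intro q hq
      simp only [taylorPoly_zero]
      exact (hW 0 0 (by simp) q hq).sub_const _
    refine (hS.abs_le (E := M) hv (tendsto_sub_taylorPoly 0 (hJ 0 0 le_rfl)) hd h1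
      (fun q hq hqd => ?_) hp le_rfl).trans (le_of_eq (by ring))
    have h3 : dist q b < R := by linarith [mul_comm (dist p b) (1 + ‖ν‖)]
    exact ⟨hb 1 0 rfl q hq h3, hb 0 1 rfl q hq h3⟩
  | succ N ih =>
    obtain ⟨C, hC, ρ', hρ', H⟩ := ih
    -- The path to `p` goes out to distance `(1 + ‖ν‖) dist p b` from `b`. The inductive bound is
    -- used at that distance, which produces the power of `1 + ‖ν‖` and the smaller radius.
    refine ⟨2 * (C * (1 + ‖ν‖) ^ (N + 1)) * (1 + 2 * ‖ν‖), by positivity,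
      min ρ (ρ' / (1 + ‖ν‖)), by positivity, ?_⟩
    intro S b W J hS hW hJ hb p hp hpd
    have hd : 0 < dist p b := dist_pos.2 fun h => hS.1 (h ▸ hp)
    obtain ⟨h1, h2⟩ := lt_min_iff.1 hpd
    rw [lt_div_iff₀ hκ] at h2
    have hv : ∀ p ∈ S, HasFDerivAt (fun q => W 0 0 q - taylorPoly (N + 1) J (q - b))
        (gradCLM (W 1 0 p - taylorPoly N (fun i j => J (i + 1) j) (p - b))
          (W 0 1 p - taylorPoly N (fun i j => J i (j + 1)) (p - b))) p := by
      intro q hq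
      rw [← gradCLM_sub]
      exact (hW 0 0 (by simp) q hq).sub (hasFDerivAt_taylorPoly_sub N J b q)
    refine (hS.abs_le (E := C * ((1 + ‖ν‖) * dist p b) ^ (N + 1)) hv
      (tendsto_sub_taylorPoly (N + 1) (hJ 0 0 (by simp))) hd h1
      (fun q hq hqd => ?_) hp le_rfl).trans (le_of_eq (by rw [mul_pow]; ring))
    have h3 : dist q b < ρ' := by linarith [mul_comm (dist p b) (1 + ‖ν‖)]
    constructor
    · refine (H S b (fun i j => W (i + 1) j) (fun i j => J (i + 1) j) hS
        (fun i j hij => hW (i + 1) j (by omega)) (fun i j hij => hJ (i + 1) j (by omega))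
        (fun i j hij => hb (i + 1) j (by omega)) q hq h3).trans ?_
      gcongr
    · refine (H S b (fun i j => W i (j + 1)) (fun i j => J i (j + 1)) hS
        (fun i j hij => hW i (j + 1) (by omega)) (fun i j hij => hJ i (j + 1) (by omega))
        (fun i j hij => hb i (j + 1) (by omega)) q hq h3).trans ?_
      gcongr

/-! ### Access to the interface from one side of a regular level set -/

/-- The part of `Ω` where `ψ` is positive. -/
def side (Ω : Set (ℝ × ℝ)) (ψ : ℝ × ℝ → ℝ) : Set (ℝ × ℝ) := {p | p ∈ Ω ∧ 0 < ψ p}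

/-- The part of `Ω` where `ψ` vanishes. -/
def zeros (Ω : Set (ℝ × ℝ)) (ψ : ℝ × ℝ → ℝ) : Set (ℝ × ℝ) := {p | p ∈ Ω ∧ ψ p = 0}

/-- Strict differentiability makes `ψ - L` Lipschitz with a small constant `c` on a whole
neighbourhood of `b₀`, hence for all base points at once. Moving along `ν` raises `ψ` at a definite
rate. The segment parallel to `p - b`, which may cross the interface, is lifted far enough along `ν`
to make `ψ` positive on it. -/
theorem exists_accessible {Ω : Set (ℝ × ℝ)} {ψ : ℝ × ℝ → ℝ} {L : ℝ × ℝ →L[ℝ] ℝ} {b₀ : ℝ × ℝ}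
    (hΩ : Ω ∈ 𝓝 b₀) (hψ : HasStrictFDerivAt ψ L b₀) (hL : L ≠ 0) :
    ∃ ρ, 0 < ρ ∧ ∃ ν, ∀ b ∈ zeros Ω ψ, dist b b₀ < ρ → Accessible (side Ω ψ) b ρ ν := by
  obtain ⟨μ, hμ⟩ : ∃ μ, L μ = 1 := by
    obtain ⟨x, hx⟩ : ∃ x, L x ≠ 0 := by
      by_contra! h
      exact hL (ContinuousLinearMap.ext h)
    exact ⟨(L x)⁻¹ • x, by simp [hx]⟩
  -- With `L μ = 1` and `c ‖μ‖ ≤ 1/2`, the linearization error costs at most half of the gain along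
  -- `μ`.
  set c : ℝ := 1 / (2 * (‖μ‖ + 1)) with hc
  have hc0 : 0 < c := by positivity
  have hcμ : c * ‖μ‖ ≤ 1 / 2 := by
    rw [hc, div_mul_eq_mul_div, div_le_div_iff₀ (by positivity) (by positivity)]
    nlinarith [norm_nonneg μ]
  -- Since `l / 2 = ‖L‖ + c + 1`, a displacement `d ν` raises `ψ` by at least `(‖L‖ + c) d + d`. The
  -- move from `b`, where `ψ = 0`, along `θ (p - b)` loses at most `(‖L‖ + c) d`.
  set l : ℝ := 2 * (‖L‖ + c) + 2 with hl
  have hl0 : 0 < l := by positivity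
  have hst : ∀ᶠ q : (ℝ × ℝ) × (ℝ × ℝ) in 𝓝 (b₀, b₀),
      ‖ψ q.1 - ψ q.2 - L (q.1 - q.2)‖ ≤ c * ‖q.1 - q.2‖ := by
    have := hψ.isLittleO
    exact this.def hc0
  obtain ⟨R, hR, hball'⟩ := Metric.eventually_nhds_iff.1 hst
  have hball : ∀ {x y : ℝ × ℝ}, dist x b₀ < R → dist y b₀ < R →
      ‖ψ x - ψ y - L (x - y)‖ ≤ c * ‖x - y‖ := fun {x y} hx hy =>
    hball' (y := (x, y)) (by rw [Prod.dist_eq]; exact max_lt hx hy)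
  obtain ⟨R', hR', hΩb⟩ := Metric.mem_nhds_iff.1 hΩ
  set R₀ := min R R'
  have hR₀ : 0 < R₀ := by positivity
  set ν := l • μ with hν
  have up : ∀ q τ, 0 ≤ τ → dist q b₀ < R → dist (q + τ • ν) b₀ < R →
      ψ q + τ * (l / 2) ≤ ψ (q + τ • ν) := by
    intro q τ hτ h1 h2
    have := hball h2 h1
    simp only [add_sub_cancel_left] at this
    have hLν : L (τ • ν) = τ * l := by simp [hν, hμ]
    have hnν : ‖τ • ν‖ = τ * l * ‖μ‖ := by
      rw [hν, norm_smul, norm_smul, Real.norm_of_nonneg hτ, Real.norm_of_nonneg hl0.le]; ring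
    rw [hLν, hnν, Real.norm_eq_abs] at this
    have h3 := (abs_le.1 this).1
    have h4 : c * (τ * l * ‖μ‖) ≤ τ * l * (1 / 2) := by
      have : 0 ≤ τ * l := by positivity
      nlinarith
    nlinarith
  have lip : ∀ q q', dist q b₀ < R → dist q' b₀ < R → ψ q - (‖L‖ + c) * ‖q' - q‖ ≤ ψ q' := by
    intro q q' h1 h2
    have := hball h2 h1
    rw [Real.norm_eq_abs] at this
    have h3 := (abs_le.1 this).1
    have h4 : |L (q' - q)| ≤ ‖L‖ * ‖q' - q‖ := L.le_opNorm _
    have h5 := (abs_le.1 h4).1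
    linarith
  have hden : 0 < 2 * (2 + ‖ν‖) := by positivity
  -- A path point is within `(1 + ‖ν‖) d` of `b`, and both `d` and `dist b b₀` are below this
  -- radius, so the point is within `R₀ / 2` of `b₀`.
  refine ⟨R₀ / (2 * (2 + ‖ν‖)), by positivity, ν, ?_⟩
  rintro b ⟨hbΩ, hb0⟩ hbd
  have hκ : ∀ d, d < R₀ / (2 * (2 + ‖ν‖)) → ∀ q, dist q b ≤ (1 + ‖ν‖) * d → dist q b₀ < R₀ := by
    intro d hd q hq
    rw [lt_div_iff₀ hden] at hd hbd
    have := dist_triangle q b b₀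
    have h0 := norm_nonneg ν
    have h1 : 0 ≤ dist b b₀ := dist_nonneg
    nlinarith [mul_nonneg h1 h0]
  have hRR : ∀ q, dist q b₀ < R₀ → dist q b₀ < R := fun q h => h.trans_le (min_le_left _ _)
  have hRΩ : ∀ q, dist q b₀ < R₀ → q ∈ Ω := fun q h => hΩb (h.trans_le (min_le_right _ _))
  refine ⟨fun h => h.2.ne' hb0, fun d hd0 hd => ⟨fun τ hτ0 hτ => ?_, fun p hp hpd =>
    ⟨fun τ hτ0 hτ => ?_, fun θ hθ0 hθ1 => ?_⟩⟩⟩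
  · have h1 : dist (b + τ • ν) b₀ < R₀ := by
      refine hκ d hd _ ?_
      rw [dist_eq_norm, add_sub_cancel_left, norm_smul, Real.norm_of_nonneg hτ0.le]
      nlinarith [norm_nonneg ν]
    have h2 : dist b b₀ < R₀ := hκ d hd b (by rw [dist_self]; positivity)
    refine ⟨hRΩ _ h1, ?_⟩
    have := up b τ hτ0.le (hRR _ h2) (hRR _ h1)
    have h3 : 0 < τ * (l / 2) := by positivity
    linarith
  · have h1 : dist (p + τ • ν) b₀ < R₀ := by
      refine hκ d hd _ ?_
      rw [dist_eq_norm, show p + τ • ν - b = (p - b) + τ • ν by abel]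
      refine (norm_add_le _ _).trans ?_
      rw [norm_smul, Real.norm_of_nonneg hτ0, ← dist_eq_norm]
      nlinarith [norm_nonneg ν]
    have h2 : dist p b₀ < R₀ := hκ d hd p (by nlinarith [norm_nonneg ν])
    refine ⟨hRΩ _ h1, ?_⟩
    have := up p τ hτ0 (hRR _ h2) (hRR _ h1)
    have h3 : 0 ≤ τ * (l / 2) := by positivity
    linarith [hp.2]
  · have hn : ‖θ • (p - b)‖ ≤ d := by
      rw [norm_smul, Real.norm_of_nonneg hθ0, ← dist_eq_norm]
      nlinarith [dist_nonneg (x := p) (y := b)]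
    have h1 : dist (b + θ • (p - b) + d • ν) b₀ < R₀ := by
      refine hκ d hd _ ?_
      rw [dist_eq_norm, show b + θ • (p - b) + d • ν - b = θ • (p - b) + d • ν by abel]
      refine (norm_add_le _ _).trans ?_
      rw [norm_smul d, Real.norm_of_nonneg hd0.le]
      linarith
    have h2 : dist (b + θ • (p - b)) b₀ < R₀ := by
      refine hκ d hd _ ?_
      rw [dist_eq_norm, add_sub_cancel_left]
      nlinarith [norm_nonneg ν]
    have h3 : dist b b₀ < R₀ := hκ d hd b (by rw [dist_self]; positivity)
    refine ⟨hRΩ _ h1, ?_⟩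
    have e1 := up _ d hd0.le (hRR _ h2) (hRR _ h1)
    have e2 := lip b (b + θ • (p - b)) (hRR _ h3) (hRR _ h2)
    rw [add_sub_cancel_left, hb0] at e2
    have e3 : (‖L‖ + c) * ‖θ • (p - b)‖ ≤ (‖L‖ + c) * d := by gcongr
    rw [hl] at e1
    nlinarith

/-! ### One-sided limits -/

/-- `w` is of class `C^N` on `S` and its partial derivatives of order at most `N` have limits from
`S` at the points of `Z`. -/
def SmoothUpTo (Z S : Set (ℝ × ℝ)) (N : ℕ) (w : ℝ × ℝ → ℝ) : Prop :=
  ContDiffOn ℝ N w S ∧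
    ∀ p ∈ Z, ∀ m n : ℕ, m + n ≤ N → ∃ L : ℝ, Tendsto (pd m n w) (𝓝[S] p) (𝓝 L)

lemma SmoothUpTo.mono {Z S : Set (ℝ × ℝ)} {N N' : ℕ} {w : ℝ × ℝ → ℝ} (h : SmoothUpTo Z S N w)
    (hN : N' ≤ N) : SmoothUpTo Z S N' w :=
  ⟨h.1.of_le (by exact_mod_cast hN), fun p hp m n hmn => h.2 p hp m n (hmn.trans hN)⟩

lemma trace_eq_of_mem {S : Set (ℝ × ℝ)} (hS : IsOpen S) {v : ℝ × ℝ → ℝ} {p : ℝ × ℝ} (hp : p ∈ S)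
    (hv : ContinuousAt v p) : trace S v p = v p := by
  rw [trace, hS.nhdsWithin_eq hp]
  exact hv.tendsto.limUnder_eq

lemma SmoothUpTo.continuousAt {Z S : Set (ℝ × ℝ)} {N : ℕ} {w : ℝ × ℝ → ℝ} (hS : IsOpen S)
    (h : SmoothUpTo Z S N w) {m n : ℕ} (hmn : m + n ≤ N) {p : ℝ × ℝ} (hp : p ∈ S) :
    ContinuousAt (pd m n w) p :=
  ((contDiffOn_pd (n := 0) hS (h.1.of_le (by exact_mod_cast hmn))).continuousOn).continuousAt
    (hS.mem_nhds hp)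

lemma SmoothUpTo.sideJet_of_mem {Z S : Set (ℝ × ℝ)} {N : ℕ} {w : ℝ × ℝ → ℝ} (hS : IsOpen S)
    (h : SmoothUpTo Z S N w) {m n : ℕ} (hmn : m + n ≤ N) {p : ℝ × ℝ} (hp : p ∈ S) :
    sideJet S w p m n = pd m n w p := trace_eq_of_mem hS hp (h.continuousAt hS hmn hp)

lemma SmoothUpTo.tendsto {Z S : Set (ℝ × ℝ)} {N : ℕ} {w : ℝ × ℝ → ℝ}
    (h : SmoothUpTo Z S N w) {m n : ℕ} (hmn : m + n ≤ N) {p : ℝ × ℝ} (hp : p ∈ Z) :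
    Tendsto (pd m n w) (𝓝[S] p) (𝓝 (sideJet S w p m n)) :=
  tendsto_nhds_limUnder (h.2 p hp m n hmn)

/-- `trace` is the extension by limits `extendFrom`. Its continuity on `Z` follows from the
existence of the limits, because the target space is regular. -/
lemma SmoothUpTo.continuousOn {Z S : Set (ℝ × ℝ)} {N : ℕ} {w : ℝ × ℝ → ℝ}
    (h : SmoothUpTo Z S N w) {m n : ℕ} (hmn : m + n ≤ N) (hZ : Z ⊆ closure S) :
    ContinuousOn (fun p => sideJet S w p m n) Z :=
  continuousOn_extendFrom hZ fun p hp => h.2 p hp m n hmn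

lemma SmoothUpTo.eventually_bounded {Z S : Set (ℝ × ℝ)} {N : ℕ} {w : ℝ × ℝ → ℝ}
    (h : SmoothUpTo Z S N w) {b₀ : ℝ × ℝ} (hb₀ : b₀ ∈ Z) :
    ∃ M, 0 ≤ M ∧ ∃ R, 0 < R ∧ ∀ m n, m + n ≤ N → ∀ q ∈ S, dist q b₀ < R → |pd m n w q| ≤ M := by
  set M := ∑ q ∈ Lam N, (|sideJet S w b₀ q.1 q.2| + 1) with hM
  have hev : ∀ᶠ p in 𝓝[S] b₀, ∀ q ∈ Lam N, |pd q.1 q.2 w p| ≤ M := by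
    refine (Filter.eventually_all_finset _).2 fun q hq => ?_
    have h1 := (h.tendsto (mem_Lam.1 hq) hb₀).abs
    have h2 := h1.eventually (gt_mem_nhds (lt_add_one |sideJet S w b₀ q.1 q.2|))
    filter_upwards [h2] with p hp
    refine hp.le.trans ?_
    exact Finset.single_le_sum (f := fun q : ℕ × ℕ => |sideJet S w b₀ q.1 q.2| + 1)
      (fun q _ => by positivity) hq
  obtain ⟨R, hR, hsub⟩ := Metric.mem_nhdsWithin_iff.1 hev
  refine ⟨M, Finset.sum_nonneg fun q _ => by positivity, R, hR, fun m n hmn q hq hqd => ?_⟩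
  exact hsub ⟨hqd, hq⟩ (m, n) (mem_Lam.2 hmn)

/-- Taylor's formula on one side of the interface, uniformly in the base point. -/
theorem SmoothUpTo.taylor {Ω : Set (ℝ × ℝ)} {ψ : ℝ × ℝ → ℝ} {L : ℝ × ℝ →L[ℝ] ℝ} {b₀ : ℝ × ℝ}
    (hS : IsOpen (side Ω ψ)) (hΩ : Ω ∈ 𝓝 b₀) (hb₀ : b₀ ∈ zeros Ω ψ)
    (hψ : HasStrictFDerivAt ψ L b₀) (hL : L ≠ 0) {w : ℝ × ℝ → ℝ} (i j N : ℕ)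
    (hw : SmoothUpTo (zeros Ω ψ) (side Ω ψ) (N + 1 + i + j) w) :
    ∃ C, 0 ≤ C ∧ ∃ ρ, 0 < ρ ∧ ∀ b ∈ zeros Ω ψ, dist b b₀ < ρ →
      ∀ p ∈ side Ω ψ ∪ zeros Ω ψ, dist p b < ρ →
        |sideJet (side Ω ψ) w p i j
          - taylorPoly N (fun m n => sideJet (side Ω ψ) w b (i + m) (j + n)) (p - b)|
            ≤ C * dist p b ^ (N + 1) := by
  obtain ⟨ρ₁, hρ₁, ν, hacc⟩ := exists_accessible hΩ hψ hL
  obtain ⟨M, hM, R, hR, hbd⟩ := hw.eventually_bounded hb₀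
  obtain ⟨C, hC, ρ₂, hρ₂, H⟩ := Accessible.taylor N hρ₁ (half_pos hR) hM ν
  have key : ∀ b ∈ zeros Ω ψ, dist b b₀ < ρ₁ → dist b b₀ < R / 2 → ∀ p ∈ side Ω ψ,
      dist p b < ρ₂ → |pd i j w p
          - taylorPoly N (fun m n => sideJet (side Ω ψ) w b (i + m) (j + n)) (p - b)|
            ≤ C * dist p b ^ (N + 1) := by
    intro b hb h1 h2 p hp hpd
    refine H (side Ω ψ) b (fun m n => pd (i + m) (j + n) w) _ (hacc b hb h1)
      ((jetFam_pd hS hw.1).shift i j) (fun m n hmn => hw.tendsto (by omega) hb)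
      (fun m n hmn q hq hqd => hbd _ _ (by omega) q hq ?_) p hp hpd
    linarith [dist_triangle q b b₀]
  -- Halving `ρ₁` keeps every interface point `p` near `b` within `ρ₁` of `b₀`, so that `p` is
  -- itself accessible and the one-sided limit at `p` is taken along a nontrivial filter.
  set ρ := min (ρ₁ / 2) (min (R / 2) ρ₂)
  have hρ1 : ρ ≤ ρ₁ / 2 := min_le_left _ _
  have hρ2 : ρ ≤ R / 2 := (min_le_right _ _).trans (min_le_left _ _)
  have hρ3 : ρ ≤ ρ₂ := (min_le_right _ _).trans (min_le_right _ _)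
  refine ⟨C, hC, ρ, by positivity, fun b hb hbd p hp hpd => ?_⟩
  have key' := key b hb (by linarith) (by linarith)
  rcases hp with hp | hp
  · rw [hw.sideJet_of_mem hS (by omega) hp]
    exact key' p hp (by linarith)
  -- At a point of the interface the estimate is the limit of the estimates at nearby points of the
  -- open side.
  · have hne : (𝓝[side Ω ψ] p).NeBot :=
      (hacc p hp (by linarith [dist_triangle p b b₀])).neBot hρ₁
    have h1 : Tendsto (fun q => |pd i j w q
          - taylorPoly N (fun m n => sideJet (side Ω ψ) w b (i + m) (j + n)) (q - b)|)
        (𝓝[side Ω ψ] p) (𝓝 |sideJet (side Ω ψ) w p i j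
          - taylorPoly N (fun m n => sideJet (side Ω ψ) w b (i + m) (j + n)) (p - b)|) := by
      refine ((hw.tendsto (by omega) hp).sub (Tendsto.mono_left ?_ nhdsWithin_le_nhds)).abs
      exact ((continuous_taylorPoly N _).comp (continuous_id.sub continuous_const)).tendsto p
    have h2 : Tendsto (fun q => C * dist q b ^ (N + 1)) (𝓝[side Ω ψ] p)
        (𝓝 (C * dist p b ^ (N + 1))) := by
      refine Tendsto.mono_left ?_ nhdsWithin_le_nhds
      exact (continuous_const.mul ((continuous_id.dist continuous_const).pow _)).tendsto p
    refine le_of_tendsto_of_tendsto h1 h2 ?_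
    have h3 : ∀ᶠ q in 𝓝[side Ω ψ] p, dist q b < ρ₂ :=
      nhdsWithin_le_nhds ((continuous_id.dist continuous_const).continuousAt.eventually
        (gt_mem_nhds (show dist (id p) b < ρ₂ from hpd.trans_le hρ3)))
    filter_upwards [h3, self_mem_nhdsWithin] with q hq1 hq2 using key' q hq2 hq1

/-! ### The reduced Taylor polynomials -/

lemma Lam_one : Lam 1 = {(0, 0), (0, 1), (1, 0)} := by decide

lemma Lam_two : Lam 2 = {(0, 0), (0, 1), (0, 2), (1, 0), (1, 1), (2, 0)} := by decide

lemma Lam_three : Lam 3 =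
    {(0, 0), (0, 1), (0, 2), (0, 3), (1, 0), (1, 1), (1, 2), (2, 0), (2, 1), (3, 0)} := by decide

lemma Lam1_three : Lam1 3 =
    {(0, 0), (0, 1), (0, 2), (0, 3), (1, 0), (1, 1), (1, 2)} := by decide

/-- `u20`, `u21` and `u30` are jointly linear in the jets of `u` and `f`, so their values on unit
jets determine them. -/
lemma reduced_eq_sum (α υ φ : ℕ → ℕ → ℝ) {q : ℕ × ℕ} (hq : q ∈ Lam 3) :
    reduced α υ φ q.1 q.2 = ∑ k ∈ Lam1 3, υ k.1 k.2 * Au α q.1 q.2 k.1 k.2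
      + ∑ k ∈ Lam 1, φ k.1 k.2 * Af α q.1 q.2 k.1 k.2 := by
  rw [Lam_three] at hq
  simp only [Finset.mem_insert, Finset.mem_singleton] at hq
  rw [Lam1_three, Lam_one]
  rcases hq with rfl | rfl | rfl | rfl | rfl | rfl | rfl | rfl | rfl | rfl <;>
  simp [Au, Af, reduced, u20, u21, u30, unitJet] <;> ring

/-- The alternating sum in `G` collects the terms of order `m + n`, where the equation acts as `u_xx
= -u_yy`; the second sum collects the higher orders, which see the derivatives of `a`. In this form
`G` becomes accessible to the calculus of Taylor polynomials. -/
lemma G_eq (α : ℕ → ℕ → ℝ) {q : ℕ × ℕ} (hq : q ∈ Lam1 3) :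
    G α q.1 q.2 = taylorPoly 3 (fun i j => Au α i j q.1 q.2) := by
  funext p
  rw [Lam1_three] at hq
  simp only [Finset.mem_insert, Finset.mem_singleton] at hq
  have h0 : Lam2 3 \ Lam2 0 = {(2, 0), (2, 1), (3, 0)} := by decide
  have h1 : Lam2 3 \ Lam2 1 = {(2, 0), (2, 1), (3, 0)} := by decide
  have h2 : Lam2 3 \ Lam2 2 = {(2, 1), (3, 0)} := by decide
  rcases hq with rfl | rfl | rfl | rfl | rfl | rfl | rfl <;>
  simp [G, taylorPoly, Lam_three, h0, h1, h2, Au, reduced, u20, u21, u30, unitJet,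
    Finset.sum_range_succ] <;> ring

lemma H_eq (α : ℕ → ℕ → ℝ) {q : ℕ × ℕ} (hq : q ∈ Lam 1) :
    H α q.1 q.2 = taylorPoly 3 (fun i j => Af α i j q.1 q.2) := by
  funext p
  rw [Lam_one] at hq
  simp only [Finset.mem_insert, Finset.mem_singleton] at hq
  have h2 : Lam2 3 \ Lam2 2 = {(2, 1), (3, 0)} := by decide
  rcases hq with rfl | rfl | rfl <;>
  simp [H, taylorPoly, Lam_three, h2, Af, reduced, u20, u21, u30, unitJet] <;> ring

/-- Solving the equation for a derivative never introduces derivatives of higher order. This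
triangularity allows the transmission problem to be solved order by order. -/
lemma Au_eq_zero (α : ℕ → ℕ → ℝ) {q k : ℕ × ℕ} (hk : k ∈ Lam1 3)
    (hqk : q.1 + q.2 < k.1 + k.2) : Au α q.1 q.2 k.1 k.2 = 0 := by
  have hq : q ∈ Lam 3 := mem_Lam.2 (by have := (mem_Lam1.1 hk).1; omega)
  rw [Lam_three] at hq
  rw [Lam1_three] at hk
  simp only [Finset.mem_insert, Finset.mem_singleton] at hq hk
  rcases hk with rfl | rfl | rfl | rfl | rfl | rfl | rfl <;>
  rcases hq with rfl | rfl | rfl | rfl | rfl | rfl | rfl | rfl | rfl | rfl <;>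
  first
  | (exfalso; revert hqk; norm_num; done)
  | simp [Au, reduced, u20, unitJet]

/-! ### Formal Taylor series along the interface -/

/-- The formal Taylor series at `0`. -/
def ser (f : ℝ → ℝ) : PowerSeries ℝ := PowerSeries.mk (coeffAt f)

@[simp] lemma coeff_ser (f : ℝ → ℝ) (p : ℕ) : PowerSeries.coeff p (ser f) = coeffAt f p := by
  simp [ser]

/-- Leibniz' rule divided by factorials is the Cauchy product. Products along the curve thus become
products of power series, where orders of vanishing are divisibility by powers of `X`. -/
lemma ser_mul {f g : ℝ → ℝ} (hf : ContDiffAt ℝ ∞ f 0) (hg : ContDiffAt ℝ ∞ g 0) :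
    ser (fun t => f t * g t) = ser f * ser g := by
  ext p
  have hfp : ContDiffAt ℝ p f 0 := hf.of_le (by exact_mod_cast le_top)
  have hgp : ContDiffAt ℝ p g 0 := hg.of_le (by exact_mod_cast le_top)
  have h := iteratedDeriv_mul hfp hgp
  rw [PowerSeries.coeff_mul, Finset.Nat.sum_antidiagonal_eq_sum_range_succ_mk]
  simp only [coeff_ser, coeffAt]
  change iteratedDeriv p (f * g) 0 / _ = _
  rw [h, Finset.sum_div]
  refine Finset.sum_congr rfl fun i hi => ?_
  have hip : i ≤ p := by simpa [Nat.lt_succ_iff] using hi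
  rw [Nat.cast_choose ℝ hip]
  have h1 : (Nat.factorial p : ℝ) ≠ 0 := by positivity
  have h2 : (Nat.factorial i : ℝ) ≠ 0 := by positivity
  have h3 : (Nat.factorial (p - i) : ℝ) ≠ 0 := by positivity
  field_simp

lemma ser_add {f g : ℝ → ℝ} (hf : ContDiffAt ℝ ∞ f 0) (hg : ContDiffAt ℝ ∞ g 0) :
    ser (fun t => f t + g t) = ser f + ser g := by
  ext p
  have hfp : ContDiffAt ℝ p f 0 := hf.of_le (by exact_mod_cast le_top)
  have hgp : ContDiffAt ℝ p g 0 := hg.of_le (by exact_mod_cast le_top)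
  have h := iteratedDeriv_add hfp hgp
  simp only [map_add, coeff_ser, coeffAt]
  change iteratedDeriv p (f + g) 0 / _ = _
  rw [h, add_div]

lemma ser_sub {f g : ℝ → ℝ} (hf : ContDiffAt ℝ ∞ f 0) (hg : ContDiffAt ℝ ∞ g 0) :
    ser (fun t => f t - g t) = ser f - ser g := by
  ext p
  have hfp : ContDiffAt ℝ p f 0 := hf.of_le (by exact_mod_cast le_top)
  have hgp : ContDiffAt ℝ p g 0 := hg.of_le (by exact_mod_cast le_top)
  have h := iteratedDeriv_sub hfp hgp
  simp only [map_sub, coeff_ser, coeffAt]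
  change iteratedDeriv p (f - g) 0 / _ = _
  rw [h, sub_div]

lemma ser_const (c : ℝ) : ser (fun _ => c) = PowerSeries.C c := by
  ext p
  rw [coeff_ser, PowerSeries.coeff_C, coeffAt, iteratedDeriv_const]
  split_ifs with h <;> simp [h]

lemma ser_pow {f : ℝ → ℝ} (hf : ContDiffAt ℝ ∞ f 0) (n : ℕ) :
    ser (fun t => f t ^ n) = ser f ^ n := by
  induction n with
  | zero => simpa using ser_const 1
  | succ n ih => simp only [pow_succ]; rw [ser_mul (hf.pow n) hf, ih]

lemma ser_sum {ι : Type*} (s : Finset ι) {f : ι → ℝ → ℝ} (hf : ∀ i ∈ s, ContDiffAt ℝ ∞ (f i) 0) :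
    ser (fun t => ∑ i ∈ s, f i t) = ∑ i ∈ s, ser (f i) := by
  classical
  induction s using Finset.induction_on with
  | empty => simpa using ser_const 0
  | insert a s ha ih =>
    simp only [Finset.sum_insert ha]
    rw [ser_add (hf a (by simp)) (ContDiffAt.sum fun i hi => hf i (by simp [hi])),
      ih fun i hi => hf i (by simp [hi])]

lemma coeff_ser_deriv (f : ℝ → ℝ) (n : ℕ) :
    PowerSeries.coeff n (ser (deriv f)) = (n + 1) * PowerSeries.coeff (n + 1) (ser f) := by
  simp only [coeff_ser, coeffAt]
  rw [← iteratedDeriv_succ', Nat.factorial_succ]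
  push_cast
  field_simp

lemma contDiffAt_deriv {f : ℝ → ℝ} (hf : ContDiffAt ℝ ∞ f 0) : ContDiffAt ℝ ∞ (deriv f) 0 := by
  have h1 : ContDiffAt ℝ ∞ (fderiv ℝ f) 0 := hf.fderiv_right (by simp)
  have h2 : deriv f = fun t => fderiv ℝ f t 1 := by funext t; simp
  rw [h2]
  exact h1.clm_apply contDiffAt_const

/-- If `f` vanishes to the order `N + 1` at `0`, so do its Taylor coefficients. -/
theorem coeffAt_eq_zero {f : ℝ → ℝ} (hf : ContDiffAt ℝ ∞ f 0) {N : ℕ}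
    (h : f =O[𝓝[>] 0] fun t => t ^ (N + 1)) : ∀ p ≤ N, coeffAt f p = 0 := by
  intro p
  induction p using Nat.strong_induction_on with
  | _ p ih =>
  intro hp
  have hfp : ContDiffAt ℝ p f 0 := hf.of_le (by exact_mod_cast le_top)
  obtain ⟨V, hV, hfV⟩ := hfp.contDiffOn (m := p) le_rfl (by simp)
  obtain ⟨r, hr, hball⟩ := Metric.mem_nhds_iff.1 hV
  have hT := taylor_isLittleO (convex_ball (0 : ℝ) r) (Metric.mem_ball_self hr) (hfV.mono hball)
  -- The lower coefficients vanish by induction, so Peano's form of Taylor's formula leaves a single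
  -- term. As `f` is also `o(t ^ p)`, this term is `o(t ^ p)`, which forces its coefficient to be
  -- zero.
  have hT' : (fun t => f t - coeffAt f p * t ^ p) =o[𝓝[>] 0] fun t : ℝ => t ^ p := by
    have h1 := hT.mono (show 𝓝[>] (0 : ℝ) ≤ 𝓝[Metric.ball 0 r] 0 by
      rw [Metric.isOpen_ball.nhdsWithin_eq (Metric.mem_ball_self hr)]; exact nhdsWithin_le_nhds)
    simp only [sub_zero] at h1
    refine h1.congr_left fun t => ?_
    rw [taylor_within_apply, Finset.sum_eq_single p]
    · rw [iteratedDerivWithin_of_isOpen Metric.isOpen_ball (Metric.mem_ball_self hr), coeffAt]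
      simp [div_eq_mul_inv]; ring
    · intro k hk hkp
      have hk' : k < p := by
        have := Finset.mem_range.1 hk; omega
      have h2 := ih k hk' (by omega)
      rw [coeffAt, div_eq_zero_iff] at h2
      rw [iteratedDerivWithin_of_isOpen Metric.isOpen_ball (Metric.mem_ball_self hr)]
      rcases h2 with h2 | h2
      · simp [h2]
      · exact absurd h2 (by positivity)
    · intro h; simp at h
  have ho : (fun t : ℝ => t ^ (N + 1)) =o[𝓝[>] 0] fun t : ℝ => t ^ p :=
    (isLittleO_pow_pow (by omega)).mono nhdsWithin_le_nhds
  have hc : (fun t : ℝ => coeffAt f p * t ^ p) =o[𝓝[>] 0] fun t : ℝ => t ^ p :=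
    ((h.trans_isLittleO ho).sub hT').congr_left fun t => by ring
  by_contra hne
  have h3 := (isLittleO_const_mul_left_iff hne).1 hc
  refine isLittleO_irrefl (Eventually.frequently ?_) h3
  filter_upwards [self_mem_nhdsWithin] with t ht using pow_ne_zero _ (ne_of_gt ht)

namespace LocalGeometry

variable (L : LocalGeometry)

/-- The parametrization is smooth and passes through the base point at `t = 0`. -/
structure Smooth : Prop where
  r : ContDiffAt ℝ ∞ L.r 0
  s : ContDiffAt ℝ ∞ L.s 0
  r_zero : L.r 0 = 0
  s_zero : L.s 0 = 0

/-- The Taylor series of `mono m n` along the interface. -/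
def serMono (m n : ℕ) : PowerSeries ℝ :=
  PowerSeries.C (((Nat.factorial m : ℝ) * (Nat.factorial n : ℝ))⁻¹) * (ser L.r ^ m * ser L.s ^ n)

/-- The Taylor series of `taylorPoly N J` along the interface. -/
def serPoly (N : ℕ) (J : ℕ → ℕ → ℝ) : PowerSeries ℝ :=
  ∑ q ∈ Lam N, PowerSeries.C (J q.1 q.2) * L.serMono q.1 q.2

variable {L}

lemma Smooth.mono (hL : L.Smooth) (m n : ℕ) :
    ContDiffAt ℝ ∞ (fun t => EllipticInterface.mono m n (L.r t, L.s t)) 0 := by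
  unfold EllipticInterface.mono
  exact ((hL.r.pow m).mul (hL.s.pow n)).div_const _

lemma Smooth.taylorPoly (hL : L.Smooth) (N : ℕ) (J : ℕ → ℕ → ℝ) :
    ContDiffAt ℝ ∞ (fun t => EllipticInterface.taylorPoly N J (L.r t, L.s t)) 0 :=
  ContDiffAt.sum fun q _ => contDiffAt_const.mul (hL.mono q.1 q.2)

lemma Smooth.ser_taylorPoly (hL : L.Smooth) (N : ℕ) (J : ℕ → ℕ → ℝ) :
    ser (fun t => EllipticInterface.taylorPoly N J (L.r t, L.s t)) = L.serPoly N J := by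
  unfold EllipticInterface.taylorPoly serPoly
  rw [ser_sum _ fun q _ => contDiffAt_const.mul (hL.mono q.1 q.2)]
  refine Finset.sum_congr rfl fun q _ => ?_
  rw [ser_mul contDiffAt_const (hL.mono q.1 q.2), ser_const, serMono, ← ser_const (_⁻¹),
    ← ser_pow hL.r, ← ser_pow hL.s, ← ser_mul (hL.r.pow _) (hL.s.pow _),
    ← ser_mul contDiffAt_const ((hL.r.pow _).mul (hL.s.pow _))]
  congr 2
  funext t
  rw [EllipticInterface.mono]
  field_simp

lemma Smooth.along_taylorPoly (hL : L.Smooth) (N : ℕ) (J : ℕ → ℕ → ℝ) (p : ℕ) :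
    L.along (EllipticInterface.taylorPoly N J) p = PowerSeries.coeff p (L.serPoly N J) := by
  rw [along, ← coeff_ser, hL.ser_taylorPoly]

lemma Smooth.flux (hL : L.Smooth) (α : ℕ → ℕ → ℝ) (N : ℕ) (J : ℕ → ℕ → ℝ) :
    ContDiffAt ℝ ∞ (fun t => taylorA α (L.r t, L.s t) *
      (dX (EllipticInterface.taylorPoly (N + 1) J) (L.r t, L.s t) * deriv L.s t
        - dY (EllipticInterface.taylorPoly (N + 1) J) (L.r t, L.s t) * deriv L.r t)) 0 := by
  simp only [dX_taylorPoly, dY_taylorPoly]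
  exact (hL.taylorPoly 2 α).mul (((hL.taylorPoly N _).mul (contDiffAt_deriv hL.s)).sub
    ((hL.taylorPoly N _).mul (contDiffAt_deriv hL.r)))

lemma Smooth.fluxAlong_taylorPoly (hL : L.Smooth) (α : ℕ → ℕ → ℝ) (N : ℕ) (J : ℕ → ℕ → ℝ)
    (p : ℕ) :
    L.fluxAlong α (EllipticInterface.taylorPoly (N + 1) J) p =
      PowerSeries.coeff p (L.serPoly 2 α * (L.serPoly N (fun i j => J (i + 1) j) * ser (deriv L.s)
        - L.serPoly N (fun i j => J i (j + 1)) * ser (deriv L.r))) := by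
  rw [fluxAlong, ← coeff_ser]
  simp only [dX_taylorPoly, dY_taylorPoly]
  have hs := contDiffAt_deriv hL.s
  have hr := contDiffAt_deriv hL.r
  have h1 := (hL.taylorPoly N (fun i j => J (i + 1) j)).mul hs
  have h2 := (hL.taylorPoly N (fun i j => J i (j + 1))).mul hr
  have h3 : ContDiffAt ℝ ∞ (fun t => taylorA α (L.r t, L.s t)) 0 := hL.taylorPoly 2 α
  have h4 : ser (fun t => taylorA α (L.r t, L.s t)) = L.serPoly 2 α := hL.ser_taylorPoly 2 α
  rw [ser_mul h3 (h1.sub h2), ser_sub h1 h2, ser_mul (hL.taylorPoly N _) hs,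
    ser_mul (hL.taylorPoly N _) hr, hL.ser_taylorPoly, hL.ser_taylorPoly, h4]

/-! ### Functionals that depend linearly on the jet -/

/-- The functional `Φ` is linear on the polynomials `taylorPoly 3 J`. -/
def _root_.EllipticInterface.LinTaylor (Φ : (ℝ × ℝ → ℝ) → ℝ) : Prop :=
  ∃ c : ℕ × ℕ → ℝ, ∀ J : ℕ → ℕ → ℝ,
    Φ (EllipticInterface.taylorPoly 3 J) = ∑ q ∈ Lam 3, J q.1 q.2 * c q

/-- The regrouping into `G` and `H` is done once for all linear functionals. It is applied to point
values, directional derivatives, and the coefficients of traces and fluxes along the curve. -/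
lemma _root_.EllipticInterface.LinTaylor.reduced {Φ : (ℝ × ℝ → ℝ) → ℝ} (h : LinTaylor Φ)
    {α υ φ J : ℕ → ℕ → ℝ}
    (hJ : ∀ q ∈ Lam 3, J q.1 q.2 = EllipticInterface.reduced α υ φ q.1 q.2) :
    Φ (EllipticInterface.taylorPoly 3 J) = ∑ k ∈ Lam1 3, υ k.1 k.2 * Φ (G α k.1 k.2)
      + ∑ k ∈ Lam 1, φ k.1 k.2 * Φ (H α k.1 k.2) := by
  obtain ⟨c, hc⟩ := h
  have h1 : ∀ k ∈ Lam1 3, υ k.1 k.2 * Φ (G α k.1 k.2)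
      = ∑ q ∈ Lam 3, υ k.1 k.2 * Au α q.1 q.2 k.1 k.2 * c q := fun k hk => by
    rw [G_eq α hk, hc, Finset.mul_sum]
    exact Finset.sum_congr rfl fun q _ => by ring
  have h2 : ∀ k ∈ Lam 1, φ k.1 k.2 * Φ (H α k.1 k.2)
      = ∑ q ∈ Lam 3, φ k.1 k.2 * Af α q.1 q.2 k.1 k.2 * c q := fun k hk => by
    rw [H_eq α hk, hc, Finset.mul_sum]
    exact Finset.sum_congr rfl fun q _ => by ring
  rw [Finset.sum_congr rfl h1, Finset.sum_congr rfl h2, Finset.sum_comm,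
    Finset.sum_comm (s := Lam 1), ← Finset.sum_add_distrib, hc]
  refine Finset.sum_congr rfl fun q hq => ?_
  rw [hJ q hq, reduced_eq_sum α υ φ hq, add_mul, Finset.sum_mul, Finset.sum_mul]

lemma _root_.EllipticInterface.linTaylor_eval (p : ℝ × ℝ) : LinTaylor fun w => w p :=
  ⟨fun q => EllipticInterface.mono q.1 q.2 p, fun _ => rfl⟩

lemma Smooth.linTaylor_along (hL : L.Smooth) (p : ℕ) : LinTaylor fun w => L.along w p :=
  ⟨fun q => PowerSeries.coeff p (L.serMono q.1 q.2), fun J => by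
    simp [hL.along_taylorPoly, serPoly]⟩

lemma _root_.EllipticInterface.linTaylor_partials (p : ℝ × ℝ) (x y : ℝ) :
    LinTaylor fun w => dX w p * x + dY w p * y :=
  ⟨fun q => monoX q.1 q.2 p * x + monoY q.1 q.2 p * y, fun J => by
    dsimp only
    rw [dX_taylorPoly, dY_taylorPoly, ← taylorPoly_sum_monoX, ← taylorPoly_sum_monoY,
      Finset.sum_mul, Finset.sum_mul, ← Finset.sum_add_distrib]
    exact Finset.sum_congr rfl fun q _ => by ring⟩

lemma Smooth.linTaylor_fluxAlong (hL : L.Smooth) (α : ℕ → ℕ → ℝ) (p : ℕ) :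
    LinTaylor fun w => L.fluxAlong α w p := by
  refine ⟨fun q => coeffAt (fun t => taylorA α (L.r t, L.s t) *
    (monoX q.1 q.2 (L.r t, L.s t) * deriv L.s t
      + monoY q.1 q.2 (L.r t, L.s t) * (-deriv L.r t))) p, fun J => ?_⟩
  have hm : ∀ m n, ContDiffAt ℝ ∞ (fun t => taylorA α (L.r t, L.s t) *
      (monoX m n (L.r t, L.s t) * deriv L.s t
        + monoY m n (L.r t, L.s t) * (-deriv L.r t))) 0 := by
    intro m n
    have hX : ContDiffAt ℝ ∞ (fun t => monoX m n (L.r t, L.s t)) 0 := by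
      unfold monoX; split_ifs
      · exact contDiffAt_const
      · exact hL.mono _ _
    have hY : ContDiffAt ℝ ∞ (fun t => monoY m n (L.r t, L.s t)) 0 := by
      unfold monoY; split_ifs
      · exact contDiffAt_const
      · exact hL.mono _ _
    exact (hL.taylorPoly 2 α).mul ((hX.mul (contDiffAt_deriv hL.s)).add
      (hY.mul (contDiffAt_deriv hL.r).neg))
  dsimp only
  rw [fluxAlong, ← coeff_ser]
  have h : (fun t => taylorA α (L.r t, L.s t) *
      (dX (EllipticInterface.taylorPoly 3 J) (L.r t, L.s t) * deriv L.s t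
        - dY (EllipticInterface.taylorPoly 3 J) (L.r t, L.s t) * deriv L.r t))
      = fun t => ∑ q ∈ Lam 3, J q.1 q.2 * (taylorA α (L.r t, L.s t) *
        (monoX q.1 q.2 (L.r t, L.s t) * deriv L.s t
          + monoY q.1 q.2 (L.r t, L.s t) * (-deriv L.r t))) := by
    funext t
    rw [dX_taylorPoly, dY_taylorPoly, ← taylorPoly_sum_monoX, ← taylorPoly_sum_monoY,
      Finset.sum_mul, Finset.sum_mul, ← Finset.sum_sub_distrib, Finset.mul_sum]
    exact Finset.sum_congr rfl fun q _ => by ring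
  rw [h, ser_sum _ fun q _ => contDiffAt_const.mul (hm q.1 q.2), map_sum]
  refine Finset.sum_congr rfl fun q _ => ?_
  rw [ser_mul contDiffAt_const (hm q.1 q.2), ser_const, PowerSeries.coeff_C_mul, coeff_ser]

/-! ### Leading coefficients -/

lemma Smooth.ser_r (hL : L.Smooth) :
    ∃ R, ser L.r = PowerSeries.X * R ∧ PowerSeries.constantCoeff R = deriv L.r 0 := by
  have h : PowerSeries.X ∣ ser L.r := by
    rw [PowerSeries.X_dvd_iff, ← PowerSeries.coeff_zero_eq_constantCoeff_apply, coeff_ser]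
    simp [coeffAt, hL.r_zero]
  obtain ⟨R, hR⟩ := h
  refine ⟨R, hR, ?_⟩
  have := congrArg (PowerSeries.coeff (0 + 1)) hR
  rw [coeff_ser, PowerSeries.coeff_succ_X_mul, PowerSeries.coeff_zero_eq_constantCoeff_apply] at this
  rw [← this]; simp [coeffAt]

lemma Smooth.ser_s (hL : L.Smooth) :
    ∃ R, ser L.s = PowerSeries.X * R ∧ PowerSeries.constantCoeff R = deriv L.s 0 := by
  have h : PowerSeries.X ∣ ser L.s := by
    rw [PowerSeries.X_dvd_iff, ← PowerSeries.coeff_zero_eq_constantCoeff_apply, coeff_ser]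
    simp [coeffAt, hL.s_zero]
  obtain ⟨R, hR⟩ := h
  refine ⟨R, hR, ?_⟩
  have := congrArg (PowerSeries.coeff (0 + 1)) hR
  rw [coeff_ser, PowerSeries.coeff_succ_X_mul, PowerSeries.coeff_zero_eq_constantCoeff_apply] at this
  rw [← this]; simp [coeffAt]

/-- Both `r` and `s` vanish at `0`, so a monomial of degree `m + n` vanishes to that order along the
curve, and its leading coefficient sees only `r'(0)` and `s'(0)`. -/
lemma Smooth.serMono_eq (hL : L.Smooth) (m n : ℕ) :
    ∃ R, L.serMono m n = PowerSeries.X ^ (m + n) * R ∧ PowerSeries.constantCoeff R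
      = deriv L.r 0 ^ m * deriv L.s 0 ^ n / ((Nat.factorial m : ℝ) * (Nat.factorial n : ℝ)) := by
  obtain ⟨R₁, h1, h1'⟩ := hL.ser_r
  obtain ⟨R₂, h2, h2'⟩ := hL.ser_s
  refine ⟨PowerSeries.C (((Nat.factorial m : ℝ) * (Nat.factorial n : ℝ))⁻¹) * (R₁ ^ m * R₂ ^ n),
    ?_, ?_⟩
  · rw [serMono, h1, h2]; ring
  · simp only [map_mul, map_pow, h1', h2', PowerSeries.constantCoeff_C]
    rw [div_eq_inv_mul]

lemma Smooth.coeff_serMono (hL : L.Smooth) {d m n : ℕ} (h : d ≤ m + n) :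
    PowerSeries.coeff d (L.serMono m n) = if m + n = d then
      deriv L.r 0 ^ m * deriv L.s 0 ^ n / ((Nat.factorial m : ℝ) * (Nat.factorial n : ℝ))
      else 0 := by
  obtain ⟨R, h1, h2⟩ := hL.serMono_eq m n
  rw [h1, PowerSeries.coeff_X_pow_mul']
  split_ifs with h3 h4 h4
  · subst h4
    rw [Nat.sub_self, PowerSeries.coeff_zero_eq_constantCoeff_apply, h2]
  · omega
  · omega
  · rfl

lemma Smooth.X_pow_dvd_serPoly (hL : L.Smooth) {N d : ℕ} {J : ℕ → ℕ → ℝ}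
    (hJ : ∀ q : ℕ × ℕ, q.1 + q.2 < d → J q.1 q.2 = 0) : PowerSeries.X ^ d ∣ L.serPoly N J := by
  refine Finset.dvd_sum fun q _ => ?_
  by_cases h : q.1 + q.2 < d
  · simp [hJ q h]
  · obtain ⟨R, h1, -⟩ := hL.serMono_eq q.1 q.2
    rw [h1]
    exact ((pow_dvd_pow _ (by omega)).mul_right R).mul_left _

lemma Smooth.coeff_serPoly (hL : L.Smooth) {N d : ℕ} {J : ℕ → ℕ → ℝ}
    (hJ : ∀ q : ℕ × ℕ, q.1 + q.2 < d → J q.1 q.2 = 0) :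
    PowerSeries.coeff d (L.serPoly N J) = ∑ q ∈ Lam N, if q.1 + q.2 = d then
      J q.1 q.2 * (deriv L.r 0 ^ q.1 * deriv L.s 0 ^ q.2
        / ((Nat.factorial q.1 : ℝ) * (Nat.factorial q.2 : ℝ))) else 0 := by
  rw [serPoly, map_sum]
  refine Finset.sum_congr rfl fun q _ => ?_
  rw [PowerSeries.coeff_C_mul]
  by_cases h : q.1 + q.2 < d
  · rw [hJ q h, zero_mul, if_neg h.ne]
  · rw [hL.coeff_serMono (not_lt.1 h)]
    split_ifs <;> simp

lemma _root_.EllipticInterface.coeff_mul_of_X_pow_dvd {d : ℕ} (A : PowerSeries ℝ)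
    {P : PowerSeries ℝ} (h : PowerSeries.X ^ d ∣ P) :
    PowerSeries.coeff d (A * P) = PowerSeries.coeff 0 A * PowerSeries.coeff d P := by
  obtain ⟨R, rfl⟩ := h
  rw [show A * (PowerSeries.X ^ d * R) = PowerSeries.X ^ d * (A * R) by ring,
    PowerSeries.coeff_X_pow_mul', PowerSeries.coeff_X_pow_mul']
  simp

/-- By `Au_eq_zero` the polynomial `G` has no terms of degree below `k.1 + k.2`. Hence unknowns of
order above `p` are absent from the jump condition of order `p`. -/
lemma Smooth.along_G_eq_zero (hL : L.Smooth) (α : ℕ → ℕ → ℝ) {k : ℕ × ℕ} (hk : k ∈ Lam1 3)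
    {p : ℕ} (hp : p < k.1 + k.2) : L.along (G α k.1 k.2) p = 0 := by
  rw [G_eq α hk, hL.along_taylorPoly]
  exact PowerSeries.X_pow_dvd_iff.1
    (hL.X_pow_dvd_serPoly (d := k.1 + k.2) (J := fun i j => Au α i j k.1 k.2)
      fun _ hq => Au_eq_zero α hk hq) p hp

/-- The gradient lowers the degree by one, so the flux condition of order `p` pairs with the
condition on `u` of order `p + 1`. -/
lemma Smooth.fluxAlong_G_eq_zero (hL : L.Smooth) (α β : ℕ → ℕ → ℝ) {k : ℕ × ℕ} (hk : k ∈ Lam1 3)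
    {p : ℕ} (hp : p + 1 < k.1 + k.2) : L.fluxAlong β (G α k.1 k.2) p = 0 := by
  rw [G_eq α hk, hL.fluxAlong_taylorPoly]
  refine (PowerSeries.X_pow_dvd_iff (n := p + 1)).1 ?_ p (Nat.lt_succ_self p)
  refine dvd_mul_of_dvd_right (dvd_sub (dvd_mul_of_dvd_left ?_ _) (dvd_mul_of_dvd_left ?_ _)) _
  · exact hL.X_pow_dvd_serPoly (J := fun i j => Au α (i + 1) j k.1 k.2) fun q hq =>
      Au_eq_zero α (q := (q.1 + 1, q.2)) hk (by dsimp only; omega)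
  · exact hL.X_pow_dvd_serPoly (J := fun i j => Au α i (j + 1) k.1 k.2) fun q hq =>
      Au_eq_zero α (q := (q.1, q.2 + 1)) hk (by dsimp only; omega)

lemma Smooth.along_G (hL : L.Smooth) (α : ℕ → ℕ → ℝ) {k : ℕ × ℕ} (hk : k ∈ Lam1 3) :
    L.along (G α k.1 k.2) (k.1 + k.2) = ∑ q ∈ Lam 3, if q.1 + q.2 = k.1 + k.2 then
      Au α q.1 q.2 k.1 k.2 * (deriv L.r 0 ^ q.1 * deriv L.s 0 ^ q.2
        / ((Nat.factorial q.1 : ℝ) * (Nat.factorial q.2 : ℝ))) else 0 := by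
  rw [G_eq α hk, hL.along_taylorPoly, hL.coeff_serPoly
    (J := fun i j => Au α i j k.1 k.2) fun _ hq => Au_eq_zero α hk hq]

/-- At leading order only the constant term of the coefficient and the values `r'(0)`, `s'(0)`
survive. -/
lemma Smooth.fluxAlong_G (hL : L.Smooth) (α β : ℕ → ℕ → ℝ) {k : ℕ × ℕ} (hk : k ∈ Lam1 3) {p : ℕ}
    (hp : p + 1 = k.1 + k.2) :
    L.fluxAlong β (G α k.1 k.2) p = β 0 0 *
      ((∑ q ∈ Lam 2, if q.1 + q.2 = p then
        Au α (q.1 + 1) q.2 k.1 k.2 * (deriv L.r 0 ^ q.1 * deriv L.s 0 ^ q.2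
          / ((Nat.factorial q.1 : ℝ) * (Nat.factorial q.2 : ℝ))) else 0) * deriv L.s 0
      - (∑ q ∈ Lam 2, if q.1 + q.2 = p then
        Au α q.1 (q.2 + 1) k.1 k.2 * (deriv L.r 0 ^ q.1 * deriv L.s 0 ^ q.2
          / ((Nat.factorial q.1 : ℝ) * (Nat.factorial q.2 : ℝ))) else 0) * deriv L.r 0) := by
  have hX : ∀ q : ℕ × ℕ, q.1 + q.2 < p → Au α (q.1 + 1) q.2 k.1 k.2 = 0 := fun q hq =>
    Au_eq_zero α (q := (q.1 + 1, q.2)) hk (by dsimp only; omega)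
  have hY : ∀ q : ℕ × ℕ, q.1 + q.2 < p → Au α q.1 (q.2 + 1) k.1 k.2 = 0 := fun q hq =>
    Au_eq_zero α (q := (q.1, q.2 + 1)) hk (by dsimp only; omega)
  have dX := hL.X_pow_dvd_serPoly (N := 2) (J := fun i j => Au α (i + 1) j k.1 k.2) hX
  have dY := hL.X_pow_dvd_serPoly (N := 2) (J := fun i j => Au α i (j + 1) k.1 k.2) hY
  have h0 : PowerSeries.coeff 0 (L.serPoly 2 β) = β 0 0 := by
    rw [hL.coeff_serPoly (by simp), Lam_two]; simp
  have hs : PowerSeries.coeff 0 (ser (deriv L.s)) = deriv L.s 0 := by simp [coeffAt]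
  have hr : PowerSeries.coeff 0 (ser (deriv L.r)) = deriv L.r 0 := by simp [coeffAt]
  rw [G_eq α hk, hL.fluxAlong_taylorPoly, coeff_mul_of_X_pow_dvd _
      (dvd_sub (dvd_mul_of_dvd_left dX _) (dvd_mul_of_dvd_left dY _)), map_sub,
    mul_comm (L.serPoly 2 _), mul_comm (L.serPoly 2 _), coeff_mul_of_X_pow_dvd _ dX,
    coeff_mul_of_X_pow_dvd _ dY, h0, hs, hr,
    hL.coeff_serPoly (d := p) (J := fun i j => Au α (i + 1) j k.1 k.2) hX,
    hL.coeff_serPoly (d := p) (J := fun i j => Au α i (j + 1) k.1 k.2) hY]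
  ring

/-- The leading parts of `G_{0,p}` and `G_{1,p-1}` are the real and imaginary parts of `(y + i x)^p
/ p!`. With `ζ = s'(0) + i r'(0)`, the values along the curve are `Re ζ^p / p!` and `Im ζ^p / p!`,
and the fluxes are `-a_- Im ζ^p / (p-1)!` and `a_- Re ζ^p / (p-1)!`. The determinant is therefore a
positive multiple of `a_- |ζ|^{2p}`. -/
theorem Smooth.det_eq (hL : L.Smooth) {p : ℕ} (h1 : 1 ≤ p) (h3 : p ≤ 3) :
    L.det p = L.αM 0 0 * (deriv L.r 0 ^ 2 + deriv L.s 0 ^ 2) ^ p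
      / ((Nat.factorial p : ℝ) * (Nat.factorial (p - 1) : ℝ)) := by
  have k0 : ((0, p) : ℕ × ℕ) ∈ Lam1 3 := mem_Lam1.2 ⟨by simpa using h3, by simp⟩
  have k1 : ((1, p - 1) : ℕ × ℕ) ∈ Lam1 3 := mem_Lam1.2 ⟨by dsimp only; omega, by simp⟩
  have e0 := hL.along_G L.αM k0
  have e1 := hL.along_G L.αM k1
  have f0 := hL.fluxAlong_G L.αM L.αM k0 (p := p - 1) (by dsimp only; omega)
  have f1 := hL.fluxAlong_G L.αM L.αM k1 (p := p - 1) (by dsimp only; omega)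
  dsimp only at e0 e1 f0 f1
  rw [zero_add] at e0
  rw [show 1 + (p - 1) = p by omega] at e1
  rw [det, e0, e1, f0, f1, Lam_two, Lam_three]
  obtain rfl | rfl | rfl : p = 1 ∨ p = 2 ∨ p = 3 := by omega
  · simp [Au, reduced, unitJet]; ring
  · simp [Au, reduced, u20, u21, u30, unitJet, Nat.factorial]; ring
  · simp [Au, reduced, u20, u21, u30, unitJet, Nat.factorial]; ring

end LocalGeometry

/-! ### Linear dependence of the transmitted jet on the data -/

/-- `F` depends linearly on the entries of the jet data that enter the transmission formula. -/
def IsLin (F : JetData → ℝ) : Prop :=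
  ∃ cu cp cm c₁ c₂ : ℕ × ℕ → ℝ, ∀ D : JetData,
    F D = (∑ k ∈ Lam1 3, D.uP k.1 k.2 * cu k) + (∑ k ∈ Lam 1, D.fP k.1 k.2 * cp k)
      + (∑ k ∈ Lam 1, D.fM k.1 k.2 * cm k) + (∑ k ∈ Lam 3, D.g₁ k.1 k.2 * c₁ k)
      + ∑ k ∈ Lam 2, D.g₂ k.1 k.2 * c₂ k

namespace IsLin

lemma zero : IsLin fun _ => 0 :=
  ⟨fun _ => 0, fun _ => 0, fun _ => 0, fun _ => 0, fun _ => 0, fun _ => by simp⟩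

lemma add {F G : JetData → ℝ} (hF : IsLin F) (hG : IsLin G) : IsLin fun D => F D + G D := by
  obtain ⟨a, b, c, d, e, h⟩ := hF
  obtain ⟨a', b', c', d', e', h'⟩ := hG
  refine ⟨fun k => a k + a' k, fun k => b k + b' k, fun k => c k + c' k, fun k => d k + d' k,
    fun k => e k + e' k, fun D => ?_⟩
  simp only [mul_add, Finset.sum_add_distrib, h, h']; ring

lemma mul_const {F : JetData → ℝ} (hF : IsLin F) (x : ℝ) : IsLin fun D => F D * x := by
  obtain ⟨a, b, c, d, e, h⟩ := hF
  refine ⟨fun k => a k * x, fun k => b k * x, fun k => c k * x, fun k => d k * x,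
    fun k => e k * x, fun D => ?_⟩
  simp only [← mul_assoc, ← Finset.sum_mul, h]; ring

lemma const_mul {F : JetData → ℝ} (hF : IsLin F) (x : ℝ) : IsLin fun D => x * F D := by
  simpa only [mul_comm x] using hF.mul_const x

lemma sub {F G : JetData → ℝ} (hF : IsLin F) (hG : IsLin G) : IsLin fun D => F D - G D := by
  simpa [sub_eq_add_neg] using hF.add (hG.mul_const (-1))

lemma sum {ι : Type*} (s : Finset ι) {F : ι → JetData → ℝ} (h : ∀ i ∈ s, IsLin (F i)) :
    IsLin fun D => ∑ i ∈ s, F i D := by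
  classical
  induction s using Finset.induction_on with
  | empty => simpa using zero
  | insert a s ha ih =>
    simp only [Finset.sum_insert ha]
    exact (h a (by simp)).add (ih fun i hi => h i (by simp [hi]))

lemma uP {k : ℕ × ℕ} (hk : k ∈ Lam1 3) : IsLin fun D => D.uP k.1 k.2 :=
  ⟨fun q => if q = k then 1 else 0, fun _ => 0, fun _ => 0, fun _ => 0, fun _ => 0,
    fun D => by simp [hk]⟩

lemma fP {k : ℕ × ℕ} (hk : k ∈ Lam 1) : IsLin fun D => D.fP k.1 k.2 :=
  ⟨fun _ => 0, fun q => if q = k then 1 else 0, fun _ => 0, fun _ => 0, fun _ => 0,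
    fun D => by simp [hk]⟩

lemma fM {k : ℕ × ℕ} (hk : k ∈ Lam 1) : IsLin fun D => D.fM k.1 k.2 :=
  ⟨fun _ => 0, fun _ => 0, fun q => if q = k then 1 else 0, fun _ => 0, fun _ => 0,
    fun D => by simp [hk]⟩

lemma g₁ {k : ℕ × ℕ} (hk : k ∈ Lam 3) : IsLin fun D => D.g₁ k.1 k.2 :=
  ⟨fun _ => 0, fun _ => 0, fun _ => 0, fun q => if q = k then 1 else 0, fun _ => 0,
    fun D => by simp [hk]⟩

lemma g₂ {k : ℕ × ℕ} (hk : k ∈ Lam 2) : IsLin fun D => D.g₂ k.1 k.2 :=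
  ⟨fun _ => 0, fun _ => 0, fun _ => 0, fun _ => 0, fun q => if q = k then 1 else 0,
    fun D => by simp [hk]⟩

lemma sum_unitJet_mul {s : Finset (ℕ × ℕ)} {k : ℕ × ℕ} (hk : k ∈ s) (c : ℕ × ℕ → ℝ) :
    ∑ q ∈ s, unitJet k.1 k.2 q.1 q.2 * c q = c k := by
  rw [Finset.sum_eq_single k]
  · simp [unitJet]
  · intro q _ hq
    have : ¬(q.1 = k.1 ∧ q.2 = k.2) := fun h => hq (Prod.ext h.1 h.2)
    simp [unitJet, this]
  · exact fun h => absurd hk h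

/-- The coefficients of a linear form are its values on unit jets. For `minusJet` these are the
transmission coefficients by definition, so this is the expansion of the jet of `u_-` in terms of
the data. -/
theorem expand {F : JetData → ℝ} (hF : IsLin F) (D : JetData) :
    F D = (∑ k ∈ Lam1 3, D.uP k.1 k.2 * F { JetData.zero with uP := unitJet k.1 k.2 })
      + (∑ k ∈ Lam 1, D.fP k.1 k.2 * F { JetData.zero with fP := unitJet k.1 k.2 })
      + (∑ k ∈ Lam 1, D.fM k.1 k.2 * F { JetData.zero with fM := unitJet k.1 k.2 })
      + (∑ k ∈ Lam 3, D.g₁ k.1 k.2 * F { JetData.zero with g₁ := unitJet k.1 k.2 })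
      + ∑ k ∈ Lam 2, D.g₂ k.1 k.2 * F { JetData.zero with g₂ := unitJet k.1 k.2 } := by
  obtain ⟨a, b, c, d, e, h⟩ := hF
  have h1 : ∀ k ∈ Lam1 3, F { JetData.zero with uP := unitJet k.1 k.2 } = a k := fun k hk => by
    rw [h]; simp [JetData.zero, sum_unitJet_mul hk]
  have h2 : ∀ k ∈ Lam 1, F { JetData.zero with fP := unitJet k.1 k.2 } = b k := fun k hk => by
    rw [h]; simp [JetData.zero, sum_unitJet_mul hk]
  have h3 : ∀ k ∈ Lam 1, F { JetData.zero with fM := unitJet k.1 k.2 } = c k := fun k hk => by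
    rw [h]; simp [JetData.zero, sum_unitJet_mul hk]
  have h4 : ∀ k ∈ Lam 3, F { JetData.zero with g₁ := unitJet k.1 k.2 } = d k := fun k hk => by
    rw [h]; simp [JetData.zero, sum_unitJet_mul hk]
  have h5 : ∀ k ∈ Lam 2, F { JetData.zero with g₂ := unitJet k.1 k.2 } = e k := fun k hk => by
    rw [h]; simp [JetData.zero, sum_unitJet_mul hk]
  rw [h D]
  congr 1
  · congr 1
    · congr 1
      · congr 1
        · exact Finset.sum_congr rfl fun k hk => by rw [h1 k hk]
        · exact Finset.sum_congr rfl fun k hk => by rw [h2 k hk]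
      · exact Finset.sum_congr rfl fun k hk => by rw [h3 k hk]
    · exact Finset.sum_congr rfl fun k hk => by rw [h4 k hk]
  · exact Finset.sum_congr rfl fun k hk => by rw [h5 k hk]

end IsLin

lemma Lam1_mono {p q : ℕ} (h : p ≤ q) : Lam1 p ⊆ Lam1 q := fun k hk => by
  rw [mem_Lam1] at hk ⊢; omega

namespace LocalGeometry

variable (L : LocalGeometry)

lemma isLin_dataF (p : ℕ) : IsLin fun D => L.dataF D p :=
  (IsLin.sum _ fun _ hq => ((IsLin.fM hq).mul_const _).sub ((IsLin.fP hq).mul_const _)).add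
    (IsLin.sum _ fun _ hq => (IsLin.g₁ hq).mul_const _)

lemma isLin_dataG (p : ℕ) : IsLin fun D => L.dataG D p :=
  (IsLin.sum _ fun _ hq => ((IsLin.fM hq).mul_const _).sub ((IsLin.fP hq).mul_const _)).add
    (IsLin.sum _ fun _ hq => (IsLin.g₂ hq).mul_const _)

lemma isLin_rhsU {w : JetData → ℕ → ℕ → ℝ} (hw : ∀ m n, IsLin fun D => w D m n) {p : ℕ}
    (hp : p ≤ 3) : IsLin fun D => L.rhsU D (w D) p :=
  ((IsLin.sum _ fun _ hq => (IsLin.uP (Lam1_mono hp hq)).mul_const _).sub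
    (IsLin.sum _ fun _ _ => (hw _ _).mul_const _)).sub (L.isLin_dataF p)

lemma isLin_rhsFlux {w : JetData → ℕ → ℕ → ℝ} (hw : ∀ m n, IsLin fun D => w D m n) {p : ℕ}
    (hp : p ≤ 3) : IsLin fun D => L.rhsFlux D (w D) p :=
  ((IsLin.sum _ fun _ hq => (IsLin.uP (Lam1_mono hp hq)).mul_const _).sub
    (IsLin.sum _ fun _ _ => (hw _ _).mul_const _)).sub (L.isLin_dataG (p - 1))

/-- Each order is linear in the data and in the lower orders. Division by `det` is multiplication by
a constant, so no nondegeneracy is needed. -/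
theorem isLin_minusJet {p : ℕ} (hp : p ≤ 3) (m n : ℕ) : IsLin fun D => L.minusJet D p m n := by
  induction p generalizing m n with
  | zero =>
    simp only [minusJet]
    split_ifs
    · exact (IsLin.uP (k := (0, 0)) (by decide)).sub (IsLin.g₁ (k := (0, 0)) (by decide))
    · exact IsLin.zero
  | succ p ih =>
    have hw := fun m n => ih (by omega) m n
    simp only [minusJet]
    split_ifs
    · simpa only [div_eq_mul_inv] using (((L.isLin_rhsU hw hp).const_mul _).sub
        ((L.isLin_rhsFlux hw hp).const_mul _)).mul_const _
    · simpa only [div_eq_mul_inv] using (((L.isLin_rhsFlux hw hp).const_mul _).sub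
        ((L.isLin_rhsU hw hp).const_mul _)).mul_const _
    · exact hw m n

end LocalGeometry

/-! ### Bounded families -/

section Bounded

variable {ι : Type*}

/-- The family `x` is bounded on `T`. -/
def BddOn (T : Set ι) (x : ι → ℝ) : Prop := ∃ M, ∀ i ∈ T, |x i| ≤ M

namespace BddOn

variable {T : Set ι} {x y : ι → ℝ}

lemma const (c : ℝ) : BddOn T fun _ => c := ⟨|c|, fun _ _ => le_rfl⟩

lemma add (hx : BddOn T x) (hy : BddOn T y) : BddOn T fun i => x i + y i := by
  obtain ⟨M, hM⟩ := hx
  obtain ⟨M', hM'⟩ := hy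
  exact ⟨M + M', fun i hi => (abs_add_le _ _).trans (add_le_add (hM i hi) (hM' i hi))⟩

lemma neg (hx : BddOn T x) : BddOn T fun i => -x i := by simpa [BddOn] using hx

lemma sub (hx : BddOn T x) (hy : BddOn T y) : BddOn T fun i => x i - y i := by
  simpa only [sub_eq_add_neg] using hx.add hy.neg

lemma mul (hx : BddOn T x) (hy : BddOn T y) : BddOn T fun i => x i * y i := by
  obtain ⟨M, hM⟩ := hx
  obtain ⟨M', hM'⟩ := hy
  refine ⟨M * M', fun i hi => ?_⟩
  rw [abs_mul]
  exact mul_le_mul (hM i hi) (hM' i hi) (abs_nonneg _) ((abs_nonneg _).trans (hM i hi))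

lemma pow (hx : BddOn T x) (n : ℕ) : BddOn T fun i => x i ^ n := by
  induction n with
  | zero => simpa using const 1
  | succ n ih => simpa only [pow_succ] using ih.mul hx

lemma sum {κ : Type*} (s : Finset κ) {x : κ → ι → ℝ} (h : ∀ k ∈ s, BddOn T (x k)) :
    BddOn T fun i => ∑ k ∈ s, x k i := by
  classical
  induction s using Finset.induction_on with
  | empty => simpa using const 0
  | insert a s ha ih =>
    simp only [Finset.sum_insert ha]
    exact (h a (by simp)).add (ih fun i hi => h i (by simp [hi]))

lemma congr (hx : BddOn T x) (h : ∀ i ∈ T, y i = x i) : BddOn T y := by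
  obtain ⟨M, hM⟩ := hx
  exact ⟨M, fun i hi => by rw [h i hi]; exact hM i hi⟩

end BddOn

/-- The coefficients of order at most `d` of the power series `F i`, `i ∈ T`, are bounded. -/
def BddSer (T : Set ι) (d : ℕ) (F : ι → PowerSeries ℝ) : Prop :=
  ∀ n ≤ d, BddOn T fun i => PowerSeries.coeff n (F i)

namespace BddSer

variable {T : Set ι} {d : ℕ} {F G : ι → PowerSeries ℝ}

lemma of_le (hF : BddSer T d F) {d' : ℕ} (h : d' ≤ d) : BddSer T d' F :=
  fun n hn => hF n (hn.trans h)

lemma C {x : ι → ℝ} (hx : BddOn T x) : BddSer T d fun i => PowerSeries.C (x i) := by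
  intro n _
  simp only [PowerSeries.coeff_C]
  split_ifs
  · exact hx
  · exact BddOn.const 0

lemma sub (hF : BddSer T d F) (hG : BddSer T d G) : BddSer T d fun i => F i - G i :=
  fun n hn => by simpa only [map_sub] using (hF n hn).sub (hG n hn)

lemma mul (hF : BddSer T d F) (hG : BddSer T d G) : BddSer T d fun i => F i * G i := by
  intro n hn
  simp only [PowerSeries.coeff_mul]
  refine BddOn.sum _ fun k hk => ?_
  have := Finset.HasAntidiagonal.mem_antidiagonal.1 hk
  exact (hF k.1 (by omega)).mul (hG k.2 (by omega))

lemma pow (hF : BddSer T d F) (n : ℕ) : BddSer T d fun i => F i ^ n := by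
  induction n with
  | zero => simpa using C (T := T) (d := d) (BddOn.const 1)
  | succ n ih => simpa only [pow_succ] using ih.mul hF

lemma sum {κ : Type*} (s : Finset κ) {F : κ → ι → PowerSeries ℝ}
    (h : ∀ k ∈ s, BddSer T d (F k)) : BddSer T d fun i => ∑ k ∈ s, F k i := fun n hn => by
  simpa only [map_sum] using BddOn.sum s fun k hk => h k hk n hn

end BddSer

/-- Bounds on a family of local geometries. -/
structure GeomBdd (T : Set ι) (L : ι → LocalGeometry) : Prop where
  smooth : ∀ i ∈ T, (L i).Smooth
  r : BddSer T 3 fun i => ser (L i).r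
  s : BddSer T 3 fun i => ser (L i).s
  αP : ∀ q ∈ Lam 2, BddOn T fun i => (L i).αP q.1 q.2
  αM : ∀ q ∈ Lam 2, BddOn T fun i => (L i).αM q.1 q.2
  αP_inv : BddOn T fun i => ((L i).αP 0 0)⁻¹
  αM_inv : BddOn T fun i => ((L i).αM 0 0)⁻¹
  speed_inv : BddOn T fun i => (deriv (L i).r 0 ^ 2 + deriv (L i).s 0 ^ 2)⁻¹

variable {T : Set ι}

/-! ### Uniform bounds for the reduction and transmission coefficients -/

lemma bddOn_Au {α : ι → ℕ → ℕ → ℝ} (hα : ∀ q ∈ Lam 2, BddOn T fun i => α i q.1 q.2)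
    (hα0 : BddOn T fun i => (α i 0 0)⁻¹) (m' n' m n : ℕ) :
    BddOn T fun i => Au (α i) m' n' m n := by
  have h10 := hα (1, 0) (by decide)
  have h01 := hα (0, 1) (by decide)
  have h11 := hα (1, 1) (by decide)
  have h20 := hα (2, 0) (by decide)
  have h02 := hα (0, 2) (by decide)
  have c := fun i j => BddOn.const (T := T) (unitJet m n i j)
  have u20' : BddOn T fun i => u20 (α i) (unitJet m n) fun _ _ => 0 := by
    simp only [u20, div_eq_mul_inv]
    exact (((((h10.mul (c _ _)).add (h01.mul (c _ _))).neg).mul hα0).sub (c _ _)).sub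
      ((BddOn.const 0).mul hα0)
  have u21' : BddOn T fun i => u21 (α i) (unitJet m n) fun _ _ => 0 := by
    simp only [u21, div_eq_mul_inv]
    exact ((((((((h01.mul u20').add (((BddOn.const 2).mul h01).mul (c _ _))).add
      (h11.mul (c _ _))).add (h10.mul (c _ _))).add (h02.mul (c _ _))).neg).mul hα0).sub
      (c _ _)).sub ((BddOn.const 0).mul hα0)
  have u30' : BddOn T fun i => u30 (α i) (unitJet m n) fun _ _ => 0 := by
    simp only [u30, div_eq_mul_inv]
    exact (((((((((BddOn.const 2).mul h10).mul u20').add (h10.mul (c _ _))).add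
      (h20.mul (c _ _))).add (h11.mul (c _ _))).add (h01.mul (c _ _))).neg.mul hα0).sub
      (c _ _)).sub ((BddOn.const 0).mul hα0)
  simp only [Au, reduced]
  split_ifs
  · exact u20'
  · exact u21'
  · exact u30'
  · exact c _ _

namespace GeomBdd

variable {L : ι → LocalGeometry}

lemma serMono (hL : GeomBdd T L) (m n : ℕ) : BddSer T 3 fun i => (L i).serMono m n :=
  (BddSer.C (BddOn.const _)).mul ((hL.r.pow m).mul (hL.s.pow n))

lemma serPoly (hL : GeomBdd T L) (N : ℕ) {J : ι → ℕ → ℕ → ℝ}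
    (hJ : ∀ q ∈ Lam N, BddOn T fun i => J i q.1 q.2) :
    BddSer T 3 fun i => (L i).serPoly N (J i) :=
  BddSer.sum _ fun q hq => (BddSer.C (hJ q hq)).mul (hL.serMono q.1 q.2)

lemma ser_deriv {f : ι → ℝ → ℝ} (hf : BddSer T 3 fun i => ser (f i)) :
    BddSer T 2 fun i => ser (deriv (f i)) := fun n hn => by
  simpa only [coeff_ser_deriv] using (BddOn.const _).mul (hf (n + 1) (by omega))

lemma along_G (hL : GeomBdd T L) {α : ι → ℕ → ℕ → ℝ}
    (hα : ∀ q ∈ Lam 2, BddOn T fun i => α i q.1 q.2) (hα0 : BddOn T fun i => (α i 0 0)⁻¹)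
    {k : ℕ × ℕ} (hk : k ∈ Lam1 3) {p : ℕ} (hp : p ≤ 3) :
    BddOn T fun i => (L i).along (G (α i) k.1 k.2) p := by
  refine ((hL.serPoly 3 (J := fun i m n => Au (α i) m n k.1 k.2)
    fun q _ => bddOn_Au hα hα0 _ _ _ _) p hp).congr fun i hi => ?_
  rw [G_eq _ hk, (hL.smooth i hi).along_taylorPoly]

lemma fluxAlong_G (hL : GeomBdd T L) {α : ι → ℕ → ℕ → ℝ}
    (hα : ∀ q ∈ Lam 2, BddOn T fun i => α i q.1 q.2) (hα0 : BddOn T fun i => (α i 0 0)⁻¹)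
    {k : ℕ × ℕ} (hk : k ∈ Lam1 3) {p : ℕ} (hp : p ≤ 2) :
    BddOn T fun i => (L i).fluxAlong (α i) (G (α i) k.1 k.2) p := by
  have hX := (hL.serPoly 2 (J := fun i m n => Au (α i) (m + 1) n k.1 k.2)
    fun q _ => bddOn_Au hα hα0 _ _ _ _).of_le (show 2 ≤ 3 by norm_num)
  have hY := (hL.serPoly 2 (J := fun i m n => Au (α i) m (n + 1) k.1 k.2)
    fun q _ => bddOn_Au hα hα0 _ _ _ _).of_le (show 2 ≤ 3 by norm_num)
  refine ((((hL.serPoly 2 hα).of_le (show 2 ≤ 3 by norm_num)).mul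
    ((hX.mul (ser_deriv hL.s)).sub (hY.mul (ser_deriv hL.r)))) p hp).congr fun i hi => ?_
  rw [G_eq _ hk, (hL.smooth i hi).fluxAlong_taylorPoly]

/-- The closed form of the determinant turns the bounds on `1/a_-` and on the inverse squared speed
into a bound on `1/det`. -/
lemma det_inv (hL : GeomBdd T L) {p : ℕ} (h1 : 1 ≤ p) (h3 : p ≤ 3) :
    BddOn T fun i => ((L i).det p)⁻¹ := by
  refine ((hL.αM_inv.mul (hL.speed_inv.pow p)).mul (BddOn.const
    ((Nat.factorial p : ℝ) * (Nat.factorial (p - 1) : ℝ)))).congr fun i hi => ?_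
  rw [(hL.smooth i hi).det_eq h1 h3, inv_div, inv_pow]
  rw [div_eq_mul_inv, mul_inv]; ring

/-- Only the response to `u_+` has to be bounded: it is the only one that enters the residuals `I`,
and the others cancel in the error identity. -/
theorem minusJet (hL : GeomBdd T L) (x : ℕ → ℕ → ℝ) {p : ℕ} (hp : p ≤ 3) (m n : ℕ) :
    BddOn T fun i => (L i).minusJet { JetData.zero with uP := x } p m n := by
  induction p generalizing m n with
  | zero =>
    simp only [LocalGeometry.minusJet]
    split_ifs <;> exact BddOn.const _
  | succ p ih =>
    have hw := fun m n => ih (by omega) m n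
    have k0 : ((0, p + 1) : ℕ × ℕ) ∈ Lam1 3 := mem_Lam1.2 ⟨by dsimp only; omega, by simp⟩
    have k1 : ((1, p) : ℕ × ℕ) ∈ Lam1 3 := mem_Lam1.2 ⟨by dsimp only; omega, by simp⟩
    have hU : BddOn T fun i => (L i).rhsU { JetData.zero with uP := x }
        ((L i).minusJet { JetData.zero with uP := x } p) (p + 1) := by
      refine ((BddOn.sum (Lam1 (p + 1)) fun k hk => (BddOn.const (x k.1 k.2)).mul
        (hL.along_G hL.αP hL.αP_inv (Lam1_mono hp hk) hp)).sub
        (BddOn.sum (Lam1 p) fun k hk => (hw k.1 k.2).mul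
          (hL.along_G hL.αM hL.αM_inv (Lam1_mono (by omega) hk) hp))).congr fun i _ => ?_
      simp [LocalGeometry.rhsU, LocalGeometry.dataF, JetData.zero]
    have hF : BddOn T fun i => (L i).rhsFlux { JetData.zero with uP := x }
        ((L i).minusJet { JetData.zero with uP := x } p) (p + 1) := by
      refine ((BddOn.sum (Lam1 (p + 1)) fun k hk => (BddOn.const (x k.1 k.2)).mul
        (hL.fluxAlong_G hL.αP hL.αP_inv (Lam1_mono hp hk) (p := p) (by omega))).sub
        (BddOn.sum (Lam1 p) fun k hk => (hw k.1 k.2).mul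
          (hL.fluxAlong_G hL.αM hL.αM_inv (Lam1_mono (by omega) hk) (p := p) (by omega)))).congr
          fun i _ => ?_
      simp [LocalGeometry.rhsFlux, LocalGeometry.dataG, JetData.zero]
    have hd := hL.det_inv (p := p + 1) (by omega) hp
    have a0 := hL.along_G hL.αM hL.αM_inv k0 hp
    have a1 := hL.along_G hL.αM hL.αM_inv k1 hp
    have f0 := hL.fluxAlong_G hL.αM hL.αM_inv k0 (p := p) (by omega)
    have f1 := hL.fluxAlong_G hL.αM hL.αM_inv k1 (p := p) (by omega)
    simp only [LocalGeometry.minusJet]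
    split_ifs
    · simp only [div_eq_mul_inv]
      exact ((f1.mul hU).sub (a1.mul hF)).mul hd
    · simp only [div_eq_mul_inv]
      exact ((a0.mul hF).sub (f0.mul hU)).mul hd
    · exact hw m n

end GeomBdd

/-! ### Families of polynomials -/

lemma coeffAt_polynomial (p : Polynomial ℝ) (k : ℕ) :
    coeffAt (fun τ => p.eval τ) k = p.coeff k := by
  have h : ∀ k, iteratedDeriv k (fun τ => p.eval τ)
      = fun τ => (Polynomial.derivative^[k] p).eval τ := by
    intro k
    induction k with
    | zero => simp
    | succ k ih =>
      rw [iteratedDeriv_succ, ih, Function.iterate_succ_apply']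
      funext τ
      simp
  rw [coeffAt, h]
  dsimp only
  rw [← Polynomial.coeff_zero_eq_eval_zero, Polynomial.coeff_iterate_derivative]
  have : (Nat.factorial k : ℝ) ≠ 0 := by positivity
  simp [Nat.descFactorial_self, this]

/-- On `T`, the functions `F i` are polynomials, majorized by a common polynomial. -/
def PolyFam (T : Set ι) (F : ι → ℝ → ℝ) : Prop :=
  ∃ Q : Polynomial ℝ, ∀ i ∈ T, ∃ p : Polynomial ℝ,
    (∀ n, |p.coeff n| ≤ Q.coeff n) ∧ ∀ τ, F i τ = p.eval τ

namespace PolyFam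

variable {F G : ι → ℝ → ℝ}

lemma of_bddOn {x : ι → ℝ} (hx : BddOn T x) : PolyFam T fun i _ => x i := by
  obtain ⟨M, hM⟩ := hx
  refine ⟨Polynomial.C M, fun i hi => ⟨Polynomial.C (x i), fun n => ?_, fun τ => by simp⟩⟩
  simp only [Polynomial.coeff_C]
  split_ifs
  · exact hM i hi
  · simp

lemma const (c : ℝ) : PolyFam T fun _ _ => c := of_bddOn (BddOn.const c)

lemma var : PolyFam T fun _ τ => τ :=
  ⟨Polynomial.X, fun _ _ => ⟨Polynomial.X, fun n => by
    simp only [Polynomial.coeff_X]; split_ifs <;> simp, fun τ => by simp⟩⟩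

lemma add (hF : PolyFam T F) (hG : PolyFam T G) : PolyFam T fun i τ => F i τ + G i τ := by
  obtain ⟨Q, hQ⟩ := hF
  obtain ⟨Q', hQ'⟩ := hG
  refine ⟨Q + Q', fun i hi => ?_⟩
  obtain ⟨p, h1, h2⟩ := hQ i hi
  obtain ⟨p', h1', h2'⟩ := hQ' i hi
  refine ⟨p + p', fun n => ?_, fun τ => by simp [h2, h2']⟩
  rw [Polynomial.coeff_add, Polynomial.coeff_add]
  exact (abs_add_le _ _).trans (add_le_add (h1 n) (h1' n))

lemma mul (hF : PolyFam T F) (hG : PolyFam T G) : PolyFam T fun i τ => F i τ * G i τ := by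
  obtain ⟨Q, hQ⟩ := hF
  obtain ⟨Q', hQ'⟩ := hG
  refine ⟨Q * Q', fun i hi => ?_⟩
  obtain ⟨p, h1, h2⟩ := hQ i hi
  obtain ⟨p', h1', h2'⟩ := hQ' i hi
  refine ⟨p * p', fun n => ?_, fun τ => by simp [h2, h2']⟩
  rw [Polynomial.coeff_mul, Polynomial.coeff_mul]
  refine (Finset.abs_sum_le_sum_abs _ _).trans (Finset.sum_le_sum fun k _ => ?_)
  rw [abs_mul]
  exact mul_le_mul (h1 _) (h1' _) (abs_nonneg _) ((abs_nonneg _).trans (h1 _))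

lemma sub (hF : PolyFam T F) (hG : PolyFam T G) : PolyFam T fun i τ => F i τ - G i τ := by
  simpa [sub_eq_add_neg] using hF.add ((const (-1)).mul hG)

lemma pow (hF : PolyFam T F) (n : ℕ) : PolyFam T fun i τ => F i τ ^ n := by
  induction n with
  | zero => simpa using const (T := T) 1
  | succ n ih => simpa only [pow_succ] using ih.mul hF

lemma sum {κ : Type*} (s : Finset κ) {F : κ → ι → ℝ → ℝ} (h : ∀ k ∈ s, PolyFam T (F k)) :
    PolyFam T fun i τ => ∑ k ∈ s, F k i τ := by
  classical
  induction s using Finset.induction_on with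
  | empty => simpa using const (T := T) 0
  | insert a s ha ih =>
    simp only [Finset.sum_insert ha]
    exact (h a (by simp)).add (ih fun i hi => h i (by simp [hi]))

lemma congr (hF : PolyFam T F) (h : ∀ i ∈ T, ∀ τ, G i τ = F i τ) : PolyFam T G := by
  obtain ⟨Q, hQ⟩ := hF
  refine ⟨Q, fun i hi => ?_⟩
  obtain ⟨p, h1, h2⟩ := hQ i hi
  exact ⟨p, h1, fun τ => by rw [h i hi, h2]⟩

/-- A sum over subsets of a fixed finite set. -/
lemma sum_subset {κ : Type*} (s : Finset κ) {d : ι → Finset κ} (hd : ∀ i ∈ T, d i ⊆ s)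
    {F : κ → ι → ℝ → ℝ} (h : ∀ k ∈ s, PolyFam T (F k)) :
    PolyFam T fun i τ => ∑ k ∈ d i, F k i τ := by
  classical
  -- The index set varies with `i`; inserting the indicator of membership, a bounded family, makes
  -- it constant.
  have hb : ∀ k, BddOn T fun i => if k ∈ d i then (1 : ℝ) else 0 := fun k =>
    ⟨1, fun i _ => by dsimp only; split_ifs <;> simp⟩
  refine (sum s fun k hk => (of_bddOn (hb k)).mul (h k hk)).congr fun i hi τ => ?_
  rw [← Finset.sum_subset (hd i hi)]
  · exact Finset.sum_congr rfl fun k hk => by simp [hk]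
  · intro k _ hk; simp [hk]

/-- If each member of the family is `O(τ^N)`, it is so uniformly. -/
theorem bound (hF : PolyFam T F) (N : ℕ)
    (hO : ∀ i ∈ T, F i =O[𝓝[>] 0] fun τ : ℝ => τ ^ (N + 1)) :
    ∃ A, 0 ≤ A ∧ ∀ i ∈ T, ∀ τ, 0 < τ → τ ≤ 1 → |F i τ| ≤ A * τ ^ (N + 1) := by
  obtain ⟨Q, hQ⟩ := hF
  refine ⟨∑ n ∈ Finset.range (Q.natDegree + 1), |Q.coeff n|,
    Finset.sum_nonneg fun _ _ => abs_nonneg _, fun i hi τ h0 h1 => ?_⟩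
  obtain ⟨p, hp, hFp⟩ := hQ i hi
  -- The hypothesis has no uniform constant, but for a polynomial it says that the coefficients of
  -- degree at most `N` vanish. The others are majorized by those of `Q`, and their powers by `τ ^
  -- (N + 1)` since `τ ≤ 1`.
  have hzero : ∀ k ≤ N, p.coeff k = 0 := by
    have hO' : (fun τ => p.eval τ) =O[𝓝[>] 0] fun τ : ℝ => τ ^ (N + 1) :=
      (hO i hi).congr_left hFp
    intro k hk
    rw [← coeffAt_polynomial]
    exact coeffAt_eq_zero (f := fun τ => p.eval τ)
      (Polynomial.contDiff_aeval p ∞).contDiffAt hO' k hk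
  -- Beyond the degree of `Q` the majorant is zero, so the degrees are bounded as well.
  have hdeg : p.natDegree < Q.natDegree + 1 := by
    refine Nat.lt_succ_iff.2 (Polynomial.natDegree_le_iff_coeff_eq_zero.2 fun n hn => ?_)
    have := hp n
    rw [Polynomial.coeff_eq_zero_of_natDegree_lt hn] at this
    exact abs_nonpos_iff.1 this
  rw [hFp, Polynomial.eval_eq_sum_range' hdeg, Finset.sum_mul]
  refine (Finset.abs_sum_le_sum_abs _ _).trans (Finset.sum_le_sum fun n _ => ?_)
  rw [abs_mul, abs_of_pos (pow_pos h0 n)]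
  by_cases hn : n ≤ N
  · rw [hzero n hn]; simp; positivity
  · exact mul_le_mul ((hp n).trans (le_abs_self _))
      (pow_le_pow_of_le_one h0.le h1 (by omega)) (by positivity) (abs_nonneg _)

end PolyFam

end Bounded

/-! ### Uniform smallness of the residuals of the system -/

/-- The splitting is controlled by the constants `B` and `M`. -/
structure Split.Bounded (S : Split) (B M : ℝ) : Prop where
  smooth : S.L.Smooth
  param : ParamBound B S.L.r S.L.s
  αP : ∀ q ∈ Lam 2, |S.L.αP q.1 q.2| ≤ M
  αM : ∀ q ∈ Lam 2, |S.L.αM q.1 q.2| ≤ M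
  αP_inv : |(S.L.αP 0 0)⁻¹| ≤ M
  αM_inv : |(S.L.αM 0 0)⁻¹| ≤ M
  v₀ : |S.v₀| ≤ 1
  w₀ : |S.w₀| ≤ 1
  dP : S.dP ⊆ stencil
  dM : S.dM ⊆ stencil

/-- The splitting, the coefficients and the direction are controlled by `B` and `M`, and the
residuals of the system vanish to the fourth order. -/
structure Controlled (B M : ℝ) (x : Split × (ℤ × ℤ → Polynomial ℝ) × (ℝ × ℝ)) : Prop where
  split : x.1.Bounded B M
  degree : ∀ kl ∈ stencil, (x.2.1 kl).natDegree < 4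
  coeff : CoeffBound B x.2.1
  fst : |x.2.2.1| ≤ 1
  snd : |x.2.2.2| ≤ 1
  system : ∀ q ∈ Lam1 3, x.1.I x.2.1 x.2.2 q.1 q.2 =O[𝓝[>] 0] (fun τ : ℝ => τ ^ 4)

variable {B M : ℝ}

lemma abs_coeffAt_le {f : ℝ → ℝ} {n : ℕ} (h : |iteratedDeriv n f 0| ≤ B) : |coeffAt f n| ≤ B := by
  rw [coeffAt, abs_div, Nat.abs_cast]
  exact (div_le_self (abs_nonneg _) (by exact_mod_cast Nat.factorial_pos n)).trans h

lemma geomBdd_controlled : GeomBdd {x | Controlled B M x} fun x => x.1.L where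
  smooth := fun _ hx => hx.split.smooth
  r := fun n hn => ⟨B, fun _ hx => by
    dsimp only; rw [coeff_ser]; exact abs_coeffAt_le (hx.split.param.1 n hn).1⟩
  s := fun n hn => ⟨B, fun _ hx => by
    dsimp only; rw [coeff_ser]; exact abs_coeffAt_le (hx.split.param.1 n hn).2⟩
  αP := fun q hq => ⟨M, fun _ hx => hx.split.αP q hq⟩
  αM := fun q hq => ⟨M, fun _ hx => hx.split.αM q hq⟩
  αP_inv := ⟨M, fun _ hx => hx.split.αP_inv⟩
  αM_inv := ⟨M, fun _ hx => hx.split.αM_inv⟩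
  speed_inv := ⟨B, fun x hx => by
    have h := hx.split.param.2
    have h0 : 0 ≤ deriv x.1.L.r 0 ^ 2 + deriv x.1.L.s 0 ^ 2 := by positivity
    rcases h0.eq_or_lt with h1 | h1
    · rw [← h1] at h; linarith
    · rw [abs_of_pos (inv_pos.2 h1), inv_le_iff_one_le_mul₀ h1]
      exact h⟩

lemma polyFam_eval {kl : ℤ × ℤ} (hkl : kl ∈ stencil) :
    PolyFam {x | Controlled B M x} fun x τ => (x.2.1 kl).eval τ := by
  refine (PolyFam.sum (Finset.range 4) (F := fun n x τ => (x.2.1 kl).coeff n * τ ^ n)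
    fun n _ => (PolyFam.of_bddOn ⟨B, fun x hx => hx.coeff kl hkl n⟩).mul
      (PolyFam.var.pow n)).congr fun x hx τ => ?_
  exact Polynomial.eval_eq_sum_range' (hx.degree kl hkl) τ

section

variable {ι : Type*} {T : Set ι}

lemma PolyFam.mono {X Y : ι → ℝ → ℝ} (hX : PolyFam T X) (hY : PolyFam T Y) (m n : ℕ) :
    PolyFam T fun i τ => EllipticInterface.mono m n (X i τ, Y i τ) := by
  simp only [EllipticInterface.mono, div_eq_mul_inv]
  exact ((hX.pow m).mul (hY.pow n)).mul (PolyFam.const _)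

lemma PolyFam.taylorPoly {X Y : ι → ℝ → ℝ} (hX : PolyFam T X) (hY : PolyFam T Y) (N : ℕ)
    {J : ι → ℕ → ℕ → ℝ} (hJ : ∀ q ∈ Lam N, BddOn T fun i => J i q.1 q.2) :
    PolyFam T fun i τ => EllipticInterface.taylorPoly N (J i) (X i τ, Y i τ) :=
  PolyFam.sum _ fun q hq => (PolyFam.of_bddOn (hJ q hq)).mul (hX.mono hY q.1 q.2)

end

lemma polyFam_rel (kl : ℤ × ℤ) :
    (PolyFam {x | Controlled B M x} fun x τ => x.1.v₀ * τ + kl.1 * τ) ∧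
      PolyFam {x | Controlled B M x} fun x τ => x.1.w₀ * τ + kl.2 * τ :=
  ⟨((PolyFam.of_bddOn ⟨1, fun _ hx => hx.split.v₀⟩).mul PolyFam.var).add
      ((PolyFam.const _).mul PolyFam.var),
    ((PolyFam.of_bddOn ⟨1, fun _ hx => hx.split.w₀⟩).mul PolyFam.var).add
      ((PolyFam.const _).mul PolyFam.var)⟩

lemma polyFam_IP {k : ℕ × ℕ} (hk : k ∈ Lam1 3) :
    PolyFam {x | Controlled B M x} fun x τ => x.1.IP x.2.1 k.1 k.2 τ := by
  have hL := geomBdd_controlled (B := B) (M := M)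
  refine PolyFam.sum_subset stencil (fun x hx => hx.split.dP) fun kl hkl => ?_
  rw [show (fun x : Split × (ℤ × ℤ → Polynomial ℝ) × (ℝ × ℝ) => fun τ =>
      (x.2.1 kl).eval τ * G x.1.L.αP k.1 k.2 (x.1.rel τ kl)) = fun x τ => (x.2.1 kl).eval τ *
      taylorPoly 3 (fun i j => Au x.1.L.αP i j k.1 k.2)
        (x.1.v₀ * τ + kl.1 * τ, x.1.w₀ * τ + kl.2 * τ) by simp only [G_eq _ hk, Split.rel]]
  exact (polyFam_eval hkl).mul ((polyFam_rel kl).1.taylorPoly (polyFam_rel kl).2 3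
    fun q _ => bddOn_Au hL.αP hL.αP_inv _ _ _ _)

lemma polyFam_IM {k : ℕ × ℕ} (hk : k ∈ Lam1 3) :
    PolyFam {x | Controlled B M x} fun x τ => x.1.IM x.2.1 k.1 k.2 τ := by
  have hL := geomBdd_controlled (B := B) (M := M)
  refine PolyFam.sum_subset stencil (fun x hx => hx.split.dM) fun kl hkl => ?_
  rw [show (fun x : Split × (ℤ × ℤ → Polynomial ℝ) × (ℝ × ℝ) => fun τ =>
      (x.2.1 kl).eval τ * G x.1.L.αM k.1 k.2 (x.1.rel τ kl)) = fun x τ => (x.2.1 kl).eval τ *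
      taylorPoly 3 (fun i j => Au x.1.L.αM i j k.1 k.2)
        (x.1.v₀ * τ + kl.1 * τ, x.1.w₀ * τ + kl.2 * τ) by simp only [G_eq _ hk, Split.rel]]
  exact (polyFam_eval hkl).mul ((polyFam_rel kl).1.taylorPoly (polyFam_rel kl).2 3
    fun q _ => bddOn_Au hL.αM hL.αM_inv _ _ _ _)

lemma polyFam_directional {k : ℕ × ℕ} (hk : k ∈ Lam1 3) :
    PolyFam {x | Controlled B M x} fun x τ => x.1.directional x.2.2 (G x.1.L.αP k.1 k.2) τ := by
  have hL := geomBdd_controlled (B := B) (M := M)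
  have hv : PolyFam {x | Controlled B M x} fun x τ => x.1.v₀ * τ :=
    (PolyFam.of_bddOn ⟨1, fun _ hx => hx.split.v₀⟩).mul PolyFam.var
  have hw : PolyFam {x | Controlled B M x} fun x τ => x.1.w₀ * τ :=
    (PolyFam.of_bddOn ⟨1, fun _ hx => hx.split.w₀⟩).mul PolyFam.var
  have hX := hv.taylorPoly hw 2 (J := fun x i j => Au x.1.L.αP (i + 1) j k.1 k.2)
    fun q _ => bddOn_Au hL.αP hL.αP_inv _ _ _ _
  have hY := hv.taylorPoly hw 2 (J := fun x i j => Au x.1.L.αP i (j + 1) k.1 k.2)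
    fun q _ => bddOn_Au hL.αP hL.αP_inv _ _ _ _
  have h1 : PolyFam {x | Controlled B M x} fun x _ => x.2.2.1 :=
    PolyFam.of_bddOn ⟨1, fun _ hx => hx.fst⟩
  have h2 : PolyFam {x | Controlled B M x} fun x _ => x.2.2.2 :=
    PolyFam.of_bddOn ⟨1, fun _ hx => hx.snd⟩
  refine (PolyFam.var.mul ((hX.mul h1).add (hY.mul h2))).congr fun x _ τ => ?_
  rw [Split.directional, G_eq _ hk, dX_taylorPoly, dY_taylorPoly]

lemma polyFam_I {k : ℕ × ℕ} (hk : k ∈ Lam1 3) :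
    PolyFam {x | Controlled B M x} fun x τ => x.1.I x.2.1 x.2.2 k.1 k.2 τ :=
  ((polyFam_IP hk).add (PolyFam.sum _ fun q hq => (polyFam_IM hq).mul
    (PolyFam.of_bddOn (geomBdd_controlled.minusJet _ le_rfl q.1 q.2)))).sub
    (polyFam_directional hk)

/-- The residuals of the system are `O(h⁴)`, uniformly. -/
theorem exists_residual_bound (B M : ℝ) : ∃ A, 0 ≤ A ∧ ∀ x, Controlled B M x → ∀ q ∈ Lam1 3,
    ∀ τ, 0 < τ → τ ≤ 1 → |x.1.I x.2.1 x.2.2 q.1 q.2 τ| ≤ A * τ ^ 4 := by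
  have h : ∀ q ∈ Lam1 3, ∃ A, 0 ≤ A ∧ ∀ x, Controlled B M x →
      ∀ τ, 0 < τ → τ ≤ 1 → |x.1.I x.2.1 x.2.2 q.1 q.2 τ| ≤ A * τ ^ 4 := fun q hq =>
    (polyFam_I hq).bound 3 fun x hx => hx.system q hq
  choose! A hA0 hA using h
  refine ⟨∑ q ∈ Lam1 3, A q, Finset.sum_nonneg hA0, fun x hx q hq τ h0 h1 => ?_⟩
  exact (hA q hq x hx τ h0 h1).trans (mul_le_mul_of_nonneg_right
    (Finset.single_le_sum hA0 hq) (by positivity))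

/-! ### The jets of a solution satisfy the differentiated equation -/

/-- The hypotheses keep the shape that the product rule gives. The entry `(2, 0)` is solved for
first, and its value is then used in the other two equations. -/
lemma reduced_of_equations {α υ φ : ℕ → ℕ → ℝ} (hα : α 0 0 ≠ 0)
    (h00 : φ 0 0 = -(α 1 0 * υ 1 0 + α 0 0 * υ 2 0 + (α 0 1 * υ 0 1 + α 0 0 * υ 0 2)))
    (h10 : φ 1 0 = -(α 2 0 * υ 1 0 + α 1 0 * υ 2 0 + (α 1 0 * υ 2 0 + α 0 0 * υ 3 0)
      + (α 1 1 * υ 0 1 + α 0 1 * υ 1 1 + (α 1 0 * υ 0 2 + α 0 0 * υ 1 2))))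
    (h01 : φ 0 1 = -(α 1 1 * υ 1 0 + α 1 0 * υ 1 1 + (α 0 1 * υ 2 0 + α 0 0 * υ 2 1)
      + (α 0 2 * υ 0 1 + α 0 1 * υ 0 2 + (α 0 1 * υ 0 2 + α 0 0 * υ 0 3))))
    {q : ℕ × ℕ} : υ q.1 q.2 = reduced α υ φ q.1 q.2 := by
  have e20 : υ 2 0 = u20 α υ φ := by
    rw [u20, h00]; field_simp; ring
  have e21 : υ 2 1 = u21 α υ φ := by
    rw [u21, ← e20, h01]; field_simp; ring
  have e30 : υ 3 0 = u30 α υ φ := by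
    rw [u30, ← e20, h10]; field_simp; ring
  unfold reduced
  split_ifs with h1 h2 h3
  · rw [h1.1, h1.2, e20]
  · rw [h2.1, h2.2, e21]
  · rw [h3.1, h3.2, e30]
  · rfl

lemma SmoothUpTo.hasFDerivAt {Z S : Set (ℝ × ℝ)} {N : ℕ} {w : ℝ × ℝ → ℝ} (hS : IsOpen S)
    (h : SmoothUpTo Z S N w) {i j : ℕ} (hij : i + j < N) {p : ℝ × ℝ} (hp : p ∈ S) :
    HasFDerivAt (pd i j w) (gradCLM (pd (i + 1) j w p) (pd i (j + 1) w p)) p :=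
  jetFam_pd hS h.1 i j hij p hp

/-- The equation holds only in the open side, so it is differentiated there; the relations at `b`
follow by taking one-sided limits of all terms. -/
theorem sideJet_eq_reduced {Z S : Set (ℝ × ℝ)} (hS : IsOpen S) {a u f : ℝ × ℝ → ℝ}
    (ha : SmoothUpTo Z S 2 a) (hu : SmoothUpTo Z S 3 u) (hf : SmoothUpTo Z S 1 f)
    (hpde : ∀ p ∈ S, -(dX (fun q => a q * dX u q) p + dY (fun q => a q * dY u q) p) = f p)
    {b : ℝ × ℝ} (hb : b ∈ Z) (hne : (𝓝[S] b).NeBot) (hα : sideJet S a b 0 0 ≠ 0)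
    {q : ℕ × ℕ} :
    sideJet S u b q.1 q.2 = reduced (sideJet S a b) (sideJet S u b) (sideJet S f b) q.1 q.2 := by
  have A := fun (i j : ℕ) (hij : i + j < 2) (p : ℝ × ℝ) (hp : p ∈ S) => ha.hasFDerivAt hS hij hp
  have U := fun (i j : ℕ) (hij : i + j < 3) (p : ℝ × ℝ) (hp : p ∈ S) => hu.hasFDerivAt hS hij hp
  have F0 : EqOn f (fun p => -(pd 1 0 a p * pd 1 0 u p + pd 0 0 a p * pd 2 0 u p
      + (pd 0 1 a p * pd 0 1 u p + pd 0 0 a p * pd 0 2 u p))) S := by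
    intro p hp
    have h1 : HasFDerivAt (fun q => a q * dX u q) _ p :=
      (A 0 0 (by norm_num) p hp).mul (U 1 0 (by norm_num) p hp)
    have h2 : HasFDerivAt (fun q => a q * dY u q) _ p :=
      (A 0 0 (by norm_num) p hp).mul (U 0 1 (by norm_num) p hp)
    rw [← hpde p hp, HasFDerivAt.dX_eq h1, HasFDerivAt.dY_eq h2,
      show dX u p = pd 1 0 u p from rfl, show dY u p = pd 0 1 u p from rfl]
    simp; ring
  have D : ∀ p ∈ S, HasFDerivAt (fun p => -(pd 1 0 a p * pd 1 0 u p + pd 0 0 a p * pd 2 0 u p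
      + (pd 0 1 a p * pd 0 1 u p + pd 0 0 a p * pd 0 2 u p))) _ p := fun p hp =>
    ((((A 1 0 (by norm_num) p hp).mul (U 1 0 (by norm_num) p hp)).add
      ((A 0 0 (by norm_num) p hp).mul (U 2 0 (by norm_num) p hp))).add
      (((A 0 1 (by norm_num) p hp).mul (U 0 1 (by norm_num) p hp)).add
      ((A 0 0 (by norm_num) p hp).mul (U 0 2 (by norm_num) p hp)))).neg
  have F1 : EqOn (pd 1 0 f) (fun p => -(pd 2 0 a p * pd 1 0 u p + pd 1 0 a p * pd 2 0 u p
      + (pd 1 0 a p * pd 2 0 u p + pd 0 0 a p * pd 3 0 u p)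
      + (pd 1 1 a p * pd 0 1 u p + pd 0 1 a p * pd 1 1 u p
        + (pd 1 0 a p * pd 0 2 u p + pd 0 0 a p * pd 1 2 u p)))) S := by
    intro p hp
    have h : pd 1 0 f p = dX f p := rfl
    rw [h, dX_congr hS F0 hp, HasFDerivAt.dX_eq (D p hp)]
    simp; ring
  have F2 : EqOn (pd 0 1 f) (fun p => -(pd 1 1 a p * pd 1 0 u p + pd 1 0 a p * pd 1 1 u p
      + (pd 0 1 a p * pd 2 0 u p + pd 0 0 a p * pd 2 1 u p)
      + (pd 0 2 a p * pd 0 1 u p + pd 0 1 a p * pd 0 2 u p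
        + (pd 0 1 a p * pd 0 2 u p + pd 0 0 a p * pd 0 3 u p)))) S := by
    intro p hp
    have h : pd 0 1 f p = dY f p := rfl
    rw [h, dY_congr hS F0 hp, HasFDerivAt.dY_eq (D p hp)]
    simp; ring
  have tA := fun (i j : ℕ) (hij : i + j ≤ 2) => ha.tendsto hij hb
  have tU := fun (i j : ℕ) (hij : i + j ≤ 3) => hu.tendsto hij hb
  have tF := fun (i j : ℕ) (hij : i + j ≤ 1) => hf.tendsto hij hb
  have lim : ∀ {g g' : ℝ × ℝ → ℝ} {x y : ℝ}, EqOn g g' S → Tendsto g (𝓝[S] b) (𝓝 x) →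
      Tendsto g' (𝓝[S] b) (𝓝 y) → x = y := by
    intro g g' x y he hg hg'
    exact tendsto_nhds_unique (hg.congr' (he.eventuallyEq_of_mem self_mem_nhdsWithin)) hg'
  refine reduced_of_equations hα (lim F0 (tF 0 0 (by norm_num)) ?_)
    (lim F1 (tF 1 0 (by norm_num)) ?_) (lim F2 (tF 0 1 (by norm_num)) ?_)
  · exact ((((tA 1 0 (by norm_num)).mul (tU 1 0 (by norm_num))).add
      ((tA 0 0 (by norm_num)).mul (tU 2 0 (by norm_num)))).add
      (((tA 0 1 (by norm_num)).mul (tU 0 1 (by norm_num))).add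
      ((tA 0 0 (by norm_num)).mul (tU 0 2 (by norm_num))))).neg
  · exact (((((tA 2 0 (by norm_num)).mul (tU 1 0 (by norm_num))).add
      ((tA 1 0 (by norm_num)).mul (tU 2 0 (by norm_num)))).add
      (((tA 1 0 (by norm_num)).mul (tU 2 0 (by norm_num))).add
      ((tA 0 0 (by norm_num)).mul (tU 3 0 (by norm_num))))).add
      ((((tA 1 1 (by norm_num)).mul (tU 0 1 (by norm_num))).add
      ((tA 0 1 (by norm_num)).mul (tU 1 1 (by norm_num)))).add
      (((tA 1 0 (by norm_num)).mul (tU 0 2 (by norm_num))).add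
      ((tA 0 0 (by norm_num)).mul (tU 1 2 (by norm_num)))))).neg
  · exact (((((tA 1 1 (by norm_num)).mul (tU 1 0 (by norm_num))).add
      ((tA 1 0 (by norm_num)).mul (tU 1 1 (by norm_num)))).add
      (((tA 0 1 (by norm_num)).mul (tU 2 0 (by norm_num))).add
      ((tA 0 0 (by norm_num)).mul (tU 2 1 (by norm_num))))).add
      ((((tA 0 2 (by norm_num)).mul (tU 0 1 (by norm_num))).add
      ((tA 0 1 (by norm_num)).mul (tU 0 2 (by norm_num)))).add
      (((tA 0 1 (by norm_num)).mul (tU 0 2 (by norm_num))).add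
      ((tA 0 0 (by norm_num)).mul (tU 0 3 (by norm_num)))))).neg

/-! ### The two sides of the interface -/

/-- Uniform continuity sends the Cauchy filter `𝓝[S] p` to a Cauchy filter, and `ℝ` is complete; `p`
may lie outside `S`. -/
lemma exists_tendsto_of_uniformContinuousOn {S : Set (ℝ × ℝ)} {v : ℝ × ℝ → ℝ}
    (hv : UniformContinuousOn v S) {p : ℝ × ℝ} (hne : (𝓝[S] p).NeBot) :
    ∃ L, Tendsto v (𝓝[S] p) (𝓝 L) := by
  refine cauchy_map_iff_exists_tendsto.1 ?_
  have hc : Cauchy (𝓝[S] p) := cauchy_nhds.mono nhdsWithin_le_nhds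
  refine ⟨hc.1.map v, ?_⟩
  rw [prod_map_map_eq]
  have h : Tendsto (fun q : (ℝ × ℝ) × (ℝ × ℝ) => (v q.1, v q.2))
      (uniformity (ℝ × ℝ) ⊓ 𝓟 (S ×ˢ S)) (uniformity ℝ) := hv
  exact h.mono_left (le_inf hc.2 (by
    rw [← prod_principal_principal]
    exact Filter.prod_mono (le_principal_iff.2 self_mem_nhdsWithin)
      (le_principal_iff.2 self_mem_nhdsWithin)))

namespace Problem

variable {P : Problem}

/-! ### The subregions `Ω^±` and the smoothness of the data on them -/

lemma isOpen_Om : IsOpen P.Om := isOpen_Ioo.prod isOpen_Ioo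

/-- `Ω⁻` is the positive side of `-ψ`, so the one-sided results for positive sides cover both
subregions. -/
lemma OmM_eq_side : P.OmM = side P.Om (-P.ψ) := by
  ext p; simp [OmM, side]

lemma Gam_eq_zeros_neg : P.Gam = zeros P.Om (-P.ψ) := by
  ext p; simp [Gam, zeros]

/-- `S` is one of the two subregions. -/
def IsSide (P : Problem) (S : Set (ℝ × ℝ)) : Prop := S = P.OmP ∨ S = P.OmM

lemma isSide_plus : P.IsSide P.OmP := Or.inl rfl

lemma isSide_minus : P.IsSide P.OmM := Or.inr rfl

lemma Admissible.hasStrictFDerivAt (hP : P.Admissible) {b : ℝ × ℝ} (hb : b ∈ P.Om) :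
    HasStrictFDerivAt P.ψ (gradCLM (dX P.ψ b) (dY P.ψ b)) b := by
  have h := (hP.smooth_psi.contDiffAt (isOpen_Om.mem_nhds hb))
  have h1 := h.hasStrictFDerivAt (by simp)
  rwa [(hasFDerivAt_gradCLM h1.differentiableAt).fderiv] at h1

lemma Admissible.gradCLM_ne_zero (hP : P.Admissible) {b : ℝ × ℝ} (hb : b ∈ P.Gam) :
    gradCLM (dX P.ψ b) (dY P.ψ b) ≠ 0 := by
  intro h
  have h1 := congrArg (fun L : ℝ × ℝ →L[ℝ] ℝ => L (1, 0)) h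
  have h2 := congrArg (fun L : ℝ × ℝ →L[ℝ] ℝ => L (0, 1)) h
  simp only [gradCLM_apply, mul_one, mul_zero, add_zero, zero_add,
    _root_.zero_apply] at h1 h2
  exact (hP.regular_curve b hb).elim (· h1) (· h2)

lemma Admissible.isOpen_side (hP : P.Admissible) {S : Set (ℝ × ℝ)} (hS : P.IsSide S) :
    IsOpen S := by
  rcases hS with rfl | rfl
  · exact hP.smooth_psi.continuousOn.isOpen_inter_preimage isOpen_Om isOpen_Ioi
  · exact hP.smooth_psi.continuousOn.isOpen_inter_preimage isOpen_Om isOpen_Iio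

lemma IsSide.subset_Om {S : Set (ℝ × ℝ)} (hS : P.IsSide S) : S ⊆ P.Om := by
  rcases hS with rfl | rfl <;> exact fun p hp => hp.1

lemma IsSide.subset_union {S : Set (ℝ × ℝ)} (hS : P.IsSide S) : S ⊆ P.OmP ∪ P.OmM := by
  rcases hS with rfl | rfl
  · exact subset_union_left
  · exact subset_union_right

lemma Admissible.neBot (hP : P.Admissible) {S : Set (ℝ × ℝ)} (hS : P.IsSide S) {b : ℝ × ℝ}
    (hb : b ∈ P.Gam) : (𝓝[S] b).NeBot := by
  have hψ := hP.hasStrictFDerivAt hb.1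
  have h0 := hP.gradCLM_ne_zero hb
  rcases hS with rfl | rfl
  · obtain ⟨ρ, hρ, ν, h⟩ := exists_accessible (isOpen_Om.mem_nhds hb.1) hψ h0
    exact (h b hb (by simpa using hρ)).neBot hρ
  · obtain ⟨ρ, hρ, ν, h⟩ := exists_accessible (isOpen_Om.mem_nhds hb.1) hψ.neg (neg_ne_zero.2 h0)
    rw [OmM_eq_side]
    exact (h b (Gam_eq_zeros_neg ▸ hb) (by simpa using hρ)).neBot hρ

lemma Admissible.Gam_subset_closure (hP : P.Admissible) {S : Set (ℝ × ℝ)} (hS : P.IsSide S) :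
    P.Gam ⊆ closure S := fun _ hb =>
  mem_closure_iff_nhdsWithin_neBot.2 (hP.neBot hS hb)

theorem Admissible.taylor (hP : P.Admissible) {S : Set (ℝ × ℝ)} (hS : P.IsSide S) {b₀ : ℝ × ℝ}
    (hb₀ : b₀ ∈ P.Gam) {w : ℝ × ℝ → ℝ} (i j N : ℕ) (hw : SmoothUpTo P.Gam S (N + 1 + i + j) w) :
    ∃ C, 0 ≤ C ∧ ∃ ρ, 0 < ρ ∧ ∀ b ∈ P.Gam, dist b b₀ < ρ →
      ∀ p ∈ S ∪ P.Gam, dist p b < ρ →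
        |sideJet S w p i j - taylorPoly N (fun m n => sideJet S w b (i + m) (j + n)) (p - b)|
            ≤ C * dist p b ^ (N + 1) := by
  have hψ := hP.hasStrictFDerivAt hb₀.1
  have h0 := hP.gradCLM_ne_zero hb₀
  have ho := hP.isOpen_side hS
  have hΩ := isOpen_Om.mem_nhds hb₀.1
  rcases hS with rfl | rfl
  · exact SmoothUpTo.taylor ho hΩ hb₀ hψ h0 i j N hw
  · rw [Gam_eq_zeros_neg] at hb₀ hw ⊢
    rw [OmM_eq_side] at ho hw ⊢
    exact SmoothUpTo.taylor ho hΩ hb₀ hψ.neg (neg_ne_zero.2 h0) i j N hw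

lemma Admissible.smoothFive (hP : P.Admissible) {S : Set (ℝ × ℝ)} (hS : P.IsSide S)
    {u : ℝ × ℝ → ℝ} (hu : SmoothFive S u) : SmoothUpTo P.Gam S 5 u :=
  ⟨hu.1, fun _ hp m n hmn => exists_tendsto_of_uniformContinuousOn (hu.2 m n hmn) (hP.neBot hS hp)⟩

lemma SmoothUpToInterface.smoothUpTo {S : Set (ℝ × ℝ)} {w : ℝ × ℝ → ℝ}
    (h : P.SmoothUpToInterface S w) (N : ℕ) : SmoothUpTo P.Gam S N w :=
  ⟨h.1.of_le (by exact_mod_cast le_top), fun p hp m n _ => h.2 p hp m n⟩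

lemma tendsto_pd_of_contDiffOn {S : Set (ℝ × ℝ)} {g : ℝ × ℝ → ℝ}
    (hg : ContDiffOn ℝ ∞ g P.Om) {p : ℝ × ℝ} (hp : p ∈ P.Om) (m n : ℕ) :
    Tendsto (pd m n g) (𝓝[S] p) (𝓝 (pd m n g p)) := by
  have h : ContDiffOn ℝ (0 : ℕ) (pd m n g) P.Om :=
    contDiffOn_pd isOpen_Om (hg.of_le (by exact_mod_cast le_top))
  exact (h.continuousOn.continuousAt (isOpen_Om.mem_nhds hp)).tendsto.mono_left nhdsWithin_le_nhds

lemma IsSide.smoothUpTo {S : Set (ℝ × ℝ)} (hS : P.IsSide S) {g : ℝ × ℝ → ℝ}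
    (hg : ContDiffOn ℝ ∞ g P.Om) (N : ℕ) : SmoothUpTo P.Gam S N g :=
  ⟨(hg.mono hS.subset_Om).of_le (by exact_mod_cast le_top),
    fun _ hp m n _ => ⟨_, tendsto_pd_of_contDiffOn hg hp.1 m n⟩⟩

lemma Admissible.sideJet_eq_pd (hP : P.Admissible) {S : Set (ℝ × ℝ)} (hS : P.IsSide S)
    {g : ℝ × ℝ → ℝ} (hg : ContDiffOn ℝ ∞ g P.Om) {p : ℝ × ℝ} (hp : p ∈ P.Gam) (m n : ℕ) :
    sideJet S g p m n = pd m n g p := by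
  have := hP.neBot hS hp
  exact (tendsto_pd_of_contDiffOn hg hp.1 m n).limUnder_eq

end Problem

/-! ### Expansion of the jump conditions along the interface -/

/-- The order in which products of approximations agree. -/
lemma isBigO_mul_sub_mul {f h F H g : ℝ → ℝ} {l : Filter ℝ} (hf : (fun t => f t - F t) =O[l] g)
    (hh : (fun t => h t - H t) =O[l] g) (hF : F =O[l] fun _ => (1 : ℝ))
    (hH : H =O[l] fun _ => (1 : ℝ)) (hg : g =O[l] fun _ => (1 : ℝ)) :
    (fun t => f t * h t - F t * H t) =O[l] g := by
  have h1 : (fun t => (f t - F t) * (h t - H t)) =O[l] fun t => g t * 1 :=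
    hf.mul (hh.trans hg)
  have h2 : (fun t => (f t - F t) * H t) =O[l] fun t => g t * 1 := hf.mul hH
  have h3 : (fun t => F t * (h t - H t)) =O[l] fun t => 1 * g t := hF.mul hh
  simp only [mul_one, one_mul] at h1 h2 h3
  exact ((h1.add h2).add h3).congr_left fun t => by ring

lemma isBigO_one_of_contDiffAt {f : ℝ → ℝ} (hf : ContDiffAt ℝ ∞ f 0) :
    f =O[𝓝 0] fun _ => (1 : ℝ) := hf.continuousAt.isBigO_one ℝ

namespace LocalGeometry.Smooth

variable {L : LocalGeometry}

lemma isBigO_curve (hL : L.Smooth) : (fun t => ‖(L.r t, L.s t)‖) =O[𝓝 0] fun t : ℝ => t := by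
  have h1 := (hL.r.differentiableAt (by simp)).isBigO_sub
  have h2 := (hL.s.differentiableAt (by simp)).isBigO_sub
  simp only [hL.r_zero, hL.s_zero, sub_zero] at h1 h2
  exact (h1.prod_left h2).norm_left

lemma tendsto_curve (hL : L.Smooth) (b : ℝ × ℝ) :
    Tendsto (fun t => (b.1 + L.r t, b.2 + L.s t)) (𝓝 0) (𝓝 b) := by
  have h1 : ContinuousAt (fun t => (b.1 + L.r t, b.2 + L.s t)) 0 :=
    (continuousAt_const.add hL.r.continuousAt).prodMk (continuousAt_const.add hL.s.continuousAt)
  simpa [ContinuousAt, hL.r_zero, hL.s_zero] using h1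

end LocalGeometry.Smooth

namespace Problem

variable {P : Problem}

/-- Taylor's formula for one-sided derivatives along the interface. -/
lemma Admissible.isBigO_along (hP : P.Admissible) {S : Set (ℝ × ℝ)} (hS : P.IsSide S) {b : ℝ × ℝ}
    (hb : b ∈ P.Gam) {L : LocalGeometry} (hL : L.Smooth)
    (hmem : ∀ᶠ t in 𝓝 0, (b.1 + L.r t, b.2 + L.s t) ∈ P.Gam) {w : ℝ × ℝ → ℝ} (i j N : ℕ)
    (hw : SmoothUpTo P.Gam S (N + 1 + i + j) w) :
    (fun t => sideJet S w (b.1 + L.r t, b.2 + L.s t) i j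
      - taylorPoly N (fun m n => sideJet S w b (i + m) (j + n)) (L.r t, L.s t))
      =O[𝓝 0] fun t : ℝ => t ^ (N + 1) := by
  obtain ⟨C, hC, ρ, hρ, H⟩ := hP.taylor hS hb i j N hw
  have e : ∀ t, (b.1 + L.r t, b.2 + L.s t) - b = (L.r t, L.s t) := fun t => by
    ext <;> simp
  have hnear : ∀ᶠ t in 𝓝 (0 : ℝ), dist (b.1 + L.r t, b.2 + L.s t) b < ρ :=
    (hL.tendsto_curve b).eventually (Metric.ball_mem_nhds b hρ)
  refine IsBigO.trans (IsBigO.of_bound C ?_) (hL.isBigO_curve.pow (N + 1))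
  filter_upwards [hmem, hnear] with t h1 h2
  have := H b hb (by simpa using hρ) _ (Or.inr h1) h2
  rw [dist_eq_norm, e] at this
  rw [Real.norm_eq_abs, norm_pow, norm_norm]
  exact this

/-- The local geometry at `b` with the parametrization `(r, s)`. -/
def geom (P : Problem) (b : ℝ × ℝ) (r s : ℝ → ℝ) : LocalGeometry :=
  { αP := sideJet P.OmP P.a b, αM := sideJet P.OmM P.a b, r := r, s := s }

variable {b : ℝ × ℝ} {r s : ℝ → ℝ} {ε : ℝ}

lemma IsParam.smooth (h : P.IsParam b r s ε) : (P.geom b r s).Smooth where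
  r := h.smooth_r.contDiffAt (Ioo_mem_nhds (by linarith [h.pos]) h.pos)
  s := h.smooth_s.contDiffAt (Ioo_mem_nhds (by linarith [h.pos]) h.pos)
  r_zero := h.r_zero
  s_zero := h.s_zero

lemma IsParam.eventually_mem (h : P.IsParam b r s ε) :
    ∀ᶠ t in 𝓝 0, (b.1 + r t, b.2 + s t) ∈ P.Gam := by
  filter_upwards [Ioo_mem_nhds (show -ε < 0 by linarith [h.pos]) h.pos] with t ht using h.mem t ht

/-- The normal of the interface in terms of the parametrization. -/
lemma IsParam.eventually_normal (hP : P.Admissible) (h : P.IsParam b r s ε) :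
    ∀ᶠ t in 𝓝 (0 : ℝ), (P.normal (b.1 + r t, b.2 + s t)).1 * √(deriv r t ^ 2 + deriv s t ^ 2)
        = deriv s t ∧
      (P.normal (b.1 + r t, b.2 + s t)).2 * √(deriv r t ^ 2 + deriv s t ^ 2) = -deriv r t := by
  have hL := h.smooth
  have hI : Ioo (-ε) ε ∈ 𝓝 (0 : ℝ) := Ioo_mem_nhds (by linarith [h.pos]) h.pos
  have hb : b ∈ P.Gam := by
    have := h.mem 0 (mem_of_mem_nhds hI)
    simpa [h.r_zero, h.s_zero] using this
  have hγ : Tendsto (fun t => (b.1 + r t, b.2 + s t)) (𝓝 0) (𝓝 b) := hL.tendsto_curve b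
  have hX : Tendsto (dX P.ψ) (𝓝 b) (𝓝 (dX P.ψ b)) := by
    have := tendsto_pd_of_contDiffOn (S := univ) hP.smooth_psi hb.1 1 0
    rwa [nhdsWithin_univ] at this
  have hY : Tendsto (dY P.ψ) (𝓝 b) (𝓝 (dY P.ψ b)) := by
    have := tendsto_pd_of_contDiffOn (S := univ) hP.smooth_psi hb.1 0 1
    rwa [nhdsWithin_univ] at this
  have hr : Tendsto (deriv r) (𝓝 0) (𝓝 (deriv r 0)) := (contDiffAt_deriv hL.r).continuousAt
  have hs : Tendsto (deriv s) (𝓝 0) (𝓝 (deriv s 0)) := (contDiffAt_deriv hL.s).continuousAt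
  -- The orientation is prescribed at `t = 0` only; it persists for small `t` by continuity.
  have hor := (((hX.comp hγ).mul hs).sub ((hY.comp hγ).mul hr)).eventually (lt_mem_nhds h.orient)
  filter_upwards [hI, hor] with t ht hpos
  have hreg := h.regular t ht
  have hmem := h.mem t ht
  simp only [Function.comp_apply] at hpos
  set p : ℝ × ℝ := (b.1 + r t, b.2 + s t) with hp
  have hdr : HasDerivAt r (deriv r t) t :=
    ((h.smooth_r.contDiffAt (Ioo_mem_nhds ht.1 ht.2)).differentiableAt (by simp)).hasDerivAt
  have hds : HasDerivAt s (deriv s t) t :=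
    ((h.smooth_s.contDiffAt (Ioo_mem_nhds ht.1 ht.2)).differentiableAt (by simp)).hasDerivAt
  have hψ := (hP.hasStrictFDerivAt hmem.1).hasFDerivAt
  have hcomp : HasDerivAt (fun τ => P.ψ (b.1 + r τ, b.2 + s τ))
      (gradCLM (dX P.ψ p) (dY P.ψ p) (deriv r t, deriv s t)) t :=
    HasFDerivAt.comp_hasDerivAt (f := fun τ => (b.1 + r τ, b.2 + s τ)) t hψ
      ((hdr.const_add _).prodMk (hds.const_add _))
  have hconst : HasDerivAt (fun τ => P.ψ (b.1 + r τ, b.2 + s τ)) 0 t := by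
    refine (hasDerivAt_const t (0 : ℝ)).congr_of_eventuallyEq ?_
    filter_upwards [Ioo_mem_nhds ht.1 ht.2] with τ hτ using (h.mem τ hτ).2
  have htan : dX P.ψ p * deriv r t + dY P.ψ p * deriv s t = 0 := by
    simpa using hcomp.unique hconst
  generalize deriv r t = r' at *
  generalize deriv s t = s' at *
  simp only [normal]
  generalize dX P.ψ p = x at *
  generalize dY P.ψ p = y at *
  set σ := r' ^ 2 + s' ^ 2 with hσ
  -- Differentiating `ψ = 0` along the curve makes `∇ψ` orthogonal to `(r', s')`, so `∇ψ = l (s',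
  -- -r')`. The orientation gives `l > 0`, hence `|∇ψ| = l √σ`.
  set l := (x * s' - y * r') / σ with hl
  have hl0 : 0 < l := div_pos hpos hreg
  have hx : x = l * s' := by
    rw [hl]; field_simp; rw [hσ]; linear_combination r' * htan
  have hy : y = l * (-r') := by
    rw [hl]; field_simp; rw [hσ]; linear_combination s' * htan
  have hsq : √(x ^ 2 + y ^ 2) = l * √σ := by
    rw [show x ^ 2 + y ^ 2 = l ^ 2 * σ by rw [hx, hy, hσ]; ring, Real.sqrt_mul (by positivity),
      Real.sqrt_sq hl0.le]
  have hσ0 : √σ ≠ 0 := (Real.sqrt_pos.2 hreg).ne'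
  rw [hsq]
  constructor
  · rw [hx]; field_simp
  · rw [hy]; field_simp

/-- The jump of the Taylor polynomials of `u` along the interface. -/
theorem IsSolution.along_jump (hP : P.Admissible) {u : ℝ × ℝ → ℝ} (hu : P.IsSolution u)
    (hb : b ∈ P.Gam) (h : P.IsParam b r s ε) {p : ℕ} (hp : p ≤ 3) :
    (P.geom b r s).along (taylorPoly 3 (sideJet P.OmP u b)) p
      - (P.geom b r s).along (taylorPoly 3 (sideJet P.OmM u b)) p
      = (P.geom b r s).along (taylorPoly 3 (fun m n => pd m n P.g₁ b)) p := by
  have hL := h.smooth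
  have hS₁ := hP.smoothFive isSide_plus hu.smooth_plus
  have hS₂ := hP.smoothFive isSide_minus hu.smooth_minus
  have hS₃ := isSide_plus.smoothUpTo hP.smooth_g₁ 4
  have h1 := hP.isBigO_along isSide_plus hb hL h.eventually_mem 0 0 3 (hS₁.mono (by norm_num))
  have h2 := hP.isBigO_along isSide_minus hb hL h.eventually_mem 0 0 3 (hS₂.mono (by norm_num))
  have h3 := hP.isBigO_along isSide_plus hb hL h.eventually_mem 0 0 3 hS₃
  have hg : (fun m n => sideJet P.OmP P.g₁ b (0 + m) (0 + n)) = fun m n => pd m n P.g₁ b := by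
    funext m n
    rw [zero_add, zero_add, hP.sideJet_eq_pd isSide_plus hP.smooth_g₁ hb]
  rw [hg] at h3
  simp only [zero_add] at h1 h2
  have c1 := hL.taylorPoly 3 (sideJet P.OmP u b)
  have c2 := hL.taylorPoly 3 (sideJet P.OmM u b)
  have c3 := hL.taylorPoly 3 (fun m n => pd m n P.g₁ b)
  -- The jump condition holds exactly at every nearby point of the curve, so the traces cancel and
  -- the combination of the three polynomials alone is `O(t⁴)`.
  have hO := ((h2.sub h1).add h3).congr' (f₂ := fun t =>
      taylorPoly 3 (sideJet P.OmP u b) ((P.geom b r s).r t, (P.geom b r s).s t)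
      - taylorPoly 3 (sideJet P.OmM u b) ((P.geom b r s).r t, (P.geom b r s).s t)
      - taylorPoly 3 (fun m n => pd m n P.g₁ b) ((P.geom b r s).r t, (P.geom b r s).s t)) (by
    filter_upwards [h.eventually_mem] with t ht
    have hj := hu.jump _ ht
    have hgt := hP.sideJet_eq_pd isSide_plus hP.smooth_g₁ ht 0 0
    have e1 : ∀ S p, sideJet S u p 0 0 = trace S u p := fun _ _ => rfl
    have e2 : ∀ p, pd 0 0 P.g₁ p = P.g₁ p := fun _ => rfl
    simp only [geom] at *
    rw [hgt, e1, e1, e2, ← hj]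
    ring) EventuallyEq.rfl
  have := coeffAt_eq_zero ((c1.sub c2).sub c3) (hO.mono nhdsWithin_le_nhds) p hp
  rw [← coeff_ser, ser_sub (c1.sub c2) c3, ser_sub c1 c2] at this
  simp only [map_sub, coeff_ser] at this
  exact sub_eq_zero.1 this

lemma Admissible.trace_flux (hP : P.Admissible) {S : Set (ℝ × ℝ)} (hS : P.IsSide S)
    {a u : ℝ × ℝ → ℝ} (ha : SmoothUpTo P.Gam S 0 a) (hu : SmoothUpTo P.Gam S 1 u) {p : ℝ × ℝ}
    (hp : p ∈ P.Gam) (x y : ℝ) :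
    trace S (fun q => a q * (dX u q * x + dY u q * y)) p
      = sideJet S a p 0 0 * (sideJet S u p 1 0 * x + sideJet S u p 0 1 * y) := by
  have := hP.neBot hS hp
  have h1 : Tendsto a (𝓝[S] p) (𝓝 (sideJet S a p 0 0)) := ha.tendsto (m := 0) (n := 0) le_rfl hp
  have h2 : Tendsto (dX u) (𝓝[S] p) (𝓝 (sideJet S u p 1 0)) :=
    hu.tendsto (m := 1) (n := 0) le_rfl hp
  have h3 : Tendsto (dY u) (𝓝[S] p) (𝓝 (sideJet S u p 0 1)) :=
    hu.tendsto (m := 0) (n := 1) le_rfl hp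
  exact (h1.mul ((h2.mul_const x).add (h3.mul_const y))).limUnder_eq

/-- Taylor's formula for the flux along the interface. -/
lemma Admissible.isBigO_flux (hP : P.Admissible) {S : Set (ℝ × ℝ)} (hS : P.IsSide S)
    (hb : b ∈ P.Gam) {L : LocalGeometry} (hL : L.Smooth)
    (hmem : ∀ᶠ t in 𝓝 0, (b.1 + L.r t, b.2 + L.s t) ∈ P.Gam) {a u : ℝ × ℝ → ℝ}
    (ha : SmoothUpTo P.Gam S 3 a) (hu : SmoothUpTo P.Gam S 4 u) :
    (fun t => sideJet S a (b.1 + L.r t, b.2 + L.s t) 0 0 *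
        (sideJet S u (b.1 + L.r t, b.2 + L.s t) 1 0 * deriv L.s t
          - sideJet S u (b.1 + L.r t, b.2 + L.s t) 0 1 * deriv L.r t)
      - LocalGeometry.taylorA (sideJet S a b) (L.r t, L.s t) *
        (dX (taylorPoly 3 (sideJet S u b)) (L.r t, L.s t) * deriv L.s t
          - dY (taylorPoly 3 (sideJet S u b)) (L.r t, L.s t) * deriv L.r t))
      =O[𝓝 0] fun t : ℝ => t ^ 3 := by
  have h1 := hP.isBigO_along hS hb hL hmem 0 0 2 ha
  have h2 := hP.isBigO_along hS hb hL hmem 1 0 2 hu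
  have h3 := hP.isBigO_along hS hb hL hmem 0 1 2 hu
  simp only [zero_add, add_comm 1] at h1 h2 h3
  simp only [dX_taylorPoly, dY_taylorPoly]
  have hr := contDiffAt_deriv hL.r
  have hs := contDiffAt_deriv hL.s
  have cX := hL.taylorPoly 2 (fun i j => sideJet S u b (i + 1) j)
  have cY := hL.taylorPoly 2 (fun i j => sideJet S u b i (j + 1))
  have hg : (fun t : ℝ => t ^ 3) =O[𝓝 0] fun _ => (1 : ℝ) :=
    ((continuous_pow 3).continuousAt).isBigO_one ℝ
  -- Quadratic approximations of `a` and of `∇u` both have error `O(t³)`, and the factors are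
  -- bounded.
  refine isBigO_mul_sub_mul h1 ?_ (isBigO_one_of_contDiffAt (hL.taylorPoly 2 _))
    (isBigO_one_of_contDiffAt ((cX.mul hs).sub (cY.mul hr))) hg
  have e1 := h2.mul (isBigO_one_of_contDiffAt hs)
  have e2 := h3.mul (isBigO_one_of_contDiffAt hr)
  simp only [mul_one] at e1 e2
  exact (e1.sub e2).congr_left fun t => by ring

/-- The jump of the flux of the Taylor polynomials of `u` along the interface. -/
theorem IsSolution.flux_along_jump (hP : P.Admissible) {u : ℝ × ℝ → ℝ} (hu : P.IsSolution u)
    (hb : b ∈ P.Gam) (h : P.IsParam b r s ε) {p : ℕ} (hp : p ≤ 2) :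
    (P.geom b r s).fluxAlong (sideJet P.OmP P.a b) (taylorPoly 3 (sideJet P.OmP u b)) p
      - (P.geom b r s).fluxAlong (sideJet P.OmM P.a b) (taylorPoly 3 (sideJet P.OmM u b)) p
      = (P.geom b r s).speedAlong (taylorPoly 2 (fun m n => pd m n P.g₂ b)) p := by
  have hL := h.smooth
  have uS₁ := (hP.smoothFive isSide_plus hu.smooth_plus).mono (show 4 ≤ 5 by norm_num)
  have uS₂ := (hP.smoothFive isSide_minus hu.smooth_minus).mono (show 4 ≤ 5 by norm_num)
  have aS₁ := hP.smooth_a_plus.smoothUpTo 3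
  have aS₂ := hP.smooth_a_minus.smoothUpTo 3
  have h1 := hP.isBigO_flux isSide_plus hb hL h.eventually_mem aS₁ uS₁
  have h2 := hP.isBigO_flux isSide_minus hb hL h.eventually_mem aS₂ uS₂
  have h3 := hP.isBigO_along isSide_plus hb hL h.eventually_mem 0 0 2
    (isSide_plus.smoothUpTo hP.smooth_g₂ 3)
  have hg : (fun m n => sideJet P.OmP P.g₂ b (0 + m) (0 + n)) = fun m n => pd m n P.g₂ b := by
    funext m n
    rw [zero_add, zero_add, hP.sideJet_eq_pd isSide_plus hP.smooth_g₂ hb]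
  rw [hg] at h3
  have hr := contDiffAt_deriv hL.r
  have hs := contDiffAt_deriv hL.s
  have cσ : ContDiffAt ℝ ∞ (fun t => √(deriv r t ^ 2 + deriv s t ^ 2)) 0 :=
    ((hr.pow 2).add (hs.pow 2)).sqrt (h.regular 0 ⟨by linarith [h.pos], h.pos⟩).ne'
  have h4 := h3.mul (isBigO_one_of_contDiffAt cσ)
  simp only [mul_one] at h4
  have c1 := hL.flux (sideJet P.OmP P.a b) 2 (sideJet P.OmP u b)
  have c2 := hL.flux (sideJet P.OmM P.a b) 2 (sideJet P.OmM u b)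
  have c3 := (hL.taylorPoly 2 (fun m n => pd m n P.g₂ b)).mul cσ
  -- The flux condition is multiplied by the speed of the curve, which replaces the unit normal by
  -- `(s', -r')` and removes the square root from the left side. The traces then cancel up to
  -- `O(t³)`.
  have hO := ((h2.sub h1).add h4).congr' (f₂ := fun t =>
      LocalGeometry.taylorA (sideJet P.OmP P.a b) (r t, s t) *
        (dX (taylorPoly 3 (sideJet P.OmP u b)) (r t, s t) * deriv s t
          - dY (taylorPoly 3 (sideJet P.OmP u b)) (r t, s t) * deriv r t)
      - LocalGeometry.taylorA (sideJet P.OmM P.a b) (r t, s t) *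
        (dX (taylorPoly 3 (sideJet P.OmM u b)) (r t, s t) * deriv s t
          - dY (taylorPoly 3 (sideJet P.OmM u b)) (r t, s t) * deriv r t)
      - taylorPoly 2 (fun m n => pd m n P.g₂ b) (r t, s t) * √(deriv r t ^ 2 + deriv s t ^ 2)) (by
    filter_upwards [h.eventually_mem, h.eventually_normal hP] with t ht hn
    have hj := hu.flux_jump _ ht
    rw [hP.trace_flux isSide_plus (aS₁.mono (by norm_num)) (uS₁.mono (by norm_num)) ht,
      hP.trace_flux isSide_minus (aS₂.mono (by norm_num)) (uS₂.mono (by norm_num)) ht] at hj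
    have hgt := hP.sideJet_eq_pd isSide_plus hP.smooth_g₂ ht 0 0
    have e2 : ∀ p, pd 0 0 P.g₂ p = P.g₂ p := fun _ => rfl
    obtain ⟨n1, n2⟩ := hn
    simp only [geom]
    rw [hgt, e2]
    linear_combination (-√(deriv r t ^ 2 + deriv s t ^ 2)) * hj
      + (sideJet P.OmP P.a (b.1 + r t, b.2 + s t) 0 0 * sideJet P.OmP u (b.1 + r t, b.2 + s t) 1 0
        - sideJet P.OmM P.a (b.1 + r t, b.2 + s t) 0 0
          * sideJet P.OmM u (b.1 + r t, b.2 + s t) 1 0) * n1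
      + (sideJet P.OmP P.a (b.1 + r t, b.2 + s t) 0 0 * sideJet P.OmP u (b.1 + r t, b.2 + s t) 0 1
        - sideJet P.OmM P.a (b.1 + r t, b.2 + s t) 0 0
          * sideJet P.OmM u (b.1 + r t, b.2 + s t) 0 1) * n2) EventuallyEq.rfl
  have := coeffAt_eq_zero ((c1.sub c2).sub c3) (hO.mono nhdsWithin_le_nhds) p hp
  rw [← coeff_ser, ser_sub (c1.sub c2) c3, ser_sub c1 c2] at this
  simp only [map_sub, coeff_ser] at this
  exact sub_eq_zero.1 this

end Problem

/-! ### The jet on the negative side is the transmitted jet -/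

lemma sum_Lam1_succ (p : ℕ) (F : ℕ × ℕ → ℝ) :
    ∑ k ∈ Lam1 (p + 1), F k = ∑ k ∈ Lam1 p, F k + F (0, p + 1) + F (1, p) := by
  have h : Lam1 (p + 1) = insert (1, p) (insert (0, p + 1) (Lam1 p)) := by
    ext ⟨m, n⟩
    simp only [mem_Lam1, Finset.mem_insert, Prod.mk.injEq]
    omega
  rw [h, Finset.sum_insert (by simp [mem_Lam1]), Finset.sum_insert (by simp [mem_Lam1])]
  ring

lemma LinTaylor.sum_mono {Φ : (ℝ × ℝ → ℝ) → ℝ} (h : LinTaylor Φ) (J : ℕ → ℕ → ℝ) :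
    Φ (taylorPoly 3 J) = ∑ q ∈ Lam 3, J q.1 q.2 * Φ (mono q.1 q.2) := by
  obtain ⟨c, hc⟩ := h
  rw [hc]
  refine Finset.sum_congr rfl fun q hq => ?_
  have h1 : mono q.1 q.2 = taylorPoly 3 (unitJet q.1 q.2) := by
    funext p
    rw [taylorPoly, IsLin.sum_unitJet_mul hq fun k => mono k.1 k.2 p]
  rw [h1, hc, IsLin.sum_unitJet_mul hq]

namespace LocalGeometry

variable {L : LocalGeometry}

lemma Smooth.speedAlong_taylorPoly (hL : L.Smooth) (hreg : 0 < deriv L.r 0 ^ 2 + deriv L.s 0 ^ 2)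
    (N : ℕ) (J : ℕ → ℕ → ℝ) (p : ℕ) :
    L.speedAlong (EllipticInterface.taylorPoly N J) p
      = ∑ q ∈ Lam N, J q.1 q.2 * L.speedAlong (EllipticInterface.mono q.1 q.2) p := by
  have cσ : ContDiffAt ℝ ∞ (fun t => √(deriv L.r t ^ 2 + deriv L.s t ^ 2)) 0 :=
    (((contDiffAt_deriv hL.r).pow 2).add ((contDiffAt_deriv hL.s).pow 2)).sqrt hreg.ne'
  have hm := fun m n => (hL.mono m n).mul cσ
  rw [speedAlong, ← coeff_ser]
  simp only [EllipticInterface.taylorPoly, Finset.sum_mul, mul_assoc]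
  rw [ser_sum _ fun q _ => contDiffAt_const.mul (hm q.1 q.2), map_sum]
  refine Finset.sum_congr rfl fun q _ => ?_
  rw [ser_mul contDiffAt_const (hm q.1 q.2), ser_const, PowerSeries.coeff_C_mul, coeff_ser,
    speedAlong]

/-- The order-by-order solution of the jump conditions is the only one. -/
theorem Smooth.minusJet_eq (hL : L.Smooth) (D : JetData) (v : ℕ → ℕ → ℝ)
    (hdet : ∀ p, 1 ≤ p → p ≤ 3 → L.det p ≠ 0) (h0 : D.uP 0 0 - v 0 0 = D.g₁ 0 0)
    (hU : ∀ p ≤ 3, (∑ k ∈ Lam1 3, D.uP k.1 k.2 * L.along (G L.αP k.1 k.2) p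
        + ∑ k ∈ Lam 1, D.fP k.1 k.2 * L.along (H L.αP k.1 k.2) p)
      - (∑ k ∈ Lam1 3, v k.1 k.2 * L.along (G L.αM k.1 k.2) p
        + ∑ k ∈ Lam 1, D.fM k.1 k.2 * L.along (H L.αM k.1 k.2) p)
      = ∑ k ∈ Lam 3, D.g₁ k.1 k.2 * L.along (EllipticInterface.mono k.1 k.2) p)
    (hF : ∀ p ≤ 2, (∑ k ∈ Lam1 3, D.uP k.1 k.2 * L.fluxAlong L.αP (G L.αP k.1 k.2) p
        + ∑ k ∈ Lam 1, D.fP k.1 k.2 * L.fluxAlong L.αP (H L.αP k.1 k.2) p)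
      - (∑ k ∈ Lam1 3, v k.1 k.2 * L.fluxAlong L.αM (G L.αM k.1 k.2) p
        + ∑ k ∈ Lam 1, D.fM k.1 k.2 * L.fluxAlong L.αM (H L.αM k.1 k.2) p)
      = ∑ k ∈ Lam 2, D.g₂ k.1 k.2 * L.speedAlong (EllipticInterface.mono k.1 k.2) p)
    {p : ℕ} (hp : p ≤ 3) : ∀ k ∈ Lam1 p, L.minusJet D p k.1 k.2 = v k.1 k.2 := by
  -- Triangularity: in the equation of order `p` the sum over all unknowns reduces to those of order
  -- at most `p`.
  have cut : ∀ {p : ℕ}, p ≤ 3 → ∀ x Φ : ℕ × ℕ → ℝ, (∀ k ∈ Lam1 3, p < k.1 + k.2 → Φ k = 0) →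
      ∑ k ∈ Lam1 3, x k * Φ k = ∑ k ∈ Lam1 p, x k * Φ k := by
    intro p hp x Φ h
    refine (Finset.sum_subset (Lam1_mono hp) fun k hk hk' => ?_).symm
    rw [mem_Lam1] at hk hk'
    rw [h k (mem_Lam1.2 hk) (by omega), mul_zero]
  induction p with
  | zero =>
    rintro ⟨m, n⟩ hk
    obtain ⟨h1, -⟩ := mem_Lam1.1 hk
    obtain ⟨rfl, rfl⟩ : m = 0 ∧ n = 0 := by dsimp only at h1; omega
    simp only [minusJet, and_self, if_true]
    linarith
  | succ p ih =>
    have ih := ih (by omega)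
    have hs : ∀ Φ : ℕ × ℕ → ℝ, ∑ k ∈ Lam1 p, L.minusJet D p k.1 k.2 * Φ k
        = ∑ k ∈ Lam1 p, v k.1 k.2 * Φ k := fun Φ =>
      Finset.sum_congr rfl fun k hk => by rw [ih k hk]
    have hd := hdet (p + 1) (by omega) hp
    -- With the known lower orders moved to the right, the jump of `u` at order `p + 1` and the jump
    -- of the flux at order `p` form a two-by-two system for `v 0 (p + 1)` and `v 1 p`.
    have eU : v 0 (p + 1) * L.along (G L.αM 0 (p + 1)) (p + 1)
        + v 1 p * L.along (G L.αM 1 p) (p + 1) = L.rhsU D (L.minusJet D p) (p + 1) := by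
      have h := hU (p + 1) hp
      rw [cut hp (fun k => D.uP k.1 k.2) _ fun k hk hkp => hL.along_G_eq_zero L.αP hk hkp,
        cut hp (fun k => v k.1 k.2) _ fun k hk hkp => hL.along_G_eq_zero L.αM hk hkp,
        sum_Lam1_succ p fun k => v k.1 k.2 * _] at h
      rw [rhsU, dataF, Nat.add_sub_cancel, hs fun k => L.along (G L.αM k.1 k.2) (p + 1),
        Finset.sum_sub_distrib]
      linarith
    have eF : v 0 (p + 1) * L.fluxAlong L.αM (G L.αM 0 (p + 1)) p
        + v 1 p * L.fluxAlong L.αM (G L.αM 1 p) p = L.rhsFlux D (L.minusJet D p) (p + 1) := by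
      have h := hF p (by omega)
      rw [cut hp (fun k => D.uP k.1 k.2) _ fun k hk hkp => hL.fluxAlong_G_eq_zero L.αP L.αP hk hkp,
        cut hp (fun k => v k.1 k.2) _ fun k hk hkp => hL.fluxAlong_G_eq_zero L.αM L.αM hk hkp,
        sum_Lam1_succ p fun k => v k.1 k.2 * _] at h
      rw [rhsFlux, dataG, Nat.add_sub_cancel, hs fun k => L.fluxAlong L.αM (G L.αM k.1 k.2) p,
        Finset.sum_sub_distrib]
      linarith
    rintro ⟨m, n⟩ hk
    rw [det, Nat.add_sub_cancel] at hd
    simp only [minusJet, det, Nat.add_sub_cancel]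
    -- Cramer's rule for `eU` and `eF` in the first two cases; the third is the induction
    -- hypothesis.
    split_ifs with h1 h2
    · rw [h1.1, h1.2, div_eq_iff hd]
      linear_combination (-L.fluxAlong L.αM (G L.αM 1 p) p) * eU
        + L.along (G L.αM 1 p) (p + 1) * eF
    · rw [h2.1, h2.2, div_eq_iff hd]
      linear_combination (-L.along (G L.αM 0 (p + 1)) (p + 1)) * eF
        + L.fluxAlong L.αM (G L.αM 0 (p + 1)) p * eU
    · refine ih (m, n) (mem_Lam1.2 ?_)
      have := mem_Lam1.1 hk
      dsimp only at this ⊢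
      omega

end LocalGeometry

namespace Problem

variable {P : Problem} {b : ℝ × ℝ} {r s : ℝ → ℝ} {ε : ℝ}

lemma Admissible.side_pos (hP : P.Admissible) {S : Set (ℝ × ℝ)} (hS : P.IsSide S)
    (hb : b ∈ P.Gam) : 0 < sideJet S P.a b 0 0 := by
  rcases hS with rfl | rfl
  · exact hP.a_pos_plus b hb
  · exact hP.a_pos_minus b hb

lemma Admissible.smooth_a (hP : P.Admissible) {S : Set (ℝ × ℝ)} (hS : P.IsSide S) (N : ℕ) :
    SmoothUpTo P.Gam S N P.a := by
  rcases hS with rfl | rfl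
  · exact hP.smooth_a_plus.smoothUpTo N
  · exact hP.smooth_a_minus.smoothUpTo N

lemma Admissible.smooth_f (hP : P.Admissible) {S : Set (ℝ × ℝ)} (hS : P.IsSide S) (N : ℕ) :
    SmoothUpTo P.Gam S N P.f := by
  rcases hS with rfl | rfl
  · exact hP.smooth_f_plus.smoothUpTo N
  · exact hP.smooth_f_minus.smoothUpTo N

lemma IsSolution.smoothUpTo (hP : P.Admissible) {u : ℝ × ℝ → ℝ} (hu : P.IsSolution u)
    {S : Set (ℝ × ℝ)} (hS : P.IsSide S) : SmoothUpTo P.Gam S 5 u := by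
  rcases hS with rfl | rfl
  · exact hP.smoothFive isSide_plus hu.smooth_plus
  · exact hP.smoothFive isSide_minus hu.smooth_minus

lemma IsSolution.reduced (hP : P.Admissible) {u : ℝ × ℝ → ℝ} (hu : P.IsSolution u)
    {S : Set (ℝ × ℝ)} (hS : P.IsSide S) (hb : b ∈ P.Gam) (q : ℕ × ℕ) :
    sideJet S u b q.1 q.2
      = EllipticInterface.reduced (sideJet S P.a b) (sideJet S u b) (sideJet S P.f b) q.1 q.2 :=
  sideJet_eq_reduced (hP.isOpen_side hS) (hP.smooth_a hS 2)
    ((hu.smoothUpTo hP hS).mono (by norm_num)) (hP.smooth_f hS 1)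
    (fun p hp => hu.pde p (hS.subset_union hp)) hb (hP.neBot hS hb) (hP.side_pos hS hb).ne'

/-- The jets of the data at `b`. -/
def jetData (P : Problem) (u : ℝ × ℝ → ℝ) (b : ℝ × ℝ) : JetData :=
  { uP := sideJet P.OmP u b, fP := sideJet P.OmP P.f b, fM := sideJet P.OmM P.f b,
    g₁ := fun m n => pd m n P.g₁ b, g₂ := fun m n => pd m n P.g₂ b }

/-- The true jet of `u_-` solves the expanded jump conditions, and these have a unique solution
because the determinants do not vanish. This links the algebraic transmission coefficients to the
solution `u`. -/
theorem IsSolution.minusJet_eq (hP : P.Admissible) {u : ℝ × ℝ → ℝ} (hu : P.IsSolution u)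
    (hb : b ∈ P.Gam) (h : P.IsParam b r s ε) {k : ℕ × ℕ} (hk : k ∈ Lam1 3) :
    sideJet P.OmM u b k.1 k.2 = (P.geom b r s).minusJet (P.jetData u b) 3 k.1 k.2 := by
  have hL := h.smooth
  have hreg : 0 < deriv r 0 ^ 2 + deriv s 0 ^ 2 := h.regular 0 ⟨by linarith [h.pos], h.pos⟩
  have hRP := fun q (_ : q ∈ Lam 3) => hu.reduced hP isSide_plus hb q
  have hRM := fun q (_ : q ∈ Lam 3) => hu.reduced hP isSide_minus hb q
  refine (hL.minusJet_eq (P.jetData u b) (sideJet P.OmM u b) (fun p h1 h3 => ?_) (hu.jump b hb)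
    (fun p hp => ?_) (fun p hp => ?_) le_rfl k hk).symm
  · rw [hL.det_eq h1 h3]
    have h4 : 0 < (P.geom b r s).αM 0 0 := hP.side_pos isSide_minus hb
    have h5 : 0 < deriv (P.geom b r s).r 0 ^ 2 + deriv (P.geom b r s).s 0 ^ 2 := hreg
    positivity
  · have e := hu.along_jump hP hb h hp
    have e1 := (hL.linTaylor_along p).reduced hRP
    have e2 := (hL.linTaylor_along p).reduced hRM
    have e3 := (hL.linTaylor_along p).sum_mono (fun m n => pd m n P.g₁ b)
    rw [e1, e2, e3] at e
    exact e
  · have e := hu.flux_along_jump hP hb h hp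
    have e1 := (hL.linTaylor_fluxAlong (sideJet P.OmP P.a b) p).reduced hRP
    have e2 := (hL.linTaylor_fluxAlong (sideJet P.OmM P.a b) p).reduced hRM
    have e3 := hL.speedAlong_taylorPoly hreg 2 (fun m n => pd m n P.g₂ b) p
    rw [e1, e2, e3] at e
    exact e

end Problem

/-! ### The error identity -/

namespace Split

variable (S : Split) (C : ℤ × ℤ → Polynomial ℝ) (e : ℝ × ℝ)

lemma sum_eval_taylorPoly (d : Finset (ℤ × ℤ)) (x : ℤ × ℤ → ℝ) (y : ℤ × ℤ → ℝ × ℝ)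
    {α υ φ : ℕ → ℕ → ℝ} (h : ∀ q ∈ Lam 3, υ q.1 q.2 = reduced α υ φ q.1 q.2) :
    ∑ kl ∈ d, x kl * taylorPoly 3 υ (y kl)
      = ∑ k ∈ Lam1 3, υ k.1 k.2 * ∑ kl ∈ d, x kl * G α k.1 k.2 (y kl)
        + ∑ k ∈ Lam 1, φ k.1 k.2 * ∑ kl ∈ d, x kl * H α k.1 k.2 (y kl) := by
  simp only [Finset.mul_sum]
  rw [Finset.sum_comm, Finset.sum_comm (s := Lam 1), ← Finset.sum_add_distrib]
  refine Finset.sum_congr rfl fun kl _ => ?_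
  have h1 := (linTaylor_eval (y kl)).reduced h
  rw [h1, mul_add, Finset.mul_sum, Finset.mul_sum]
  congr 1 <;> exact Finset.sum_congr rfl fun k _ => by ring

lemma directional_taylorPoly {α υ φ : ℕ → ℕ → ℝ}
    (h : ∀ q ∈ Lam 3, υ q.1 q.2 = reduced α υ φ q.1 q.2) (τ : ℝ) :
    S.directional e (taylorPoly 3 υ) τ
      = ∑ k ∈ Lam1 3, υ k.1 k.2 * S.directional e (G α k.1 k.2) τ
        + ∑ k ∈ Lam 1, φ k.1 k.2 * S.directional e (H α k.1 k.2) τ := by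
  have h1 := (linTaylor_partials (S.v₀ * τ, S.w₀ * τ) e.1 e.2).reduced h
  simp only [directional]
  rw [h1, mul_add, Finset.mul_sum, Finset.mul_sum]
  congr 1 <;> exact Finset.sum_congr rfl fun k _ => by ring

lemma sum_mul_transfer (I : Finset (ℕ × ℕ)) (x : ℕ → ℕ → ℝ) (T : ℕ → ℕ → ℕ → ℕ → ℝ) (τ : ℝ) :
    ∑ q ∈ I, x q.1 q.2 * S.transfer C T q.1 q.2 τ
      = ∑ k ∈ Lam1 3, (∑ q ∈ I, x q.1 q.2 * T k.1 k.2 q.1 q.2) * S.IM C k.1 k.2 τ := by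
  simp only [transfer, Finset.mul_sum, Finset.sum_mul]
  rw [Finset.sum_comm]
  exact Finset.sum_congr rfl fun k _ => Finset.sum_congr rfl fun q _ => by ring

/-- An exact identity, with no estimate. The stencil sums of the two Taylor polynomials are expanded
in `G` and `H`, and the jet of `u_-` is replaced by its transmitted form. All contributions of
`f_±`, `g₁`, `g₂` then cancel against the subtracted terms, apart from the directional parts, which
reassemble into the derivative of the Taylor polynomial of `u_+`. -/
theorem mul_gradFormula {τ : ℝ} (hτ : τ ≠ 0) (U : ℤ × ℤ → ℝ) (D : JetData) (υM : ℕ → ℕ → ℝ)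
    (hd : ∀ F : ℤ × ℤ → ℝ, ∑ kl ∈ stencil, F kl = ∑ kl ∈ S.dP, F kl + ∑ kl ∈ S.dM, F kl)
    (hP : ∀ q ∈ Lam 3, D.uP q.1 q.2 = reduced S.L.αP D.uP D.fP q.1 q.2)
    (hM : ∀ q ∈ Lam 3, υM q.1 q.2 = reduced S.L.αM υM D.fM q.1 q.2)
    (hT : ∀ k ∈ Lam1 3, υM k.1 k.2 = S.L.minusJet D 3 k.1 k.2) :
    τ * S.gradFormula C e τ U D.fP D.fM D.g₁ D.g₂
      = ∑ kl ∈ S.dP, (C kl).eval τ * (U kl - taylorPoly 3 D.uP (S.rel τ kl))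
        + ∑ kl ∈ S.dM, (C kl).eval τ * (U kl - taylorPoly 3 υM (S.rel τ kl))
        + ∑ q ∈ Lam1 3, D.uP q.1 q.2 * S.I C e q.1 q.2 τ
        + S.directional e (taylorPoly 3 D.uP) τ := by
  have hmul : ∀ (I : Finset (ℕ × ℕ)) (x y : ℕ × ℕ → ℝ),
      τ * ∑ q ∈ I, 1 / τ * x q * y q = ∑ q ∈ I, x q * y q := fun I x y => by
    rw [Finset.mul_sum]
    exact Finset.sum_congr rfl fun q _ => by field_simp
  have hmul' : τ * ∑ kl ∈ stencil, 1 / τ * (C kl).eval τ * U kl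
      = ∑ kl ∈ stencil, (C kl).eval τ * U kl := by
    rw [Finset.mul_sum]
    exact Finset.sum_congr rfl fun q _ => by field_simp
  have e1 := sum_eval_taylorPoly S.dP (fun kl => (C kl).eval τ) (S.rel τ) hP
  have e2 := sum_eval_taylorPoly S.dM (fun kl => (C kl).eval τ) (S.rel τ) hM
  have e3 := S.directional_taylorPoly e hP τ
  -- The unknown jet of `u_-` enters only through these sums; expanding it in the data produces the
  -- five transfer terms of `I`, `J^±`, `J^{g₁}` and `J^{g₂}`.
  have e4 : ∑ k ∈ Lam1 3, υM k.1 k.2 * S.IM C k.1 k.2 τ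
      = ∑ q ∈ Lam1 3, D.uP q.1 q.2 * S.transfer C S.L.TU q.1 q.2 τ
        + ∑ q ∈ Lam 1, D.fP q.1 q.2 * S.transfer C S.L.TP q.1 q.2 τ
        + ∑ q ∈ Lam 1, D.fM q.1 q.2 * S.transfer C S.L.TM q.1 q.2 τ
        + ∑ q ∈ Lam 3, D.g₁ q.1 q.2 * S.transfer C S.L.TG1 q.1 q.2 τ
        + ∑ q ∈ Lam 2, D.g₂ q.1 q.2 * S.transfer C S.L.TG2 q.1 q.2 τ := by
    simp only [sum_mul_transfer, ← Finset.sum_add_distrib, ← add_mul]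
    refine Finset.sum_congr rfl fun k hk => ?_
    rw [hT k hk, (S.L.isLin_minusJet le_rfl k.1 k.2).expand D]
    rfl
  rw [gradFormula, mul_sub, mul_sub, mul_sub, mul_sub, hmul', hd,
    hmul (Lam 1) (fun q => D.fP q.1 q.2) fun q => S.JP C e q.1 q.2 τ,
    hmul (Lam 1) (fun q => D.fM q.1 q.2) fun q => S.JM C q.1 q.2 τ,
    hmul (Lam 3) (fun q => D.g₁ q.1 q.2) fun q => S.JG1 C q.1 q.2 τ,
    hmul (Lam 2) (fun q => D.g₂ q.1 q.2) fun q => S.JG2 C q.1 q.2 τ]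
  simp only [I, JP, JM, JG1, JG2, IP, JP0, JM0, mul_sub, mul_add, Finset.sum_sub_distrib,
    Finset.sum_add_distrib]
  simp only [IM] at e4
  rw [e1, e2, e3, e4]
  ring

end Split

/-! ### The error estimate near a point of the interface -/

lemma abs_eval_le {B : ℝ} {C : ℤ × ℤ → Polynomial ℝ} (hC : CoeffBound B C) {kl : ℤ × ℤ}
    (hkl : kl ∈ stencil) (hdeg : (C kl).natDegree < 4) {h : ℝ} (h0 : 0 ≤ h) (h1 : h ≤ 1) :
    |(C kl).eval h| ≤ 4 * B := by
  rw [Polynomial.eval_eq_sum_range' hdeg]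
  refine (Finset.abs_sum_le_sum_abs _ _).trans ?_
  have hb : ∀ i ∈ Finset.range 4, |(C kl).coeff i * h ^ i| ≤ B := fun i _ => by
    rw [abs_mul, abs_of_nonneg (pow_nonneg h0 i)]
    exact (mul_le_of_le_one_right (abs_nonneg _) (pow_le_one₀ h0 h1)).trans (hC kl hkl i)
  refine (Finset.sum_le_sum hb).trans ?_
  simp

lemma exists_eventually_abs_le {Z : Set (ℝ × ℝ)} {b₀ : ℝ × ℝ} (hb₀ : b₀ ∈ Z) {κ : Type*}
    (I : Finset κ) {x : κ → ℝ × ℝ → ℝ} (hx : ∀ q ∈ I, ContinuousOn (x q) Z) :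
    ∃ M, 0 ≤ M ∧ ∀ᶠ b in 𝓝[Z] b₀, ∀ q ∈ I, |x q b| ≤ M := by
  refine ⟨∑ q ∈ I, (|x q b₀| + 1), Finset.sum_nonneg fun q _ => by positivity,
    (Filter.eventually_all_finset _).2 fun q hq => ?_⟩
  have h := ((hx q hq) b₀ hb₀).tendsto.abs.eventually (gt_mem_nhds (lt_add_one |x q b₀|))
  filter_upwards [h] with b hb
  exact hb.le.trans (Finset.single_le_sum (f := fun q => |x q b₀| + 1)
    (fun q _ => by positivity) hq)

lemma card_stencil : stencil.card = 9 := by decide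

lemma abs_le_one_of_mem_stencil {kl : ℤ × ℤ} (h : kl ∈ stencil) :
    |(kl.1 : ℝ)| ≤ 1 ∧ |(kl.2 : ℝ)| ≤ 1 := by
  simp only [stencil, Finset.mem_product, Finset.mem_Icc] at h
  obtain ⟨⟨h1, h2⟩, h3, h4⟩ := h
  exact ⟨abs_le.2 ⟨by exact_mod_cast h1, by exact_mod_cast h2⟩,
    abs_le.2 ⟨by exact_mod_cast h3, by exact_mod_cast h4⟩⟩

lemma dist_node_le {c b : ℝ × ℝ} {h : ℝ} (h0 : 0 < h) (h1 : |c.1 - b.1| < h)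
    (h2 : |c.2 - b.2| < h) {kl : ℤ × ℤ} (hkl : kl ∈ stencil) : dist (node c h kl) b ≤ 2 * h := by
  obtain ⟨k1, k2⟩ := abs_le_one_of_mem_stencil hkl
  have aux : ∀ x y k : ℝ, |x - y| < h → |k| ≤ 1 → |x + k * h - y| ≤ 2 * h := by
    intro x y k hxy hk
    have : |x + k * h - y| ≤ |x - y| + |k| * h := by
      rw [show x + k * h - y = (x - y) + k * h by ring]
      refine (abs_add_le _ _).trans (le_of_eq ?_)
      rw [abs_mul, abs_of_pos h0]
    nlinarith
  rw [Prod.dist_eq, Real.dist_eq, Real.dist_eq]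
  exact max_le (aux _ _ _ h1 k1) (aux _ _ _ h2 k2)

namespace Problem

variable {P : Problem}

lemma IsSolution.nodeValue_plus (hP : P.Admissible) {u : ℝ × ℝ → ℝ} (hu : P.IsSolution u)
    {p : ℝ × ℝ} (hp : p ∈ P.Om) (h : 0 ≤ P.ψ p) :
    p ∈ P.OmP ∪ P.Gam ∧ P.nodeValue u p = sideJet P.OmP u p 0 0 := by
  rcases h.eq_or_lt with h | h
  · exact ⟨Or.inr ⟨hp, h.symm⟩, by rw [nodeValue, if_pos h.symm]; rfl⟩
  · refine ⟨Or.inl ⟨hp, h⟩, ?_⟩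
    rw [nodeValue, if_neg h.ne', (hu.smoothUpTo hP isSide_plus).sideJet_of_mem
      (hP.isOpen_side isSide_plus) (by norm_num) ⟨hp, h⟩]
    rfl

lemma IsSolution.nodeValue_minus (hP : P.Admissible) {u : ℝ × ℝ → ℝ} (hu : P.IsSolution u)
    {p : ℝ × ℝ} (hp : p ∈ P.Om) (h : P.ψ p < 0) :
    p ∈ P.OmM ∪ P.Gam ∧ P.nodeValue u p = sideJet P.OmM u p 0 0 := by
  refine ⟨Or.inl ⟨hp, h⟩, ?_⟩
  rw [nodeValue, if_neg h.ne, (hu.smoothUpTo hP isSide_minus).sideJet_of_mem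
    (hP.isOpen_side isSide_minus) (by norm_num) ⟨hp, h⟩]
  rfl

lemma sum_stencil (c : ℝ × ℝ) (h : ℝ) (F : ℤ × ℤ → ℝ) :
    ∑ kl ∈ stencil, F kl = ∑ kl ∈ P.dPlus c h, F kl + ∑ kl ∈ P.dMinus c h, F kl := by
  classical
  rw [dPlus, dMinus, ← Finset.sum_filter_add_sum_filter_not stencil
    (fun kl => 0 ≤ P.ψ (node c h kl))]
  simp only [not_le]

/-- The error estimate with the constants `A` and `h₀`, for base points in `V`. -/
def Estimate (P : Problem) (u : ℝ × ℝ → ℝ) (B A h₀ : ℝ) (V : Set (ℝ × ℝ)) : Prop :=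
  ∀ (h : ℝ) (c b : ℝ × ℝ) (r s : ℝ → ℝ) (ε : ℝ), 0 < h → h < h₀ → 0 ≤ P.ψ c →
    b ∈ P.Gam → b ∈ V → |c.1 - b.1| < h → |c.2 - b.2| < h →
    P.IsParam b r s ε → ParamBound B r s →
    (∀ kl ∈ stencil, node c h kl ∈ P.Om) ∧
    ∀ (U : ℤ × ℤ → ℝ) (δ : ℝ), (∀ kl ∈ stencil, |U kl - P.nodeValue u (node c h kl)| ≤ δ) →
      ∀ (e : ℝ × ℝ), |e.1| ≤ 1 → |e.2| ≤ 1 → ∀ C : ℤ × ℤ → Polynomial ℝ,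
        (P.split c b h r s).IsNontrivialSolution C e → CoeffBound B C →
        |P.gradApprox c b h r s C e U
          - (sideJet P.OmP u c 1 0 * e.1 + sideJet P.OmP u c 0 1 * e.2)| ≤ A * (h ^ 3 + δ / h)

lemma Estimate.mono {u : ℝ × ℝ → ℝ} {B A A' h₀ h₀' : ℝ} {V V' : Set (ℝ × ℝ)}
    (H : P.Estimate u B A h₀ V) (hA : A ≤ A') (hh : h₀' ≤ h₀) (hV : V' ⊆ V) :
    P.Estimate u B A' h₀' V' := by
  intro h c b r s ε h1 h2 h3 h4 h5 h6 h7 h8 h9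
  obtain ⟨H1, H2⟩ := H h c b r s ε h1 (h2.trans_le hh) h3 h4 (hV h5) h6 h7 h8 h9
  refine ⟨H1, fun U δ hU e he1 he2 C hC hCB => (H2 U δ hU e he1 he2 C hC hCB).trans ?_⟩
  have hδ : 0 ≤ δ := (abs_nonneg _).trans (hU (0, 0) (by decide))
  gcongr

lemma dist_center_le {c b : ℝ × ℝ} {h : ℝ} (h1 : |c.1 - b.1| < h) (h2 : |c.2 - b.2| < h) :
    dist c b ≤ h := by
  rw [Prod.dist_eq, Real.dist_eq, Real.dist_eq]
  exact max_le h1.le h2.le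

lemma split_rel {c b : ℝ × ℝ} {h : ℝ} (h0 : h ≠ 0) (r s : ℝ → ℝ) (kl : ℤ × ℤ) :
    (P.split c b h r s).rel h kl = node c h kl - b := by
  ext <;> simp [Split.rel, split, node, h0] <;> ring

lemma split_center {c b : ℝ × ℝ} {h : ℝ} (h0 : h ≠ 0) (r s : ℝ → ℝ) :
    ((P.split c b h r s).v₀ * h, (P.split c b h r s).w₀ * h) = c - b := by
  ext <;> simp [split, h0]

/-- Near `b₀` every ingredient is uniform in the base point: the Taylor remainders of `u_±`, `u_x`
and `u_y`, the bounds on `a_±`, `1/a_±` and the jet of `u_+`, and the residuals. The error identity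
then adds them up. -/
theorem IsSolution.exists_estimate (hP : P.Admissible) {u : ℝ × ℝ → ℝ} (hu : P.IsSolution u)
    (B : ℝ) {b₀ : ℝ × ℝ} (hb₀ : b₀ ∈ P.Gam) :
    ∃ ρ, 0 < ρ ∧ ∃ A, 0 < A ∧ ∃ h₀, 0 < h₀ ∧ P.Estimate u B A h₀ (Metric.ball b₀ ρ) := by
  have uP := hu.smoothUpTo hP isSide_plus
  have uM := hu.smoothUpTo hP isSide_minus
  have aP := hP.smooth_a isSide_plus 2
  have aM := hP.smooth_a isSide_minus 2
  have clP := hP.Gam_subset_closure isSide_plus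
  have clM := hP.Gam_subset_closure isSide_minus
  obtain ⟨C₁, hC₁, ρ₁, hρ₁, T₁⟩ := hP.taylor isSide_plus hb₀ 0 0 3 (uP.mono (by norm_num))
  obtain ⟨C₂, hC₂, ρ₂, hρ₂, T₂⟩ := hP.taylor isSide_minus hb₀ 0 0 3 (uM.mono (by norm_num))
  obtain ⟨C₃, hC₃, ρ₃, hρ₃, T₃⟩ := hP.taylor isSide_plus hb₀ 1 0 2 (uP.mono (by norm_num))
  obtain ⟨C₄, hC₄, ρ₄, hρ₄, T₄⟩ := hP.taylor isSide_plus hb₀ 0 1 2 (uP.mono (by norm_num))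
  simp only [zero_add] at T₁ T₂ T₃ T₄
  obtain ⟨M₁, hM₁, E₁⟩ := exists_eventually_abs_le hb₀ (Lam 2)
    (x := fun q b => sideJet P.OmP P.a b q.1 q.2) fun q hq => aP.continuousOn (mem_Lam.1 hq) clP
  obtain ⟨M₂, hM₂, E₂⟩ := exists_eventually_abs_le hb₀ (Lam 2)
    (x := fun q b => sideJet P.OmM P.a b q.1 q.2) fun q hq => aM.continuousOn (mem_Lam.1 hq) clM
  -- A one-point index set applies the bound for finite families to a single function.
  obtain ⟨M₃, hM₃, E₃⟩ := exists_eventually_abs_le hb₀ {()}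
    (x := fun _ b => (sideJet P.OmP P.a b 0 0)⁻¹) fun _ _ =>
      (aP.continuousOn (m := 0) (n := 0) (by norm_num) clP).inv₀ fun b hb =>
        (hP.side_pos isSide_plus hb).ne'
  obtain ⟨M₄, hM₄, E₄⟩ := exists_eventually_abs_le hb₀ {()}
    (x := fun _ b => (sideJet P.OmM P.a b 0 0)⁻¹) fun _ _ =>
      (aM.continuousOn (m := 0) (n := 0) (by norm_num) clM).inv₀ fun b hb =>
        (hP.side_pos isSide_minus hb).ne'
  obtain ⟨M₅, hM₅, E₅⟩ := exists_eventually_abs_le hb₀ (Lam1 3)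
    (x := fun q b => sideJet P.OmP u b q.1 q.2) fun q hq =>
      uP.continuousOn ((mem_Lam1.1 hq).1.trans (by norm_num)) clP
  obtain ⟨ρ₅, hρ₅, hE⟩ := Metric.mem_nhdsWithin_iff.1
    (E₁.and (E₂.and (E₃.and (E₄.and E₅))))
  obtain ⟨ρ₆, hρ₆, hΩ⟩ := Metric.mem_nhds_iff.1 (isOpen_Om.mem_nhds hb₀.1)
  set M := M₁ + M₂ + M₃ + M₄ with hM
  obtain ⟨A₁, hA₁, hres⟩ := exists_residual_bound B M
  set ρ := min (min ρ₁ ρ₂) (min (min ρ₃ ρ₄) (min ρ₅ ρ₆)) with hρ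
  have hρ0 : 0 < ρ := by positivity
  have l₁ : ρ ≤ ρ₁ := (min_le_left _ _).trans (min_le_left _ _)
  have l₂ : ρ ≤ ρ₂ := (min_le_left _ _).trans (min_le_right _ _)
  have l₃ : ρ ≤ ρ₃ := (min_le_right _ _).trans ((min_le_left _ _).trans (min_le_left _ _))
  have l₄ : ρ ≤ ρ₄ := (min_le_right _ _).trans ((min_le_left _ _).trans (min_le_right _ _))
  have l₅ : ρ ≤ ρ₅ := (min_le_right _ _).trans ((min_le_right _ _).trans (min_le_left _ _))
  have l₆ : ρ ≤ ρ₆ := (min_le_right _ _).trans ((min_le_right _ _).trans (min_le_right _ _))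
  clear_value ρ
  -- Nine nodes with `|C_{k,ℓ}(h)| ≤ 4|B|` give `36 |B|`, and `16` comes from `(2h)⁴`, as the nodes
  -- are within `2h` of `b`. The `7` counts the residuals, `C₃ + C₄` comes from the derivative at
  -- the centre, and `1` makes the constant positive. For `h < ρ/4` the nodes stay within `ρ` of
  -- `b₀`.
  refine ⟨ρ / 2, by positivity, 36 * |B| * (1 + 16 * (C₁ + C₂)) + 7 * (M₅ * A₁) + (C₃ + C₄) + 1,
    by positivity, min 1 (ρ / 4), by positivity, ?_⟩
  intro h c b r s ε h0 hlt hψc hb hbV hc1 hc2 hpar hpb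
  have h1 : h ≤ 1 := hlt.le.trans (min_le_left _ _)
  have h4 : h < ρ / 4 := hlt.trans_le (min_le_right _ _)
  have hbd : dist b b₀ < ρ / 2 := hbV
  have hnode : ∀ kl ∈ stencil, dist (node c h kl) b ≤ 2 * h := fun kl hkl =>
    dist_node_le h0 hc1 hc2 hkl
  have hOm : ∀ p, dist p b ≤ 2 * h → p ∈ P.Om := fun p hp => hΩ (by
    rw [Metric.mem_ball]; linarith [dist_triangle p b b₀])
  refine ⟨fun kl hkl => hOm _ (hnode kl hkl), fun U δ hU e he1 he2 C hC hCB => ?_⟩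
  have hδ : 0 ≤ δ := (abs_nonneg _).trans (hU (0, 0) (by decide))
  have hcb : dist c b ≤ h := dist_center_le hc1 hc2
  have hcP := (hu.nodeValue_plus hP (hOm c (by linarith)) hψc).1
  obtain ⟨b1, b2, b3, b4, b5⟩ := hE ⟨show dist b b₀ < ρ₅ by linarith, hb⟩
  set S := P.split c b h r s with hS
  have hv : ∀ x : ℝ, |x| < h → |x / h| ≤ 1 := fun x hx => by
    rw [abs_div, abs_of_pos h0, div_le_one h0]; exact hx.le
  have hctrl : Controlled B M (S, C, e) :=
    { split :=
        { smooth := hpar.smooth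
          param := hpb
          αP := fun q hq => (b1 q hq).trans (by rw [hM]; linarith)
          αM := fun q hq => (b2 q hq).trans (by rw [hM]; linarith)
          αP_inv := (b3 () (by simp)).trans (by rw [hM]; linarith)
          αM_inv := (b4 () (by simp)).trans (by rw [hM]; linarith)
          v₀ := hv _ hc1
          w₀ := hv _ hc2
          dP := Finset.filter_subset _ _
          dM := Finset.filter_subset _ _ }
      degree := hC.degree
      coeff := hCB
      fst := he1
      snd := he2
      system := hC.system }
  have hid := S.mul_gradFormula C e h0.ne' U (P.jetData u b) (sideJet P.OmM u b)
    (sum_stencil c h) (fun q _ => hu.reduced hP isSide_plus hb q)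
    (fun q _ => hu.reduced hP isSide_minus hb q) (fun k hk => hu.minusJet_eq hP hb hpar hk)
  set X := 4 * |B| * (δ + 16 * (C₁ + C₂) * h ^ 4) with hX
  have hev : ∀ kl ∈ stencil, |(C kl).eval h| ≤ 4 * |B| := fun kl hkl =>
    (abs_eval_le hCB hkl (hC.degree kl hkl) h0.le h1).trans (by gcongr; exact le_abs_self B)
  have hpow : ∀ kl ∈ stencil, dist (node c h kl) b ^ (3 + 1) ≤ 16 * h ^ 4 := fun kl hkl => by
    calc dist (node c h kl) b ^ (3 + 1) ≤ (2 * h) ^ (3 + 1) :=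
          pow_le_pow_left₀ dist_nonneg (hnode kl hkl) _
      _ = 16 * h ^ 4 := by ring
  have hXP : ∀ kl ∈ S.dP, |(C kl).eval h * (U kl - taylorPoly 3 (P.jetData u b).uP (S.rel h kl))|
      ≤ X := by
    intro kl hkl
    obtain ⟨hkl1, hkl2⟩ := Finset.mem_filter.1 hkl
    obtain ⟨m1, m2⟩ := hu.nodeValue_plus hP (hOm _ (hnode kl hkl1)) hkl2
    have t := T₁ b hb (by linarith) _ m1 (by linarith [hnode kl hkl1])
    have hUk := hU kl hkl1
    rw [m2] at hUk
    rw [split_rel h0.ne', abs_mul, hX]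
    refine mul_le_mul (hev kl hkl1) ?_ (abs_nonneg _) (by positivity)
    have t2 : C₁ * dist (node c h kl) b ^ (3 + 1) ≤ (C₁ + C₂) * (16 * h ^ 4) :=
      mul_le_mul (by linarith) (hpow kl hkl1) (by positivity) (by positivity)
    refine (abs_sub_le _ (sideJet P.OmP u (node c h kl) 0 0) _).trans ?_
    have t3 : |sideJet P.OmP u (node c h kl) 0 0
        - taylorPoly 3 (P.jetData u b).uP (node c h kl - b)| ≤ _ := t
    linarith
  have hXM : ∀ kl ∈ S.dM, |(C kl).eval h * (U kl - taylorPoly 3 (sideJet P.OmM u b) (S.rel h kl))|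
      ≤ X := by
    intro kl hkl
    obtain ⟨hkl1, hkl2⟩ := Finset.mem_filter.1 hkl
    obtain ⟨m1, m2⟩ := hu.nodeValue_minus hP (hOm _ (hnode kl hkl1)) hkl2
    have t := T₂ b hb (by linarith) _ m1 (by linarith [hnode kl hkl1])
    have hUk := hU kl hkl1
    rw [m2] at hUk
    rw [split_rel h0.ne', abs_mul, hX]
    refine mul_le_mul (hev kl hkl1) ?_ (abs_nonneg _) (by positivity)
    have t2 : C₂ * dist (node c h kl) b ^ (3 + 1) ≤ (C₁ + C₂) * (16 * h ^ 4) :=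
      mul_le_mul (by linarith) (hpow kl hkl1) (by positivity) (by positivity)
    refine (abs_sub_le _ (sideJet P.OmM u (node c h kl) 0 0) _).trans ?_
    have t3 : |sideJet P.OmM u (node c h kl) 0 0
        - taylorPoly 3 (sideJet P.OmM u b) (node c h kl - b)| ≤ _ := t
    linarith
  have hsumX : ∑ kl ∈ S.dP, X + ∑ kl ∈ S.dM, X = 9 * X := by
    have := (sum_stencil (P := P) c h fun _ => X).symm
    rw [Finset.sum_const (s := stencil), card_stencil] at this
    exact this.trans (by simp)
  have e1 := (Finset.abs_sum_le_sum_abs _ _).trans (Finset.sum_le_sum hXP)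
  have e2 := (Finset.abs_sum_le_sum_abs _ _).trans (Finset.sum_le_sum hXM)
  have e3 : |∑ q ∈ Lam1 3, (P.jetData u b).uP q.1 q.2 * S.I C e q.1 q.2 h|
      ≤ 7 * (M₅ * (A₁ * h ^ 4)) := by
    refine (Finset.abs_sum_le_sum_abs _ _).trans ((Finset.sum_le_sum
      (g := fun _ => M₅ * (A₁ * h ^ 4)) fun q hq => ?_).trans (le_of_eq ?_))
    · rw [abs_mul]
      exact mul_le_mul (b5 q hq) (hres (S, C, e) hctrl q hq h h0 h1) (abs_nonneg _) hM₅
    · rw [Finset.sum_const, show (Lam1 3).card = 7 by decide]; simp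
  -- The gradient of the cubic polynomial is the quadratic Taylor polynomial of the gradient, with
  -- error `O(h³)`; the factor `h` in `directional` restores the fourth order.
  have e4 : |S.directional e (taylorPoly 3 (P.jetData u b).uP) h
      - h * (sideJet P.OmP u c 1 0 * e.1 + sideJet P.OmP u c 0 1 * e.2)|
      ≤ h * ((C₃ + C₄) * h ^ 3) := by
    have t1 := T₃ b hb (by linarith) c hcP (by linarith)
    have t2 := T₄ b hb (by linarith) c hcP (by linarith)
    have d3 : dist c b ^ (2 + 1) ≤ h ^ 3 := pow_le_pow_left₀ dist_nonneg hcb _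
    replace t1 := t1.trans (mul_le_mul_of_nonneg_left d3 hC₃)
    replace t2 := t2.trans (mul_le_mul_of_nonneg_left d3 hC₄)
    simp only [add_comm 1] at t1 t2
    rw [Split.directional, split_center h0.ne', dX_taylorPoly, dY_taylorPoly, ← mul_sub, abs_mul,
      abs_of_pos h0]
    refine mul_le_mul_of_nonneg_left ?_ h0.le
    simp only [jetData]
    rw [abs_sub_comm] at t1 t2
    generalize taylorPoly 2 (fun i j => sideJet P.OmP u b (i + 1) j) (c - b) = x at *
    generalize taylorPoly 2 (fun i j => sideJet P.OmP u b i (j + 1)) (c - b) = y at *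
    have k1 := mul_le_mul t1 he1 (abs_nonneg _) (by positivity)
    have k2 := mul_le_mul t2 he2 (abs_nonneg _) (by positivity)
    rw [← abs_mul] at k1 k2
    calc _ = |(x - sideJet P.OmP u c 1 0) * e.1 + (y - sideJet P.OmP u c 0 1) * e.2| := by
          congr 1; ring
      _ ≤ _ := abs_add_le _ _
      _ ≤ _ := add_le_add k1 k2
      _ = _ := by ring
  -- All terms are compared after multiplication by `h`, where they are `O(h⁴ + δ)`; dividing by `h`
  -- at the end gives `h³ + δ/h`.
  have hmain : |h * (P.gradApprox c b h r s C e U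
      - (sideJet P.OmP u c 1 0 * e.1 + sideJet P.OmP u c 0 1 * e.2))|
      ≤ 9 * X + 7 * (M₅ * (A₁ * h ^ 4)) + h * ((C₃ + C₄) * h ^ 3) := by
    have hid' : h * P.gradApprox c b h r s C e U = _ := hid
    rw [mul_sub, hid', add_sub_assoc]
    refine (abs_add_le _ _).trans (add_le_add ?_ e4)
    refine (abs_add_le _ _).trans (add_le_add ?_ e3)
    refine (abs_add_le _ _).trans ?_
    linarith
  rw [abs_mul, abs_of_pos h0] at hmain
  refine le_of_mul_le_mul_left (hmain.trans ?_) h0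
  have hh : h * (h ^ 3 + δ / h) = h ^ 4 + δ := by field_simp
  rw [show ∀ A : ℝ, h * (A * (h ^ 3 + δ / h)) = A * (h * (h ^ 3 + δ / h)) from fun A => by ring, hh,
    hX]
  have p1 : 0 ≤ |B| * h ^ 4 := by positivity
  have p2 : 0 ≤ |B| * (C₁ + C₂) * δ := by positivity
  have p3 : 0 ≤ M₅ * A₁ * δ := by positivity
  have p4 : 0 ≤ (C₃ + C₄) * δ := by positivity
  have p5 : 0 ≤ h ^ 4 := by positivity
  nlinarith

/-- The zero set of `ψ` in `K` is compact, being closed in `K`. The existence of constants passes to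
subsets, and to unions of two sets with the larger `A` and the smaller `h₀`, so the local estimates
suffice. -/
theorem IsSolution.exists_estimate_of_isCompact (hP : P.Admissible) {u : ℝ × ℝ → ℝ}
    (hu : P.IsSolution u) (B : ℝ) {K : Set (ℝ × ℝ)} (hK : IsCompact K) (hKΩ : K ⊆ P.Om) :
    ∃ A, 0 < A ∧ ∃ h₀, 0 < h₀ ∧ P.Estimate u B A h₀ (K ∩ P.ψ ⁻¹' {0}) := by
  have hcl : IsClosed (K ∩ P.ψ ⁻¹' {0}) :=
    (hP.smooth_psi.continuousOn.mono hKΩ).preimage_isClosed_of_isClosed hK.isClosed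
      isClosed_singleton
  refine (hK.of_isClosed_subset hcl inter_subset_left).induction_on
    (p := fun V => ∃ A, 0 < A ∧ ∃ h₀, 0 < h₀ ∧ P.Estimate u B A h₀ V) ?_ ?_ ?_ ?_
  · exact ⟨1, one_pos, 1, one_pos, fun _ _ _ _ _ _ _ _ _ _ hV => absurd hV (notMem_empty _)⟩
  · rintro V V' hV ⟨A, hA, h₀, hh, H⟩
    exact ⟨A, hA, h₀, hh, H.mono le_rfl le_rfl hV⟩
  · rintro V V' ⟨A, hA, h₀, hh, H⟩ ⟨A', hA', h₀', hh', H'⟩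
    refine ⟨max A A', lt_max_of_lt_left hA, min h₀ h₀', lt_min hh hh', ?_⟩
    intro h c b r s ε h1 h2 h3 h4 h5
    rcases h5 with h5 | h5
    · exact H.mono (le_max_left _ _) (min_le_left _ _) subset_rfl h c b r s ε h1 h2 h3 h4 h5
    · exact H'.mono (le_max_right _ _) (min_le_right _ _) subset_rfl h c b r s ε h1 h2 h3 h4 h5
  · rintro b₀ ⟨hbK, hb0⟩
    obtain ⟨ρ, hρ, A, hA, h₀, hh, H⟩ := hu.exists_estimate hP B (b₀ := b₀) ⟨hKΩ hbK, hb0⟩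
    exact ⟨_, mem_nhdsWithin_of_mem_nhds (Metric.ball_mem_nhds b₀ hρ), A, hA, h₀, hh, H⟩

end Problem

end

end EllipticInterface

/-! ### The theorem: the directions `(1, 0)` and `(0, 1)` of the estimate -/

theorem mainTheorem6 (P : EllipticInterface.Problem) (hP : P.Admissible)
    (u : ℝ × ℝ → ℝ) (hu : P.IsSolution u)
    (K : Set (ℝ × ℝ)) (hK : IsCompact K) (hKsub : K ⊆ P.Om) (B : ℝ) :
    ∃ A : ℝ, 0 < A ∧ ∃ h₀ : ℝ, 0 < h₀ ∧
      ∀ (h : ℝ) (c b : ℝ × ℝ) (r s : ℝ → ℝ) (ε : ℝ),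
        0 < h → h < h₀ →
        P.IsIrregular c h → 0 ≤ P.ψ c →
        b ∈ P.Gam → b ∈ K → |c.1 - b.1| < h → |c.2 - b.2| < h →
        P.IsParam b r s ε → EllipticInterface.ParamBound B r s →
        (∀ kl ∈ EllipticInterface.stencil, EllipticInterface.node c h kl ∈ P.Om) ∧
        ∀ (U : ℤ × ℤ → ℝ) (δ : ℝ),
          (∀ kl ∈ EllipticInterface.stencil,
            |U kl - P.nodeValue u (EllipticInterface.node c h kl)| ≤ δ) →
          (∀ C : ℤ × ℤ → Polynomial ℝ,
            (P.split c b h r s).IsNontrivialSolution C (1, 0) →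
            EllipticInterface.CoeffBound B C →
            |P.gradApprox c b h r s C (1, 0) U - EllipticInterface.sideJet P.OmP u c 1 0|
              ≤ A * (h ^ 3 + δ / h)) ∧
          (∀ C : ℤ × ℤ → Polynomial ℝ,
            (P.split c b h r s).IsNontrivialSolution C (0, 1) →
            EllipticInterface.CoeffBound B C →
            |P.gradApprox c b h r s C (0, 1) U - EllipticInterface.sideJet P.OmP u c 0 1|
              ≤ A * (h ^ 3 + δ / h)) := by
  obtain ⟨A, hA, h₀, hh₀, H⟩ := hu.exists_estimate_of_isCompact hP B hK hKsub
  refine ⟨A, hA, h₀, hh₀, fun h c b r s ε h1 h2 _ hψ hb hbK hc1 hc2 hpar hpb => ?_⟩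
  obtain ⟨H1, H2⟩ := H h c b r s ε h1 h2 hψ hb ⟨hbK, hb.2⟩ hc1 hc2 hpar hpb
  refine ⟨H1, fun U δ hU => ⟨fun C hC hCB => ?_, fun C hC hCB => ?_⟩⟩
  · simpa using H2 U δ hU (1, 0) (by simp) (by simp) C hC hCB
  · simpa using H2 U δ hU (0, 1) (by simp) (by simp) C hC hCB
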